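/- **Mixed Lie algebras.** A mixed Lie algebra is a graded Lie algebra $\mathfrak g=\bigoplus_{n\ge1}\mathfrak g_n$ over $\mathbb F_2$ together with maps $P:\mathfrak g_n\to\mathfrak g_{n+1}$ ($n\ge1$) such that, for $\xi,\xi'\in\mathfrak g_k$ and $\eta\in\mathfrak g_n$, $$P(\xi+\xi')=\begin{cases}P\xi+P\xi'+[\xi,\xi'] & k=1,\\ P\xi+P\xi' & k>1,\end{cases}\qquad [P\xi,\eta]=\begin{cases}P[\xi,\eta]+[\xi,[\xi,\eta]] & k=1,\\ P[\xi,\eta] & k>1.\end{cases}$$ Then $\mathfrak g^+=\bigoplus_{n>1}\mathfrak g_n$ is a Lie algebra over $\mathbb F_2[\pi]$, where $\pi$ acts as the linear extension of $P$. Let $X=\{\xi_1,\dots,\xi_d\}$ be a finite weighted set, $\xi_i$ having an integer weight $\tau_i\ge1$, numbered so that $\xi_1,\dots,\xi_m$ are exactly the elements of weight $1$. Let $L=L_{\rm mix}(X)$ be the free mixed Lie algebra on $X$ ($\xi_i$ being homogeneous of degree $\tau_i$), and $L^+(X)=L^+=\bigoplus_{n>1}L_n$. Let $A=A(X)$ be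 the free associative $\mathbb F_2[\pi]$-algebra on $X$, graded so that $\xi_i$ has degree $\tau_i$ and multiplication by $\pi$ raises degrees by $1$. Then $A_+=\bigoplus_{n>0}A_n$ is a mixed Lie algebra for the commutator bracket and $P\xi=\pi\xi+\xi^2$ for $\xi$ of degree $1$, $P\xi=\pi\xi$ for $\xi$ homogeneous of degree $>1$. Elements of $L$ are regarded as elements of $A$ through the canonical homomorphism of mixed Lie algebras $L\to A_+$, $\xi_i\mapsto\xi_i$. **Theorem 2.3.** $L^+(X)$ is a free Lie algebra over $\mathbb F_2[\pi]$. As a free Lie algebra it has a basis (free generating family) $Y$ of homogeneous elements consisting of 1. the $\binom{m+1}{2}$ elements $P\xi_1,\dots,P\xi_m$ and $[\xi_i,\xi_j]$ ($1\le i<j\le m$); 2. the elements $\xi_{m+1},\dots,\xi_d$ and $[\xi_i,\xi_j]$ ($1\le i\le m$, $m+1\le j\le d$); 3. for $k\ge3$, the $(k-1)\binom{m}{k-1}$ commutators $\mathrm{ad}(\xi_{i_1})\cdots\mathrm{ad}(\xi_{i_{k-3}})\,\mathrm{ad}(\xi_j)^2(\xi_{i_{k-2}})$, where $m\ge i_1>\cdots>i_{k-2}\ge1$,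 $1\le j\le m$, $j\ne i_1,\dots,i_{k-2}$; 4. for $k\ge3$, the $(k-1)\binom{m}{k}$ commutators $\mathrm{ad}(\xi_{i_1})\cdots\mathrm{ad}(\xi_{i_{k-1}})(\xi_{i_k})$, where $m\ge i_1>\cdots>i_{k-1}\ge1$, $i_{k-1}<i_k\le m$, $i_k\ne i_1,\dots,i_{k-2}$; 5. for $k\ge3$, the $\binom{m}{k-1}(d-m)$ commutators $\mathrm{ad}(\xi_{i_1})\cdots\mathrm{ad}(\xi_{i_{k-1}})(\xi_{i_k})$, where $m\ge i_1>\cdots>i_{k-1}\ge1$, $m<i_k\le d$. The weights are $2$ for the elements of (1), $\tau_j$ and $1+\tau_j$ for those of (2), $k$ for those of (3) and (4), and $k-1+\tau_{i_k}$ for those of (5). If $B$ is the $\mathbb F_2[\pi]$-subalgebra of $A$ generated by $Y$, then $B$ is the free associative $\mathbb F_2[\pi]$-algebra on the weighted set $Y$. Moreover $A$ is a free $B$-module, both as a left and as a right module, with basis the $2^m$ products $\xi_1^{e_1}\cdots\xi_m^{e_m}$, $e_i\in\{0,1\}$. -/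

import Mathlib

open scoped DirectSum Polynomial

universe u v w

/-- A mixed Lie algebra (for the prime 2): a Lie algebra over `𝔽₂` graded by the positive integers,
with an operator `P` raising degrees by one.  The component of degree `n` is `comp n`.  The bracket
and `P` carry a proof of the equation between degrees, so that no transport is needed to compare
elements of the components of degree `(l + m) + n` and `l + (m + n)`. -/
structure MixedLieAlgebra where
  comp : ℕ+ → Type u
  [instAddCommGroup : ∀ n, AddCommGroup (comp n)]
  [instModule : ∀ n, Module (ZMod 2) (comp n)]
  lie : ∀ {m n k : ℕ+}, m + n = k → comp m → comp n → comp k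
  P : ∀ {n k : ℕ+}, n + 1 = k → comp n → comp k
  lie_add_right : ∀ {m n k : ℕ+} (h : m + n = k) (a : comp m) (b c : comp n),
    lie h a (b + c) = lie h a b + lie h a c
  lie_add_left : ∀ {m n k : ℕ+} (h : m + n = k) (a b : comp m) (c : comp n),
    lie h (a + b) c = lie h a c + lie h b c
  lie_eq_zero : ∀ {n k : ℕ+} (h : n + n = k) (a : comp n), lie h a a = 0
  lie_swap : ∀ {m n k : ℕ+} (h : m + n = k) (h' : n + m = k) (a : comp m) (b : comp n),
    lie h a b = -lie h' b a
  lie_leibniz : ∀ {l m n p q r k : ℕ+} (h₁ : m + n = p) (h₂ : l + p = k) (h₃ : l + m = q)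
    (h₄ : q + n = k) (h₅ : l + n = r) (h₆ : m + r = k) (a : comp l) (b : comp m) (c : comp n),
    lie h₂ a (lie h₁ b c) = lie h₄ (lie h₃ a b) c + lie h₆ b (lie h₅ a c)
  /-- `P(ξ + η) = Pξ + Pη + [ξ, η]` in degree `1`. -/
  P_add_one : ∀ {k : ℕ+} (h : 1 + 1 = k) (a b : comp 1), P h (a + b) = P h a + P h b + lie h a b
  /-- `P(ξ + η) = Pξ + Pη` in degrees `> 1`. -/
  P_add : ∀ {n k : ℕ+} (_ : 1 < n) (h : n + 1 = k) (a b : comp n), P h (a + b) = P h a + P h b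
  /-- `[Pξ, η] = P[ξ, η] + [ξ, [ξ, η]]` if `ξ` has degree `1`. -/
  P_lie_one : ∀ {n p q k : ℕ+} (h₁ : 1 + 1 = p) (h₂ : p + n = k) (h₃ : 1 + n = q)
    (h₄ : q + 1 = k) (h₅ : 1 + q = k) (a : comp 1) (b : comp n),
    lie h₂ (P h₁ a) b = P h₄ (lie h₃ a b) + lie h₅ a (lie h₃ a b)
  /-- `[Pξ, η] = P[ξ, η]` if `ξ` has degree `> 1`. -/
  P_lie : ∀ {m n p q k : ℕ+} (_ : 1 < m) (h₁ : m + 1 = p) (h₂ : p + n = k) (h₃ : m + n = q)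
    (h₄ : q + 1 = k) (a : comp m) (b : comp n),
    lie h₂ (P h₁ a) b = P h₄ (lie h₃ a b)

namespace MixedLieAlgebra

attribute [instance] instAddCommGroup instModule

noncomputable section

/-- Homomorphisms of mixed Lie algebras. -/
@[ext]
structure Hom (𝔤 : MixedLieAlgebra.{u}) (𝔥 : MixedLieAlgebra.{v}) where
  map : ∀ n, 𝔤.comp n →+ 𝔥.comp n
  map_lie : ∀ {m n k : ℕ+} (h : m + n = k) (a : 𝔤.comp m) (b : 𝔤.comp n),
    map k (𝔤.lie h a b) = 𝔥.lie h (map m a) (map n b)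
  map_P : ∀ {n k : ℕ+} (h : n + 1 = k) (a : 𝔤.comp n), map k (𝔤.P h a) = 𝔥.P h (map n a)

variable (𝔤 : MixedLieAlgebra.{u})

/-! ### The underlying Lie algebra over `𝔽₂` -/

/-- The underlying `𝔽₂`-Lie algebra `⨁ₙ 𝔤ₙ` of a mixed Lie algebra. -/
abbrev Total : Type u := ⨁ n, 𝔤.comp n

/-- The inclusion of the component of degree `n`. -/
def of (n : ℕ+) : 𝔤.comp n →ₗ[ZMod 2] 𝔤.Total := DirectSum.lof (ZMod 2) ℕ+ 𝔤.comp n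

/-- The projection to the component of degree `n`. -/
def proj (n : ℕ+) : 𝔤.Total →ₗ[ZMod 2] 𝔤.comp n := DirectSum.component (ZMod 2) ℕ+ 𝔤.comp n

variable {𝔤}

theorem proj_of_same (n : ℕ+) (a : 𝔤.comp n) : 𝔤.proj n (𝔤.of n a) = a :=
  DirectSum.component.lof_self (ZMod 2) n a

theorem proj_of_ne {m n : ℕ+} (h : m ≠ n) (a : 𝔤.comp m) : 𝔤.proj n (𝔤.of m a) = 0 :=
  DirectSum.of_eq_of_ne m n a h.symm

theorem induction_total {p : 𝔤.Total → Prop} (x : 𝔤.Total) (zero : p 0)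
    (of : ∀ n (a : 𝔤.comp n), p (𝔤.of n a)) (add : ∀ x y, p x → p y → p (x + y)) : p x :=
  DirectSum.induction_on x zero of add

variable (𝔤)

/-- The bracket of homogeneous elements, with values in the total space. -/
def homogeneousBracket (m n : ℕ+) : 𝔤.comp m →+ 𝔤.comp n →+ 𝔤.Total :=
  AddMonoidHom.mk' (fun a => AddMonoidHom.mk' (fun b => 𝔤.of (m + n) (𝔤.lie rfl a b))
    fun b c => by rw [𝔤.lie_add_right, map_add])
    fun a b => by ext c; simp [𝔤.lie_add_left, map_add]

/-- The bracket on the total space: the biadditive extension of the bracket of homogeneous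
elements. -/
def totalBracket : 𝔤.Total →+ 𝔤.Total →+ 𝔤.Total :=
  DirectSum.toAddMonoid fun m => AddMonoidHom.flip
    (DirectSum.toAddMonoid fun n => (𝔤.homogeneousBracket m n).flip)

instance : Bracket 𝔤.Total 𝔤.Total := ⟨fun x y => 𝔤.totalBracket x y⟩

variable {𝔤}

theorem bracket_of {m n k : ℕ+} (h : m + n = k) (a : 𝔤.comp m) (b : 𝔤.comp n) :
    ⁅𝔤.of m a, 𝔤.of n b⁆ = 𝔤.of k (𝔤.lie h a b) := by
  subst h
  change 𝔤.totalBracket (DirectSum.of 𝔤.comp m a) (DirectSum.of 𝔤.comp n b) = _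
  unfold totalBracket
  rw [DirectSum.toAddMonoid_of, AddMonoidHom.flip_apply, DirectSum.toAddMonoid_of]
  rfl

theorem bracket_add (x y z : 𝔤.Total) : ⁅x, y + z⁆ = ⁅x, y⁆ + ⁅x, z⁆ := map_add (𝔤.totalBracket x) y z

theorem add_bracket (x y z : 𝔤.Total) : ⁅x + y, z⁆ = ⁅x, z⁆ + ⁅y, z⁆ := by
  change 𝔤.totalBracket (x + y) z = _
  rw [map_add]; rfl

theorem bracket_zero (x : 𝔤.Total) : ⁅x, (0 : 𝔤.Total)⁆ = 0 := map_zero (𝔤.totalBracket x)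

theorem zero_bracket (x : 𝔤.Total) : ⁅(0 : 𝔤.Total), x⁆ = 0 := by
  change 𝔤.totalBracket 0 x = _
  rw [map_zero]; rfl

theorem bracket_skew (x y : 𝔤.Total) : ⁅x, y⁆ = -⁅y, x⁆ := by
  induction x using induction_total with
  | zero => rw [zero_bracket, bracket_zero, neg_zero]
  | add x x' hx hx' => rw [add_bracket, bracket_add, hx, hx', neg_add]
  | of m a =>
    induction y using induction_total with
    | zero => rw [zero_bracket, bracket_zero, neg_zero]
    | add y y' hy hy' => rw [add_bracket, bracket_add, hy, hy', neg_add]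
    | of n b =>
      rw [bracket_of rfl, bracket_of (add_comm n m), 𝔤.lie_swap rfl (add_comm n m), map_neg]

theorem bracket_self (x : 𝔤.Total) : ⁅x, x⁆ = 0 := by
  induction x using induction_total with
  | zero => exact bracket_zero 0
  | add x y hx hy => rw [add_bracket, bracket_add, bracket_add, hx, hy, bracket_skew x y]; abel
  | of n a => rw [bracket_of rfl, 𝔤.lie_eq_zero, map_zero]

theorem bracket_leibniz (x y z : 𝔤.Total) : ⁅x, ⁅y, z⁆⁆ = ⁅⁅x, y⁆, z⁆ + ⁅y, ⁅x, z⁆⁆ := by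
  induction x using induction_total with
  | zero => simp only [zero_bracket, bracket_zero, add_zero]
  | add x x' hx hx' => simp only [add_bracket, bracket_add, hx, hx']; abel
  | of l a =>
    induction y using induction_total with
    | zero => simp only [zero_bracket, bracket_zero, add_zero]
    | add y y' hy hy' => simp only [add_bracket, bracket_add, hy, hy']; abel
    | of m b =>
      induction z using induction_total with
      | zero => simp only [bracket_zero, add_zero]
      | add z z' hz hz' => simp only [bracket_add, hz, hz']; abel
      | of n c =>
        rw [bracket_of (m := m) (n := n) rfl, bracket_of (m := l) (n := m) rfl,
          bracket_of (m := l) (n := n) rfl, bracket_of (k := l + (m + n)) rfl,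
          bracket_of (k := l + (m + n)) (add_assoc l m n),
          bracket_of (k := l + (m + n)) (add_left_comm m l n), ← map_add]
        exact congrArg _ (𝔤.lie_leibniz rfl rfl rfl _ rfl _ a b c)

instance : LieRing 𝔤.Total where
  add_lie := add_bracket
  lie_add := bracket_add
  lie_self := bracket_self
  leibniz_lie := bracket_leibniz

instance : LieAlgebra (ZMod 2) 𝔤.Total where
  lie_smul t x y := ZMod.map_smul (𝔤.totalBracket x) t y

theorem proj_one_bracket (x y : 𝔤.Total) : 𝔤.proj 1 ⁅x, y⁆ = 0 := by
  induction x using induction_total with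
  | zero => rw [zero_bracket, map_zero]
  | add x x' hx hx' => rw [add_bracket, map_add, hx, hx', add_zero]
  | of m a =>
    induction y using induction_total with
    | zero => rw [bracket_zero, map_zero]
    | add y y' hy hy' => rw [bracket_add, map_add, hy, hy', add_zero]
    | of n b =>
      rw [bracket_of rfl, proj_of_ne]
      intro h
      have := congrArg PNat.val h
      have h1 := m.pos
      have h2 := n.pos
      simp only [PNat.add_coe, PNat.one_coe] at this
      omega

/-! ### The part of degree `> 1`, a Lie algebra over `𝔽₂[π]` -/

variable (𝔤)

/-- `𝔤⁺ = ⨁_{n > 1} 𝔤ₙ`, the elements without component of degree `1`. -/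
def plus : LieSubalgebra (ZMod 2) 𝔤.Total where
  __ := LinearMap.ker (𝔤.proj 1)
  lie_mem' := fun {x y} _ _ => proj_one_bracket x y

variable {𝔤}

theorem mem_plus {x : 𝔤.Total} : x ∈ 𝔤.plus ↔ 𝔤.proj 1 x = 0 := Iff.rfl

theorem bracket_mem_plus (x y : 𝔤.Total) : ⁅x, y⁆ ∈ 𝔤.plus := proj_one_bracket x y

theorem of_mem_plus {n : ℕ+} (hn : n ≠ 1) (a : 𝔤.comp n) : 𝔤.of n a ∈ 𝔤.plus := proj_of_ne hn a

variable (𝔤)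

/-- The operator `P` on a component of degree `> 1`, a linear map. -/
def PLinear (n : ℕ+) (hn : 1 < n) : 𝔤.comp n →ₗ[ZMod 2] 𝔤.comp (n + 1) :=
  (AddMonoidHom.mk' (fun a => 𝔤.P rfl a) fun a b => 𝔤.P_add hn rfl a b).toZModLinearMap 2

/-- The linear extension of `P` from the components of degree `> 1` (extended by `0` to the
component of degree `1`, which plays no role). -/
def totalP : 𝔤.Total →ₗ[ZMod 2] 𝔤.Total :=
  DirectSum.toModule (ZMod 2) ℕ+ 𝔤.Total fun n =>
    if hn : 1 < n then 𝔤.of (n + 1) ∘ₗ 𝔤.PLinear n hn else 0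

variable {𝔤}

theorem totalP_of {n k : ℕ+} (hn : 1 < n) (h : n + 1 = k) (a : 𝔤.comp n) :
    𝔤.totalP (𝔤.of n a) = 𝔤.of k (𝔤.P h a) := by
  subst h
  have : 𝔤.totalP (𝔤.of n a) =
      (if hn : 1 < n then 𝔤.of (n + 1) ∘ₗ 𝔤.PLinear n hn else 0) a :=
    DirectSum.toModule_lof (ZMod 2) n a
  rw [this, dif_pos hn]; rfl

theorem totalP_of_one (a : 𝔤.comp 1) : 𝔤.totalP (𝔤.of 1 a) = 0 := by
  have : 𝔤.totalP (𝔤.of 1 a) =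
      (if hn : (1 : ℕ+) < 1 then 𝔤.of (1 + 1) ∘ₗ 𝔤.PLinear 1 hn else 0) a :=
    DirectSum.toModule_lof (ZMod 2) 1 a
  rw [this, dif_neg (lt_irrefl _)]; rfl

theorem add_one_ne_one (n : ℕ+) : n + 1 ≠ 1 := by
  intro h
  have := congrArg PNat.val h
  have h1 := n.pos
  simp only [PNat.add_coe, PNat.one_coe] at this
  omega

theorem totalP_mem_plus (x : 𝔤.Total) : 𝔤.totalP x ∈ 𝔤.plus := by
  induction x using induction_total with
  | zero => rw [map_zero]; exact zero_mem _
  | add x y hx hy => rw [map_add]; exact add_mem hx hy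
  | of n a =>
    by_cases hn : 1 < n
    · rw [totalP_of hn rfl]; exact of_mem_plus (add_one_ne_one n) _
    · obtain rfl : n = 1 := le_antisymm (not_lt.mp hn) one_le
      rw [totalP_of_one]; exact zero_mem _

/-- On brackets of homogeneous elements, the second one of degree `> 1`, `P` is linear in the
second variable. -/
theorem lie_P {m n p q k : ℕ+} (hn : 1 < n) (h₁ : n + 1 = p) (h₂ : m + p = k) (h₃ : m + n = q)
    (h₄ : q + 1 = k) (a : 𝔤.comp m) (b : 𝔤.comp n) :
    𝔤.lie h₂ a (𝔤.P h₁ b) = 𝔤.P h₄ (𝔤.lie h₃ a b) := by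
  have neg_self : ∀ {j : ℕ+} (c : 𝔤.comp j), -c = c := fun c => by
    rw [neg_eq_iff_add_eq_zero, ← two_smul (ZMod 2) c, show (2 : ZMod 2) = 0 from rfl, zero_smul]
  rw [𝔤.lie_swap h₂ (by rw [add_comm, h₂]), 𝔤.P_lie hn h₁ _ (by rw [add_comm, h₃]) h₄,
    𝔤.lie_swap h₃ (by rw [add_comm, h₃]), neg_self, neg_self]

theorem bracket_totalP (x y : 𝔤.Total) (hy : y ∈ 𝔤.plus) :
    ⁅x, 𝔤.totalP y⁆ = 𝔤.totalP ⁅x, y⁆ := by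
  have key : ∀ y : 𝔤.Total, ⁅x, 𝔤.totalP y⁆ = 𝔤.totalP ⁅x, y - 𝔤.of 1 (𝔤.proj 1 y)⁆ := by
    intro y
    induction y using induction_total with
    | zero => simp
    | add y y' h h' =>
      rw [map_add, lie_add, h, h', ← map_add, ← lie_add, map_add, map_add]
      congr 2
      abel
    | of n b =>
      by_cases hn : 1 < n
      · rw [proj_of_ne hn.ne', map_zero, sub_zero, totalP_of hn rfl]
        induction x using induction_total with
        | zero => simp
        | add x x' h h' => rw [add_lie, add_lie, map_add, h, h']
        | of m a =>
          rw [bracket_of (k := m + n + 1) (by rw [add_assoc]), bracket_of (k := m + n) rfl,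
            totalP_of (lt_trans hn (n.lt_add_left m)) rfl]
          exact congrArg _ (lie_P hn rfl _ rfl rfl a b)
      · obtain rfl : n = 1 := le_antisymm (not_lt.mp hn) one_le
        rw [proj_of_same, sub_self, totalP_of_one]
        simp
  rw [key y, mem_plus.mp hy, map_zero, sub_zero]

variable (𝔤)

/-- The Lie algebra `𝔤⁺ = ⨁_{n > 1} 𝔤ₙ`, as a type. -/
def Plus : Type u := 𝔤.plus

instance : LieRing 𝔤.Plus := inferInstanceAs (LieRing 𝔤.plus)

instance : Module (ZMod 2) 𝔤.Plus := inferInstanceAs (Module (ZMod 2) 𝔤.plus)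

instance : LieAlgebra (ZMod 2) 𝔤.Plus := inferInstanceAs (LieAlgebra (ZMod 2) 𝔤.plus)

/-- The inclusion `𝔤⁺ ⊆ 𝔤`. -/
def incl : 𝔤.Plus →ₗ⁅ZMod 2⁆ 𝔤.Total := 𝔤.plus.incl

/-- Multiplication by `π` on `𝔤⁺`: the linear extension of `P`. -/
def piPlus : Module.End (ZMod 2) 𝔤.Plus :=
  (𝔤.totalP ∘ₗ 𝔤.plus.toSubmodule.subtype).codRestrict 𝔤.plus.toSubmodule
    fun x => totalP_mem_plus x.1

/-- `𝔤⁺` is a module over `𝔽₂[π]`, where `π` acts as `P`. -/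
instance : Module (ZMod 2)[X] 𝔤.Plus :=
  Module.compHom 𝔤.Plus (Polynomial.aeval (R := ZMod 2) 𝔤.piPlus).toRingHom

variable {𝔤}

theorem smul_def (f : (ZMod 2)[X]) (x : 𝔤.Plus) : f • x = Polynomial.aeval 𝔤.piPlus f x := rfl

theorem X_smul_val (x : 𝔤.Plus) :
    𝔤.incl ((Polynomial.X : (ZMod 2)[X]) • x) = 𝔤.totalP (𝔤.incl x) := by
  rw [smul_def, Polynomial.aeval_X]; rfl

theorem lie_piPlus (x y : 𝔤.Plus) : ⁅x, 𝔤.piPlus y⁆ = 𝔤.piPlus ⁅x, y⁆ :=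
  Subtype.ext (bracket_totalP x.1 y.1 y.2)

instance : LieAlgebra (ZMod 2)[X] 𝔤.Plus where
  lie_smul f x y := by
    induction f using Polynomial.induction_on' with
    | add f g hf hg => rw [add_smul, add_smul, lie_add, hf, hg]
    | monomial n a =>
      have hpow : ∀ n : ℕ, ⁅x, (𝔤.piPlus ^ n) y⁆ = (𝔤.piPlus ^ n) ⁅x, y⁆ := by
        intro n
        induction n with
        | zero => rfl
        | succ n ih =>
          rw [pow_succ', Module.End.mul_apply, Module.End.mul_apply, lie_piPlus, ih]
      rw [smul_def, smul_def, Polynomial.aeval_monomial, Module.End.mul_apply,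
        Module.End.mul_apply, Module.algebraMap_end_apply, Module.algebraMap_end_apply, lie_smul,
        hpow]

/-! ### The mixed Lie algebra of a graded associative `𝔽₂[π]`-algebra -/

/-- If `A = ⨁_{n ≥ 0} Aₙ` is a graded associative algebra over `𝔽₂[π]`, where multiplication by `π`
raises degrees by `1`, then `A₊ = ⨁_{n > 0} Aₙ` is a mixed Lie algebra for the commutator bracket
and `Pξ = πξ + ξ²` in degree `1`, `Pξ = πξ` in degrees `> 1`. -/
def ofGradedAlgebra {A : Type v} [Ring A] [Algebra (ZMod 2) A] [Algebra (ZMod 2)[X] A]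
    (𝒜 : ℕ → Submodule (ZMod 2) A) [SetLike.GradedMonoid 𝒜]
    (hX : ∀ n, ∀ a ∈ 𝒜 n, (Polynomial.X : (ZMod 2)[X]) • a ∈ 𝒜 (n + 1)) :
    MixedLieAlgebra.{v} where
  comp n := 𝒜 n
  lie := fun {m n k} h a b => ⟨a * b - b * a, by
    subst h
    exact sub_mem (SetLike.mul_mem_graded a.2 b.2)
      (by rw [add_comm m n]; exact SetLike.mul_mem_graded b.2 a.2)⟩
  P := fun {n k} h a =>
    ⟨(Polynomial.X : (ZMod 2)[X]) • (a : A) + (if n = 1 then (a : A) * a else 0), by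
      subst h
      refine add_mem (hX n _ a.2) ?_
      split_ifs with hn
      · subst hn; exact SetLike.mul_mem_graded a.2 a.2
      · exact zero_mem _⟩
  lie_add_right h a b c := Subtype.ext (by simp only [Submodule.coe_add]; noncomm_ring)
  lie_add_left h a b c := Subtype.ext (by simp only [Submodule.coe_add]; noncomm_ring)
  lie_eq_zero h a := Subtype.ext (by simp)
  lie_swap h h' a b := Subtype.ext (by simp)
  lie_leibniz _ _ _ _ _ _ a b c :=
    Subtype.ext (by simp only [Submodule.coe_add]; noncomm_ring)
  P_add_one h a b := Subtype.ext (by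
    have neg_self : ∀ c : A, -c = c := fun c => by
      rw [neg_eq_iff_add_eq_zero, ← two_smul (ZMod 2), show (2 : ZMod 2) = 0 from rfl, zero_smul]
    simp only [Submodule.coe_add, if_true, smul_add, mul_add, add_mul, sub_eq_add_neg, neg_self]
    abel)
  P_add hn h a b := Subtype.ext (by
    simp only [Submodule.coe_add, hn.ne', if_false, smul_add]; abel)
  P_lie_one := fun {n p q k} h₁ h₂ h₃ h₄ h₅ a b => Subtype.ext (by
    subst h₁ h₃
    have e1 : (1 : ℕ+) + n ≠ 1 := by rw [add_comm]; exact add_one_ne_one n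
    have neg_self : ∀ c : A, -c = c := fun c => by
      rw [neg_eq_iff_add_eq_zero, ← two_smul (ZMod 2), show (2 : ZMod 2) = 0 from rfl, zero_smul]
    have h2 : (a : A) * (b * a) + a * (b * a) = 0 := by
      rw [← two_smul (ZMod 2), show (2 : ZMod 2) = 0 from rfl, zero_smul]
    simp only [Submodule.coe_add, if_true, e1, if_false, smul_add, add_mul, mul_add,
      sub_eq_add_neg, neg_self, smul_mul_assoc, mul_smul_comm, mul_assoc, add_zero]
    rw [← add_zero (_ + _ + _), ← h2]
    abel)
  P_lie := fun {m n p q k} hm h₁ h₂ h₃ h₄ a b => Subtype.ext (by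
    subst h₁ h₃
    have e1 : m + n ≠ 1 := (lt_trans hm (m.lt_add_right n)).ne'
    simp only [hm.ne', e1, if_false, add_zero, smul_sub, smul_mul_assoc, mul_smul_comm])

end

end MixedLieAlgebra

/-! ### The free mixed Lie algebra on a weighted set -/

namespace FreeMixedLie

variable {ι : Type u} (τ : ι → ℕ+)

/-- Formal homogeneous expressions in generators `i : ι` of weight `τ i`. -/
inductive Word : ℕ+ → Type u
  | gen (i : ι) : Word (τ i)
  | zero (n : ℕ+) : Word n
  | add {n : ℕ+} (a b : Word n) : Word n
  | lie {m n k : ℕ+} (h : m + n = k) (a : Word m) (b : Word n) : Word k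
  | P {n k : ℕ+} (h : n + 1 = k) (a : Word n) : Word k

open Word in
/-- The smallest congruence on formal expressions for which the quotient satisfies the axioms of a
mixed Lie algebra. -/
inductive Rel : ∀ {n : ℕ+}, Word τ n → Word τ n → Prop
  | refl {n : ℕ+} (a : Word τ n) : Rel a a
  | symm {n : ℕ+} {a b : Word τ n} : Rel a b → Rel b a
  | trans {n : ℕ+} {a b c : Word τ n} : Rel a b → Rel b c → Rel a c
  | congr_add {n : ℕ+} {a a' b b' : Word τ n} : Rel a a' → Rel b b' → Rel (add a b) (add a' b')
  | congr_lie {m n k : ℕ+} (h : m + n = k) {a a' : Word τ m} {b b' : Word τ n} :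
      Rel a a' → Rel b b' → Rel (lie h a b) (lie h a' b')
  | congr_P {n k : ℕ+} (h : n + 1 = k) {a a' : Word τ n} : Rel a a' → Rel (P h a) (P h a')
  | add_assoc {n : ℕ+} (a b c : Word τ n) : Rel (add (add a b) c) (add a (add b c))
  | add_comm {n : ℕ+} (a b : Word τ n) : Rel (add a b) (add b a)
  | zero_add {n : ℕ+} (a : Word τ n) : Rel (add (zero n) a) a
  | add_self {n : ℕ+} (a : Word τ n) : Rel (add a a) (zero n)
  | lie_add_right {m n k : ℕ+} (h : m + n = k) (a : Word τ m) (b c : Word τ n) :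
      Rel (lie h a (add b c)) (add (lie h a b) (lie h a c))
  | lie_add_left {m n k : ℕ+} (h : m + n = k) (a b : Word τ m) (c : Word τ n) :
      Rel (lie h (add a b) c) (add (lie h a c) (lie h b c))
  | lie_eq_zero {n k : ℕ+} (h : n + n = k) (a : Word τ n) : Rel (lie h a a) (zero k)
  | lie_swap {m n k : ℕ+} (h : m + n = k) (h' : n + m = k) (a : Word τ m) (b : Word τ n) :
      Rel (lie h a b) (lie h' b a)
  | lie_leibniz {l m n p q r k : ℕ+} (h₁ : m + n = p) (h₂ : l + p = k) (h₃ : l + m = q)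
      (h₄ : q + n = k) (h₅ : l + n = r) (h₆ : m + r = k)
      (a : Word τ l) (b : Word τ m) (c : Word τ n) :
      Rel (lie h₂ a (lie h₁ b c)) (add (lie h₄ (lie h₃ a b) c) (lie h₆ b (lie h₅ a c)))
  | P_add_one {k : ℕ+} (h : 1 + 1 = k) (a b : Word τ 1) :
      Rel (P h (add a b)) (add (add (P h a) (P h b)) (lie h a b))
  | P_add {n k : ℕ+} (hn : 1 < n) (h : n + 1 = k) (a b : Word τ n) :
      Rel (P h (add a b)) (add (P h a) (P h b))
  | P_lie_one {n p q k : ℕ+} (h₁ : 1 + 1 = p) (h₂ : p + n = k) (h₃ : 1 + n = q)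
      (h₄ : q + 1 = k) (h₅ : 1 + q = k) (a : Word τ 1) (b : Word τ n) :
      Rel (lie h₂ (P h₁ a) b) (add (P h₄ (lie h₃ a b)) (lie h₅ a (lie h₃ a b)))
  | P_lie {m n p q k : ℕ+} (hm : 1 < m) (h₁ : m + 1 = p) (h₂ : p + n = k) (h₃ : m + n = q)
      (h₄ : q + 1 = k) (a : Word τ m) (b : Word τ n) :
      Rel (lie h₂ (P h₁ a) b) (P h₄ (lie h₃ a b))

instance setoid (n : ℕ+) : Setoid (Word τ n) := ⟨Rel τ, Rel.refl, Rel.symm, Rel.trans⟩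

/-- The homogeneous component of degree `n` of the free mixed Lie algebra. -/
def Comp (n : ℕ+) : Type u := Quotient (setoid τ n)

variable {τ}

/-- The class of an expression. -/
def mk {n : ℕ+} (a : Word τ n) : Comp τ n := Quotient.mk _ a

theorem mk_eq {n : ℕ+} {a b : Word τ n} (h : Rel τ a b) : mk a = mk b := Quotient.sound h

theorem mk_surjective {n : ℕ+} (x : Comp τ n) : ∃ a, mk a = x := Quotient.exists_rep x

instance (n : ℕ+) : Zero (Comp τ n) := ⟨mk (Word.zero n)⟩

instance (n : ℕ+) : Add (Comp τ n) :=
  ⟨Quotient.map₂ Word.add fun _ _ h _ _ h' => Rel.congr_add h h'⟩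

instance (n : ℕ+) : Neg (Comp τ n) := ⟨id⟩

theorem mk_add {n : ℕ+} (a b : Word τ n) : mk (a.add b) = mk a + mk b := rfl

instance (n : ℕ+) : AddCommGroup (Comp τ n) where
  add_assoc := by rintro ⟨a⟩ ⟨b⟩ ⟨c⟩; exact mk_eq (Rel.add_assoc a b c)
  zero_add := by rintro ⟨a⟩; exact mk_eq (Rel.zero_add a)
  add_zero := by rintro ⟨a⟩; exact mk_eq ((Rel.add_comm _ _).trans (Rel.zero_add a))
  neg_add_cancel := by rintro ⟨a⟩; exact mk_eq (Rel.add_self a)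
  add_comm := by rintro ⟨a⟩ ⟨b⟩; exact mk_eq (Rel.add_comm a b)
  nsmul := nsmulRec
  zsmul := zsmulRec

theorem neg_eq {n : ℕ+} (x : Comp τ n) : -x = x := rfl

instance (n : ℕ+) : Module (ZMod 2) (Comp τ n) :=
  AddCommGroup.zmodModule fun x => by rw [two_nsmul, ← neg_eq_iff_add_eq_zero, neg_eq]

end FreeMixedLie

open FreeMixedLie in
/-- The free mixed Lie algebra `L_mix(X)` on the set `X = {ξ i | i : ι}`, where `ξ i` has weight
`τ i`. -/
def freeMixedLie {ι : Type u} (τ : ι → ℕ+) : MixedLieAlgebra.{u} where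
  comp := Comp τ
  lie h := Quotient.map₂ (Word.lie h) fun _ _ h₁ _ _ h₂ => Rel.congr_lie h h₁ h₂
  P h := Quotient.map (Word.P h) fun _ _ h₁ => Rel.congr_P h h₁
  lie_add_right h := by rintro ⟨a⟩ ⟨b⟩ ⟨c⟩; exact mk_eq (Rel.lie_add_right h a b c)
  lie_add_left h := by rintro ⟨a⟩ ⟨b⟩ ⟨c⟩; exact mk_eq (Rel.lie_add_left h a b c)
  lie_eq_zero h := by rintro ⟨a⟩; exact mk_eq (Rel.lie_eq_zero h a)
  lie_swap h h' := by rintro ⟨a⟩ ⟨b⟩; exact mk_eq (Rel.lie_swap h h' a b)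
  lie_leibniz h₁ h₂ h₃ h₄ h₅ h₆ := by
    rintro ⟨a⟩ ⟨b⟩ ⟨c⟩; exact mk_eq (Rel.lie_leibniz h₁ h₂ h₃ h₄ h₅ h₆ a b c)
  P_add_one h := by rintro ⟨a⟩ ⟨b⟩; exact mk_eq (Rel.P_add_one h a b)
  P_add hn h := by rintro ⟨a⟩ ⟨b⟩; exact mk_eq (Rel.P_add hn h a b)
  P_lie_one h₁ h₂ h₃ h₄ h₅ := by
    rintro ⟨a⟩ ⟨b⟩; exact mk_eq (Rel.P_lie_one h₁ h₂ h₃ h₄ h₅ a b)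
  P_lie hm h₁ h₂ h₃ h₄ := by rintro ⟨a⟩ ⟨b⟩; exact mk_eq (Rel.P_lie hm h₁ h₂ h₃ h₄ a b)

namespace FreeMixedLie

variable {ι : Type u} {τ : ι → ℕ+}

/-- The generators of the free mixed Lie algebra. -/
def gen (τ : ι → ℕ+) (i : ι) : (freeMixedLie τ).comp (τ i) := mk (Word.gen i)

variable {𝔥 : MixedLieAlgebra.{v}} (f : ∀ i, 𝔥.comp (τ i))

/-- Evaluation of formal expressions in a mixed Lie algebra. -/
def eval : ∀ {n : ℕ+}, Word τ n → 𝔥.comp n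
  | _, Word.gen i => f i
  | _, Word.zero _ => 0
  | _, Word.add a b => eval a + eval b
  | _, Word.lie h a b => 𝔥.lie h (eval a) (eval b)
  | _, Word.P h a => 𝔥.P h (eval a)

theorem comp_add_self {n : ℕ+} (c : 𝔥.comp n) : c + c = 0 := by
  rw [← two_smul (ZMod 2) c, show (2 : ZMod 2) = 0 from rfl, zero_smul]

theorem eval_eq {n : ℕ+} {a b : Word τ n} (h : Rel τ a b) : eval f a = eval f b := by
  induction h with
  | refl a => rfl
  | symm _ ih => exact ih.symm
  | trans _ _ ih ih' => exact ih.trans ih'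
  | congr_add _ _ ih ih' => simp only [eval, ih, ih']
  | congr_lie h _ _ ih ih' => simp only [eval, ih, ih']
  | congr_P h _ ih => simp only [eval, ih]
  | add_assoc a b c => exact add_assoc _ _ _
  | add_comm a b => exact add_comm _ _
  | zero_add a => exact zero_add _
  | add_self a => exact comp_add_self _
  | lie_add_right h a b c => exact 𝔥.lie_add_right h _ _ _
  | lie_add_left h a b c => exact 𝔥.lie_add_left h _ _ _
  | lie_eq_zero h a => exact 𝔥.lie_eq_zero h _
  | lie_swap h h' a b =>
    exact (𝔥.lie_swap h h' _ _).trans (neg_eq_of_add_eq_zero_left (comp_add_self _))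
  | lie_leibniz h₁ h₂ h₃ h₄ h₅ h₆ a b c => exact 𝔥.lie_leibniz h₁ h₂ h₃ h₄ h₅ h₆ _ _ _
  | P_add_one h a b => exact 𝔥.P_add_one h _ _
  | P_add hn h a b => exact 𝔥.P_add hn h _ _
  | P_lie_one h₁ h₂ h₃ h₄ h₅ a b => exact 𝔥.P_lie_one h₁ h₂ h₃ h₄ h₅ _ _
  | P_lie hm h₁ h₂ h₃ h₄ a b => exact 𝔥.P_lie hm h₁ h₂ h₃ h₄ _ _

/-- The homomorphism from the free mixed Lie algebra given by the images of the generators. -/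
def lift : MixedLieAlgebra.Hom (freeMixedLie τ) 𝔥 where
  map n := AddMonoidHom.mk' (Quotient.lift (eval f) fun _ _ h => eval_eq f h)
    (by rintro ⟨a⟩ ⟨b⟩; rfl)
  map_lie h := by rintro ⟨a⟩ ⟨b⟩; rfl
  map_P h := by rintro ⟨a⟩; rfl

/-- The universal property of the free mixed Lie algebra. -/
theorem existsUnique_hom :
    ∃! φ : MixedLieAlgebra.Hom (freeMixedLie τ) 𝔥, ∀ i, φ.map (τ i) (gen τ i) = f i := by
  refine ⟨lift f, fun i => rfl, fun φ hφ => ?_⟩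
  have key : ∀ {n : ℕ+} (a : Word τ n), φ.map n (mk a) = eval f a := by
    intro n a
    induction a with
    | gen i => exact hφ i
    | zero n => exact map_zero (φ.map n)
    | add a b ha hb => exact (map_add (φ.map _) (mk a) (mk b)).trans (congrArg₂ (· + ·) ha hb)
    | lie h a b ha hb => exact (φ.map_lie h (mk a) (mk b)).trans (congrArg₂ (𝔥.lie h) ha hb)
    | P h a ha => exact (φ.map_P h (mk a)).trans (congrArg (𝔥.P h) ha)
  refine MixedLieAlgebra.Hom.ext (funext fun n => AddMonoidHom.ext fun x => ?_)
  obtain ⟨a, rfl⟩ := mk_surjective x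
  exact key a

end FreeMixedLie

/-! ### The free associative algebra on a weighted set -/

noncomputable section FreeAssociative

variable {ι : Type u} (τ : ι → ℕ+)

/-- The homogeneous component of degree `n` of the free associative algebra `A(X)` over `𝔽₂[π]`,
where the generator `i` has degree `τ i` and `π` has degree `1`: it is spanned over `𝔽₂` by the
elements `π ^ a • ξ i₁ ⋯ ξ iₖ` with `a + τ i₁ + ⋯ + τ iₖ = n`. -/
def weightedComp (n : ℕ) : Submodule (ZMod 2) (FreeAlgebra (ZMod 2)[X] ι) :=
  Submodule.span (ZMod 2) {x | ∃ (a : ℕ) (l : List ι), a + (l.map fun i => (τ i : ℕ)).sum = n ∧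
    x = (Polynomial.X : (ZMod 2)[X]) ^ a • (l.map (FreeAlgebra.ι (ZMod 2)[X])).prod}

instance : SetLike.GradedMonoid (weightedComp τ) where
  one_mem := Submodule.subset_span ⟨0, [], rfl, by simp⟩
  mul_mem := by
    intro m n x y hx hy
    have h := Submodule.mul_mem_mul hx hy
    rw [weightedComp, weightedComp, Submodule.span_mul_span] at h
    refine Submodule.span_le.mpr ?_ h
    rintro _ ⟨_, ⟨a, l, rfl, rfl⟩, _, ⟨b, l', rfl, rfl⟩, rfl⟩
    refine Submodule.subset_span ⟨a + b, l ++ l', ?_, ?_⟩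
    · simp only [List.map_append, List.sum_append]; omega
    · simp only [List.map_append, List.prod_append, smul_mul_assoc, mul_smul_comm, smul_smul,
        pow_add, mul_comm]

theorem X_smul_mem_weightedComp (n : ℕ) (x : FreeAlgebra (ZMod 2)[X] ι)
    (hx : x ∈ weightedComp τ n) : (Polynomial.X : (ZMod 2)[X]) • x ∈ weightedComp τ (n + 1) := by
  induction hx using Submodule.span_induction with
  | zero => rw [smul_zero]; exact zero_mem _
  | add x y _ _ hx hy => rw [smul_add]; exact add_mem hx hy
  | smul c x _ hx => rw [smul_comm]; exact Submodule.smul_mem _ c hx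
  | mem x hx =>
    obtain ⟨a, l, rfl, rfl⟩ := hx
    exact Submodule.subset_span ⟨a + 1, l, by omega, by rw [smul_smul, pow_succ']⟩

theorem ι_mem_weightedComp (i : ι) :
    FreeAlgebra.ι (ZMod 2)[X] i ∈ weightedComp τ (τ i) :=
  Submodule.subset_span ⟨0, [i], by simp, by simp⟩

/-- The mixed Lie algebra `A(X)₊`. -/
def freeAssocMixed : MixedLieAlgebra.{u} :=
  MixedLieAlgebra.ofGradedAlgebra (weightedComp τ) (X_smul_mem_weightedComp τ)

/-- The canonical homomorphism of mixed Lie algebras `L_mix(X) → A(X)₊`, sending `ξ i` to `ξ i`. -/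
def canonicalHom : MixedLieAlgebra.Hom (freeMixedLie τ) (freeAssocMixed τ) :=
  FreeMixedLie.lift fun i => ⟨FreeAlgebra.ι (ZMod 2)[X] i, ι_mem_weightedComp τ i⟩

/-- The canonical map `L_mix(X) → A(X)`, on the total spaces. -/
def toAssoc : (freeMixedLie τ).Total →+ FreeAlgebra (ZMod 2)[X] ι :=
  DirectSum.toAddMonoid fun n =>
    (weightedComp τ n).subtype.toAddMonoidHom.comp ((canonicalHom τ).map n)

end FreeAssociative

/-! ### The basis of `L⁺(X)` -/

/-- The indices `(i₁, …, i_{k-2}; j)` with `m ≥ i₁ > ⋯ > i_{k-2} ≥ 1` and `j ≠ i₁, …, i_{k-2}`,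
where `init = (i₁, …, i_{k-3})` and `last = i_{k-2}`. -/
@[ext]
structure AdSqIndex (m k : ℕ) where
  init : List (Fin m)
  last : Fin m
  j : Fin m
  length_eq : init.length + 3 = k
  decreasing : (init ++ [last]).Pairwise (· > ·)
  notMem : j ∉ init ++ [last]

/-- The indices `(i₁, …, i_k)`, `k ≥ 3`, with `m ≥ i₁ > ⋯ > i_{k-1} ≥ 1`, `i_{k-1} < i_k ≤ m`
and `i_k ≠ i₁, …, i_{k-2}`, where `init = (i₁, …, i_{k-2})`, `a = i_{k-1}` and `b = i_k`. -/
@[ext]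
structure AdIndex (m k : ℕ) where
  init : List (Fin m)
  a : Fin m
  b : Fin m
  three_le : 3 ≤ k
  length_eq : init.length + 2 = k
  decreasing : (init ++ [a]).Pairwise (· > ·)
  lt : a < b
  notMem : b ∉ init

/-- The indices `(i₁, …, i_k)`, `k ≥ 3`, with `m ≥ i₁ > ⋯ > i_{k-1} ≥ 1` and `m < i_k ≤ d`,
where `init = (i₁, …, i_{k-1})` and `last = i_k`. -/
@[ext]
structure AdMixedIndex (d m k : ℕ) where
  init : List (Fin m)
  last : Fin d
  three_le : 3 ≤ k
  length_eq : init.length + 1 = k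
  decreasing : init.Pairwise (· > ·)
  le : m ≤ (last : ℕ)

/-- The index set of the basis `Y` of `L⁺(X)`, where `X = {ξ₁, …, ξ_d}` and `ξ₁, …, ξ_m` are the
elements of weight `1` (both numbered from `0` here). -/
inductive YIndex (d m : ℕ) : Type
  /-- `P ξᵢ`, `i ≤ m` -/
  | sq (i : Fin m)
  /-- `[ξᵢ, ξⱼ]`, `i < j ≤ m` -/
  | br (i j : Fin m) (h : i < j)
  /-- `ξⱼ`, `j > m` -/
  | gen (j : Fin d) (h : m ≤ (j : ℕ))
  /-- `[ξᵢ, ξⱼ]`, `i ≤ m < j` -/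
  | brMixed (i : Fin m) (j : Fin d) (h : m ≤ (j : ℕ))
  /-- `ad(ξ_{i₁}) ⋯ ad(ξ_{i_{k-3}}) ad(ξⱼ)² (ξ_{i_{k-2}})` -/
  | adSq (k : ℕ) (s : AdSqIndex m k)
  /-- `ad(ξ_{i₁}) ⋯ ad(ξ_{i_{k-2}}) ad(ξ_{i_{k-1}}) (ξ_{i_k})`, `i_k ≤ m` -/
  | ad (k : ℕ) (s : AdIndex m k)
  /-- `ad(ξ_{i₁}) ⋯ ad(ξ_{i_{k-2}}) ad(ξ_{i_{k-1}}) (ξ_{i_k})`, `i_k > m` -/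
  | adMixed (k : ℕ) (s : AdMixedIndex d m k)

noncomputable section Basis

variable {d m : ℕ} (hmd : m ≤ d) (τ : Fin d → ℕ+)

/-- The generator `ξᵢ` as an element of `L_mix(X)`. -/
def ξ (i : Fin d) : (freeMixedLie τ).Total := (freeMixedLie τ).of (τ i) (FreeMixedLie.gen τ i)

/-- The element `P ξᵢ` of `L_mix(X)`. -/
def Pξ (i : Fin d) : (freeMixedLie τ).Total :=
  (freeMixedLie τ).of (τ i + 1) ((freeMixedLie τ).P rfl (FreeMixedLie.gen τ i))

/-- `ad(ξ_{i₁}) ⋯ ad(ξ_{iᵣ}) (u)` for a list `i₁, …, iᵣ` of indices `≤ m`. -/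
def iterAd (l : List (Fin m)) (u : (freeMixedLie τ).Total) : (freeMixedLie τ).Total :=
  l.foldr (fun i v => ⁅ξ τ (i.castLE hmd), v⁆) u

/-- The elements of `Y`, in `L_mix(X)`. -/
def yTotal : YIndex d m → (freeMixedLie τ).Total
  | .sq i => Pξ τ (i.castLE hmd)
  | .br i j _ => ⁅ξ τ (i.castLE hmd), ξ τ (j.castLE hmd)⁆
  | .gen j _ => ξ τ j
  | .brMixed i j _ => ⁅ξ τ (i.castLE hmd), ξ τ j⁆
  | .adSq _ s => iterAd hmd τ s.init
      ⁅ξ τ (s.j.castLE hmd), ⁅ξ τ (s.j.castLE hmd), ξ τ (s.last.castLE hmd)⁆⁆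
  | .ad _ s => iterAd hmd τ s.init ⁅ξ τ (s.a.castLE hmd), ξ τ (s.b.castLE hmd)⁆
  | .adMixed _ s => iterAd hmd τ s.init (ξ τ s.last)

/-- The weights of the elements of `Y`. -/
def yWeight : YIndex d m → ℕ
  | .sq _ => 2
  | .br _ _ _ => 2
  | .gen j _ => τ j
  | .brMixed _ j _ => 1 + τ j
  | .adSq k _ => k
  | .ad k _ => k
  | .adMixed k s => (k - 1) + τ s.last

theorem iterAd_mem_plus (l : List (Fin m)) (u : (freeMixedLie τ).Total)
    (hu : u ∈ (freeMixedLie τ).plus) : iterAd hmd τ l u ∈ (freeMixedLie τ).plus := by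
  cases l with
  | nil => exact hu
  | cons i l => exact MixedLieAlgebra.bracket_mem_plus _ _

theorem yTotal_mem_plus (hτ : ∀ i : Fin d, τ i = 1 ↔ (i : ℕ) < m) (y : YIndex d m) :
    yTotal hmd τ y ∈ (freeMixedLie τ).plus := by
  have hgen : ∀ j : Fin d, m ≤ (j : ℕ) → ξ τ j ∈ (freeMixedLie τ).plus := fun j h =>
    MixedLieAlgebra.of_mem_plus (fun e => absurd ((hτ j).mp e) (not_lt.mpr h)) _
  cases y with
  | sq i => exact MixedLieAlgebra.of_mem_plus (MixedLieAlgebra.add_one_ne_one _) _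
  | br i j h => exact MixedLieAlgebra.bracket_mem_plus _ _
  | gen j h => exact hgen j h
  | brMixed i j h => exact MixedLieAlgebra.bracket_mem_plus _ _
  | adSq k s => exact iterAd_mem_plus hmd τ _ _ (MixedLieAlgebra.bracket_mem_plus _ _)
  | ad k s => exact iterAd_mem_plus hmd τ _ _ (MixedLieAlgebra.bracket_mem_plus _ _)
  | adMixed k s => exact iterAd_mem_plus hmd τ _ _ (hgen _ s.le)

/-- The elements of `Y`, in `L⁺(X)`. -/
def yPlus (hτ : ∀ i : Fin d, τ i = 1 ↔ (i : ℕ) < m) (y : YIndex d m) : (freeMixedLie τ).Plus :=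
  ⟨yTotal hmd τ y, yTotal_mem_plus hmd τ hτ y⟩

/-- The elements of `Y`, in `A(X)`. -/
def yAssoc (y : YIndex d m) : FreeAlgebra (ZMod 2)[X] (Fin d) := toAssoc τ (yTotal hmd τ y)

/-- The subalgebra `B` of `A(X)` generated by `Y`. -/
def subalgebraB : Subalgebra (ZMod 2)[X] (FreeAlgebra (ZMod 2)[X] (Fin d)) :=
  Algebra.adjoin (ZMod 2)[X] (Set.range (yAssoc hmd τ))

/-- The elements of `Y`, in `B`. -/
def yB (y : YIndex d m) : subalgebraB hmd τ :=
  ⟨yAssoc hmd τ y, Algebra.subset_adjoin (Set.mem_range_self y)⟩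

/-- The product `ξ₁ ^ e₁ ⋯ ξ_m ^ e_m` in `A(X)`, where `eᵢ ∈ {0, 1}`. -/
def monomialXi (e : Fin m → Fin 2) : FreeAlgebra (ZMod 2)[X] (Fin d) :=
  (List.ofFn fun i : Fin m => FreeAlgebra.ι (ZMod 2)[X] (i.castLE hmd) ^ (e i : ℕ)).prod

end Basis

/-! The proof maps `L⁺` and the free algebras on `Y` into the associative algebra `A`, and so
reduces freeness to a generation statement and a count.

Generation. Let `S` be a subgroup of `L` containing `Y` and closed under brackets and `π`. In degree
1 one has ad(Pξ) = π ad(ξ) + ad(ξ)², and ad(ξᵢ), ad(ξⱼ) commute up to ad[ξᵢ, ξⱼ]. Hence the letters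
of an iterated bracket may be permuted, and a repeated letter removed, up to terms built from
shorter brackets. The Jacobi identity brings the least index into the innermost bracket, and the
normal forms that remain are exactly those of `Y`. This induction is `IsSquareClosed.bracketsMem`;
it yields `IsYClosed.plus_le`, that `S` contains `L⁺`.

Independence. The image of `L⁺` in `A` lies in `B`. So the commutators of ξᵢ (i ≤ m) with `B` and
with each other lie in `B`, and so does πξᵢ + ξᵢ². The ordered monomials ξ^e therefore generate `A`
over `B` on either side (`IsAlmostCentral.prod_mul_eq_top`). If `T` is the free associative algebra
on `Y`, this is a surjection from 2^m copies of `T` onto `A`, preserving weights. Both sides have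
finite dimension over 𝔽₂ in each weight, and the dimensions agree because (1+t)^m (1 − ∑ᵢ t^{τᵢ}) =
1 − ∑_y t^{weight y} (`weightSeries_yWeight`). A surjection between spaces of equal finite dimension
is injective, so `T` → `B` is an isomorphism and `A` is free over `B` (`injective_monomialMul`).

Free Lie algebra. The map from the free Lie algebra on `Y` to `L⁺`, followed by `L⁺` → `A`, equals
the embedding into `T` followed by the injection `T` → `A`; so it is injective, and it is surjective
by generation. That a free Lie algebra embeds into the free associative algebra
(`FreeLieAlgebra.lift_ι_injective`) is shown over a field by passing to its finite-dimensional
nilpotent quotients, which embed into their enveloping algebras by induction along ideals of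
codimension one. Flat base change then gives it over 𝔽₂[π]. -/

/-! ### Faithfulness of enveloping algebras of solvable Lie algebras. -/

section EnvelopingFaithful

attribute [local instance] LieRing.ofAssociativeRing

open UniversalEnvelopingAlgebra in
/-- If the kernel of a linear form vanishing on brackets embeds into its enveloping algebra, then so
does the whole Lie algebra: it acts on the enveloping algebra of the kernel. -/
theorem UniversalEnvelopingAlgebra.ι_injective_of_ker {F : Type u} {N : Type v} [CommRing F]
    [LieRing N] [LieAlgebra F N] (I : LieIdeal F N) (f : N →ₗ[F] F)
    (hI : ∀ x, x ∈ I ↔ f x = 0) (hf : ∀ x y : N, f ⁅x, y⁆ = 0) (b : N) (hb : f b = 1)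
    (h : Function.Injective (ι F : I →ₗ⁅F⁆ UniversalEnvelopingAlgebra F I)) :
    Function.Injective (ι F : N →ₗ⁅F⁆ UniversalEnvelopingAlgebra F N) := by
  let U := UniversalEnvelopingAlgebra F I
  let ad : I →ₗ[F] I :=
    { toFun := fun x => ⟨⁅b, (x : N)⁆, (hI _).mpr (hf _ _)⟩
      map_add' := fun x y => Subtype.ext (lie_add _ _ _)
      map_smul' := fun c x => Subtype.ext (lie_smul _ _ _) }
  have ad_lie : ∀ x y : I, ad ⁅x, y⁆ = ⁅ad x, y⁆ + ⁅x, ad y⁆ := fun x y =>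
    Subtype.ext (leibniz_lie _ _ _)
  have ι_lie : ∀ x y : I, (ι F ⁅x, y⁆ : U) = ι F x * ι F y - ι F y * ι F x := fun x y => by
    rw [LieHom.map_lie, LieRing.of_associative_ring_bracket]
  -- An algebra homomorphism `U` → `U`[ε] lifting the identity is u ↦ u + D(u)ε with `D` a
  -- derivation. So lifting x + (ad x)ε extends the derivation ad(b) of `I` to a derivation of `U`.
  let g : I →ₗ⁅F⁆ DualNumber U :=
    { toFun := fun x => TrivSqZeroExt.inl (ι F x) + TrivSqZeroExt.inr (ι F (ad x))
      map_add' := fun x y => by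
        ext <;> simp [-ι_apply]
      map_smul' := fun c x => by
        ext <;> simp [-ι_apply]
      map_lie' := fun {x y} => by
        rw [ad_lie, map_add, ι_lie, ι_lie, ι_lie, LieRing.of_associative_ring_bracket]
        ext
        · simp [-ι_apply]
        · simp [-ι_apply]
          abel }
  let G := lift F g
  have hG : ∀ u : U, (G u).fst = u := by
    have : (TrivSqZeroExt.fstHom F U U).comp G = AlgHom.id F U := by
      ext x
      have := lift_ι_apply F g x
      simp only [LieHom.coe_comp, Function.comp_apply, AlgHom.coe_toLieHom, AlgHom.comp_apply, G]
      rw [this]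
      simp only [g, LieHom.coe_mk, TrivSqZeroExt.fstHom_apply, TrivSqZeroExt.fst_add,
        TrivSqZeroExt.fst_inl, TrivSqZeroExt.fst_inr, add_zero]
      rfl
    exact fun u => DFunLike.congr_fun this u
  let D : U →ₗ[F] U := (TrivSqZeroExt.sndHom U U).restrictScalars F ∘ₗ G.toLinearMap
  have D_mul : ∀ (z : I) (u : U), D (ι F z * u) = ι F z * D u + ι F (ad z) * u := by
    intro z u
    have h2 : G (ι F z) = g z := lift_ι_apply F g z
    change (G (ι F z * u)).snd = _ * (G u).snd + _
    rw [map_mul, TrivSqZeroExt.snd_mul, hG, hG, h2]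
    simp [g, -ι_apply]
  have D_one : D 1 = 0 := by
    change (G 1).snd = 0
    rw [map_one]; rfl
  let p : N →ₗ[F] I :=
    { toFun := fun x => ⟨x - f x • b, (hI _).mpr (by simp [hb])⟩
      map_add' := fun x y => Subtype.ext (by
        simp only [map_add, add_smul, LieSubmodule.coe_add]; abel)
      map_smul' := fun c x => Subtype.ext (by simp [smul_sub, smul_smul]) }
  have p_lie : ∀ x y, p ⁅x, y⁆ = ⁅p x, p y⁆ + f x • ad (p y) - f y • ad (p x) := by
    intro x y
    apply Subtype.ext
    change ⁅x, y⁆ - f ⁅x, y⁆ • b = ⁅x - f x • b, y - f y • b⁆ + f x • ⁅b, y - f y • b⁆ -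
      f y • ⁅b, x - f x • b⁆
    simp only [hf, zero_smul, lie_sub, sub_lie, lie_smul, smul_lie, lie_self, smul_zero, sub_zero]
    rw [← lie_skew x b, smul_neg]
    abel
  -- Writing x = p x + f(x) b, let `I` act by left multiplication and b by `D`. This respects
  -- brackets because the commutator of `D` with left multiplication by z is left multiplication by
  -- ad(b)(z).
  let ρ : N →ₗ⁅F⁆ Module.End F U :=
    { toFun := fun x => LinearMap.mulLeft F (ι F (p x)) + f x • D
      map_add' := fun x y => by
        ext u; simp only [map_add, LinearMap.add_apply, LinearMap.mulLeft_apply,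
          LinearMap.smul_apply, add_mul, add_smul]; abel
      map_smul' := fun c x => by
        ext u; simp only [map_smul, LinearMap.add_apply, LinearMap.mulLeft_apply,
          LinearMap.smul_apply, smul_mul_assoc, smul_add, smul_smul, RingHom.id_apply, smul_eq_mul]
      map_lie' := fun {x y} => by
        ext u
        simp only [p_lie, hf, zero_smul, add_zero, LieRing.of_associative_ring_bracket,
          LinearMap.sub_apply, Module.End.mul_apply, LinearMap.add_apply, LinearMap.mulLeft_apply,
          LinearMap.smul_apply, ι_lie, map_add, map_sub, map_smul, D_mul, mul_add, add_mul,
          sub_mul, smul_add, smul_mul_assoc,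
          mul_smul_comm, mul_assoc, smul_comm (f x) (f y)]
        abel }
  let f' : N →ₗ⁅F⁆ F :=
    { f with
      map_lie' := fun {x y} => (hf x y).trans (by
        rw [LieRing.of_associative_ring_bracket, mul_comm, sub_self]) }
  rw [injective_iff_map_eq_zero]
  intro x hx
  -- Both `ρ` and `f'` factor through the enveloping algebra of `N`. The form gives f x = 0, and
  -- evaluating `ρ x` at 1, where `D` vanishes, gives p x = 0.
  have h1 : ρ x = 0 := by rw [← lift_ι_apply F ρ x, hx, map_zero]
  have h2 : f x = 0 := by
    have : f' x = 0 := by rw [← lift_ι_apply F f' x, hx, map_zero]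
    exact this
  have h3 : ι F (p x) = 0 := by
    have : ρ x 1 = 0 := by rw [h1]; rfl
    have h4 : ρ x 1 = ι F (p x) * 1 + f x • D 1 := rfl
    rwa [h4, D_one, smul_zero, add_zero, mul_one] at this
  have h5 : p x = 0 := h (by rw [h3, map_zero])
  have h6 : x - f x • b = 0 := congrArg Subtype.val h5
  rwa [h2, zero_smul, sub_zero] at h6

/-- A finite-dimensional solvable Lie algebra over a field embeds into its enveloping algebra. -/
theorem UniversalEnvelopingAlgebra.ι_injective_of_isSolvable {F : Type u} [Field F] (n : ℕ) :
    ∀ (N : Type v) [LieRing N] [LieAlgebra F N] [LieAlgebra.IsSolvable N] [Module.Finite F N],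
      Module.finrank F N = n →
      Function.Injective (ι F : N →ₗ⁅F⁆ UniversalEnvelopingAlgebra F N) := by
  induction n with
  | zero =>
    intro N _ _ _ _ hn
    have := Module.finrank_zero_iff.mp hn
    exact Function.injective_of_subsingleton _
  | succ n ih =>
    intro N _ _ _ _ hn
    have : Nontrivial N := Module.nontrivial_of_finrank_pos (R := F) (by omega)
    have hlt := LieAlgebra.derivedSeries_lt_top_of_solvable F N
    -- Solvability makes the derived ideal proper, so it lies in a hyperplane; any such hyperplane
    -- is an ideal, of dimension one less.
    obtain ⟨f, hf0, hf⟩ := Submodule.exists_le_ker_of_lt_top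
      (LieAlgebra.derivedSeries F N 1).toSubmodule (by
        rw [lt_top_iff_ne_top]; intro h; exact hlt.ne (by
          rwa [LieSubmodule.toSubmodule_eq_top] at h))
    have hbr : ∀ x y : N, f ⁅x, y⁆ = 0 := fun x y => hf (by
      change _ ∈ LieAlgebra.derivedSeries F N 1
      rw [LieAlgebra.derivedSeries_def, LieAlgebra.derivedSeriesOfIdeal_succ]
      exact LieSubmodule.lie_mem_lie (LieSubmodule.mem_top x) (LieSubmodule.mem_top y))
    obtain ⟨b, hb⟩ : ∃ b, f b = 1 := LinearMap.surjective hf0 1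
    let I : LieIdeal F N :=
      { LinearMap.ker f with lie_mem := fun {x y} _ => hbr x y }
    refine ι_injective_of_ker I f (fun x => Iff.rfl) hbr b hb (ih I ?_)
    have := LinearMap.finrank_range_add_finrank_ker f
    rw [LinearMap.range_eq_top.mpr (LinearMap.surjective hf0), finrank_top, Module.finrank_self,
      hn] at this
    change Module.finrank F (LinearMap.ker f) = n
    omega

end EnvelopingFaithful

/-! ### Free Lie algebras inside free associative algebras. -/

section FreeLie

open scoped TensorProduct

attribute [local instance] LieRing.ofAssociativeRing

open LieModule (lowerCentralSeries)

namespace FreeLieAlgebra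

/-- The generators generate the free Lie algebra. -/
theorem mem_of_forall_of_mem {R : Type u} [CommRing R] {Y : Type v}
    (S : LieSubalgebra R (FreeLieAlgebra R Y)) (h : ∀ y, of R y ∈ S) (x : FreeLieAlgebra R Y) :
    x ∈ S := by
  have : S.incl.comp (lift R fun y => (⟨of R y, h y⟩ : S)) = LieHom.id := by
    ext y
    simp
  have hx := LieHom.congr_fun this x
  rw [LieHom.id_apply] at hx
  rw [← hx]
  exact (lift R (fun y => (⟨of R y, h y⟩ : S)) x).2

/-- Modulo brackets the algebra is spanned by the generators, and the next layer is spanned by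
brackets of the generators with a spanning set of the current one. The error terms are harmless
because the bracket of term 1 with term n lies in term n + 2, by the Jacobi identity. -/
theorem exists_lowerCentralSeries_le (R : Type u) [CommRing R] (Y : Type v) [Finite Y] (n : ℕ) :
    ∃ W : Submodule R (FreeLieAlgebra R Y), W.FG ∧
      (lowerCentralSeries R (FreeLieAlgebra R Y) (FreeLieAlgebra R Y) n).toSubmodule ≤
        W ⊔ (lowerCentralSeries R (FreeLieAlgebra R Y) (FreeLieAlgebra R Y) (n + 1)).toSubmodule := by
  let L := FreeLieAlgebra R Y
  let C := lowerCentralSeries R L L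
  have hC : ∀ n (a b : L), b ∈ C n → ⁅a, b⁆ ∈ C (n + 1) := fun n a b hb => by
    change _ ∈ lowerCentralSeries R L L (n + 1)
    rw [LieModule.lowerCentralSeries_succ]
    exact LieSubmodule.lie_mem_lie (LieSubmodule.mem_top a) hb
  let V : Submodule R L := Submodule.span R (Set.range (of R))
  have hV : ∀ x : L, x ∈ V ⊔ (C 1).toSubmodule := by
    let S : LieSubalgebra R L :=
      { V ⊔ (C 1).toSubmodule with
        lie_mem' := fun {x y} _ _ => Submodule.mem_sup_right (hC 0 x y (LieSubmodule.mem_top y)) }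
    exact mem_of_forall_of_mem S fun y =>
      Submodule.mem_sup_left (Submodule.subset_span ⟨y, rfl⟩)
  have hVfg : V.FG := Submodule.fg_span (Set.finite_range _)
  have hC1 : ∀ n, ∀ c ∈ C 1, ∀ b ∈ C n, ⁅c, b⁆ ∈ C (n + 2) := by
    intro n c hc b hb
    have hc' : c ∈ (lowerCentralSeries R L L 1).toSubmodule := hc
    clear hc
    rw [LieModule.lowerCentralSeries_succ, LieSubmodule.lieIdeal_oper_eq_linear_span'] at hc'
    induction hc' using Submodule.span_induction with
    | mem x hx =>
      obtain ⟨p, -, q, -, rfl⟩ := hx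
      rw [lie_lie]
      exact sub_mem (hC _ _ _ (hC _ _ _ hb)) (hC _ _ _ (hC _ _ _ hb))
    | zero => rw [zero_lie]; exact zero_mem _
    | add x y _ _ h h' => rw [add_lie]; exact add_mem h h'
    | smul a x _ h => rw [smul_lie]; exact (C (n + 2)).smul_mem _ h
  induction n with
  | zero => exact ⟨V, hVfg, fun x _ => hV x⟩
  | succ n ih =>
    obtain ⟨W, hW, hle⟩ := ih
    let br : L →ₗ[R] L →ₗ[R] L := LinearMap.mk₂ R (fun x y => ⁅x, y⁆) add_lie smul_lie lie_add
      lie_smul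
    refine ⟨Submodule.map₂ br V W, hVfg.map₂ br hW, ?_⟩
    rw [LieModule.lowerCentralSeries_succ, LieSubmodule.lieIdeal_oper_eq_linear_span',
      Submodule.span_le]
    rintro _ ⟨a, -, b, hb, rfl⟩
    obtain ⟨p, hp, c, hc, rfl⟩ := Submodule.mem_sup.mp (hV a)
    obtain ⟨q, hq, d, hd, rfl⟩ := Submodule.mem_sup.mp (hle hb)
    rw [SetLike.mem_coe, add_lie, lie_add]
    refine add_mem (add_mem ?_ ?_) ?_
    · exact Submodule.mem_sup_left (Submodule.apply_mem_map₂ br hp hq)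
    · exact Submodule.mem_sup_right (hC _ _ _ hd)
    · exact Submodule.mem_sup_right (hC1 n c hc _ hb)

theorem finite_quotient_lowerCentralSeries (R : Type u) [CommRing R] (Y : Type v) [Finite Y]
    (n : ℕ) : Module.Finite R (FreeLieAlgebra R Y ⧸
      lowerCentralSeries R (FreeLieAlgebra R Y) (FreeLieAlgebra R Y) n) := by
  let L := FreeLieAlgebra R Y
  let C := lowerCentralSeries R L L
  have : ∀ n, ∃ W : Submodule R L, W.FG ∧ ⊤ ≤ W ⊔ (C n).toSubmodule := by
    intro n
    induction n with
    | zero => exact ⟨⊥, Submodule.fg_bot, fun x _ => Submodule.mem_sup_right (LieSubmodule.mem_top x)⟩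
    | succ n ih =>
      obtain ⟨W, hW, hle⟩ := ih
      obtain ⟨W', hW', hle'⟩ := exists_lowerCentralSeries_le R Y n
      exact ⟨W ⊔ W', hW.sup hW', by
        rw [sup_assoc]; exact hle.trans (sup_le_sup_left hle' _)⟩
  obtain ⟨W, hW, hle⟩ := this n
  refine ⟨?_⟩
  have hW' : W.map (C n).toSubmodule.mkQ = ⊤ := by
    rw [Submodule.eq_top_iff']
    rintro ⟨x⟩
    obtain ⟨p, hp, c, hc, rfl⟩ := Submodule.mem_sup.mp (hle (Submodule.mem_top (x := x)))
    exact ⟨p, hp, (Submodule.Quotient.eq _).mpr (by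
      rw [sub_add_cancel_left]; exact neg_mem hc)⟩
  exact hW' ▸ hW.map (C n).toSubmodule.mkQ

/-- The quotient map of a Lie algebra by an ideal. -/
def quotientHom {R : Type u} {L : Type v} [CommRing R] [LieRing L] [LieAlgebra R L]
    (I : LieIdeal R L) : L →ₗ⁅R⁆ L ⧸ I :=
  { I.toSubmodule.mkQ with map_lie' := rfl }

theorem isSolvable_quotient_lowerCentralSeries (R : Type u) (L : Type v) [CommRing R] [LieRing L]
    [LieAlgebra R L] (n : ℕ) : LieAlgebra.IsSolvable (L ⧸ lowerCentralSeries R L L n) := by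
  have : LieModule.IsNilpotent (L ⧸ lowerCentralSeries R L L n)
      (L ⧸ lowerCentralSeries R L L n) := by
    refine LieModule.IsNilpotent.mk (R := R) _ (k := n) ?_
    rw [← LieIdeal.lowerCentralSeries_map_eq n (f := quotientHom (lowerCentralSeries R L L n))
      Quot.mk_surjective, eq_bot_iff, LieIdeal.map_le_iff_le_comap]
    intro x hx
    rw [LieIdeal.mem_comap, LieSubmodule.mem_bot]
    exact (Submodule.Quotient.mk_eq_zero _).mpr hx
  infer_instance

variable {F : Type u} [CommRing F]

section Polynomials

variable {L : Type v} [LieRing L] [LieAlgebra F L]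

variable (F L) in
/-- The `n`-th coefficient of a polynomial with coefficients in `L`. -/
noncomputable def tensorCoeff (n : ℕ) : F[X] ⊗[F] L →ₗ[F] L :=
  (TensorProduct.lid F L).toLinearMap ∘ₗ LinearMap.rTensor L (Polynomial.lcoeff F n)

variable (F L) in
/-- The value at `1` of a polynomial with coefficients in `L`. -/
noncomputable def tensorEvalOne : F[X] ⊗[F] L →ₗ[F] L :=
  (TensorProduct.lid F L).toLinearMap ∘ₗ LinearMap.rTensor L (Polynomial.leval (1 : F))

theorem tensorCoeff_tmul (n : ℕ) (f : F[X]) (a : L) :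
    tensorCoeff F L n (f ⊗ₜ a) = f.coeff n • a := by
  simp [tensorCoeff]

theorem tensorEvalOne_tmul (f : F[X]) (a : L) :
    tensorEvalOne F L (f ⊗ₜ a) = f.eval 1 • a := by
  simp [tensorEvalOne]

section ExtendScalars

variable {A : Type w} [CommRing A] [Algebra F A]

theorem tensor_zero_lie (t : A ⊗[F] L) : ⁅(0 : A ⊗[F] L), t⁆ = 0 := zero_lie t

theorem tensor_lie_zero (t : A ⊗[F] L) : ⁅t, (0 : A ⊗[F] L)⁆ = 0 := lie_zero t

theorem tensor_add_lie (s s' t : A ⊗[F] L) : ⁅s + s', t⁆ = ⁅s, t⁆ + ⁅s', t⁆ := add_lie s s' t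

theorem tensor_lie_add (s t t' : A ⊗[F] L) : ⁅s, t + t'⁆ = ⁅s, t⁆ + ⁅s, t'⁆ := lie_add s t t'

/-- The linear extension of a homomorphism of Lie algebras preserves brackets. -/
theorem map_tensor_lie {B : Type*} [LieRing B] [LieAlgebra A B] (r : A ⊗[F] L →ₗ[A] B)
    (hr : ∀ x y : L, r (1 ⊗ₜ ⁅x, y⁆) = ⁅r (1 ⊗ₜ x), r (1 ⊗ₜ y)⁆) (s t : A ⊗[F] L) :
    r ⁅s, t⁆ = ⁅r s, r t⁆ := by
  have smul_tmul : ∀ (a : A) (x : L), a ⊗ₜ[F] x = a • (1 : A) ⊗ₜ[F] x := fun a x => by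
    rw [TensorProduct.smul_tmul', smul_eq_mul, mul_one]
  induction s using TensorProduct.induction_on with
  | zero => rw [tensor_zero_lie, map_zero, zero_lie]
  | add s s' h h' => rw [tensor_add_lie, map_add, h, h', map_add, add_lie]
  | tmul a x =>
    induction t using TensorProduct.induction_on with
    | zero => rw [tensor_lie_zero, map_zero, lie_zero]
    | add t t' h h' => rw [tensor_lie_add, map_add, h, h', map_add, lie_add]
    | tmul b y =>
      rw [LieAlgebra.ExtendScalars.bracket_tmul, smul_tmul a, smul_tmul b, smul_tmul (a * b),
        map_smul, map_smul, map_smul, hr, smul_lie, lie_smul, smul_smul]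

end ExtendScalars

theorem tensorEvalOne_lie (s t : F[X] ⊗[F] L) :
    tensorEvalOne F L ⁅s, t⁆ = ⁅tensorEvalOne F L s, tensorEvalOne F L t⁆ := by
  induction s using TensorProduct.induction_on with
  | zero => rw [tensor_zero_lie, map_zero, zero_lie]
  | add s s' h h' => rw [tensor_add_lie, map_add, h, h', map_add, add_lie]
  | tmul f a =>
    induction t using TensorProduct.induction_on with
    | zero => rw [tensor_lie_zero, map_zero, lie_zero]
    | add s s' h h' => rw [tensor_lie_add, map_add, h, h', map_add, lie_add]
    | tmul g b =>
      rw [LieAlgebra.ExtendScalars.bracket_tmul, tensorEvalOne_tmul, tensorEvalOne_tmul,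
        tensorEvalOne_tmul, Polynomial.eval_mul, smul_lie, lie_smul, smul_smul]

theorem tensorCoeff_lie (n : ℕ) (s t : F[X] ⊗[F] L) :
    tensorCoeff F L n ⁅s, t⁆ =
      ∑ p ∈ Finset.HasAntidiagonal.antidiagonal n, ⁅tensorCoeff F L p.1 s, tensorCoeff F L p.2 t⁆ := by
  induction s using TensorProduct.induction_on with
  | zero => simp only [tensor_zero_lie, zero_lie, map_zero, Finset.sum_const_zero]
  | add s s' h h' => simp only [tensor_add_lie, add_lie, map_add, h, h', Finset.sum_add_distrib]
  | tmul f a =>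
    induction t using TensorProduct.induction_on with
    | zero => simp only [tensor_lie_zero, lie_zero, map_zero, Finset.sum_const_zero]
    | add s s' h h' => simp only [tensor_lie_add, lie_add, map_add, h, h', Finset.sum_add_distrib]
    | tmul g b =>
      simp only [LieAlgebra.ExtendScalars.bracket_tmul, tensorCoeff_tmul, Polynomial.coeff_mul,
        smul_lie, lie_smul, smul_smul, Finset.sum_smul, mul_comm]

theorem tensorCoeff_lie_eq_zero {k n : ℕ} {s t : F[X] ⊗[F] L}
    (hs : ∀ i < k, tensorCoeff F L i s = 0) (ht : ∀ i < n, tensorCoeff F L i t = 0) :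
    ∀ i < k + n, tensorCoeff F L i ⁅s, t⁆ = 0 := by
  intro i hi
  rw [tensorCoeff_lie]
  refine Finset.sum_eq_zero fun p hp => ?_
  rw [Finset.HasAntidiagonal.mem_antidiagonal] at hp
  rcases lt_or_ge p.1 k with h | h
  · rw [hs _ h, zero_lie]
  · rw [ht _ (by omega), lie_zero]

theorem exists_tensorEvalOne_eq_sum (t : F[X] ⊗[F] L) : ∃ N, ∀ M ≥ N,
    tensorEvalOne F L t = ∑ i ∈ Finset.range M, tensorCoeff F L i t := by
  induction t using TensorProduct.induction_on with
  | zero => exact ⟨0, fun M _ => by simp only [map_zero, Finset.sum_const_zero]⟩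
  | add s t hs ht =>
    obtain ⟨N, hN⟩ := hs
    obtain ⟨N', hN'⟩ := ht
    refine ⟨max N N', fun M hM => ?_⟩
    simp only [map_add, Finset.sum_add_distrib]
    rw [← hN M (le_trans (le_max_left _ _) hM), ← hN' M (le_trans (le_max_right _ _) hM)]
  | tmul f a =>
    refine ⟨f.natDegree + 1, fun M hM => ?_⟩
    simp only [tensorCoeff_tmul, tensorEvalOne_tmul, ← Finset.sum_smul]
    rw [Polynomial.eval_eq_sum_range' (Nat.lt_of_succ_le hM)]
    simp

end Polynomials

variable {Y : Type v}

variable (F Y) in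
/-- The homomorphism multiplying each generator by the indeterminate. -/
noncomputable def grading : FreeLieAlgebra F Y →ₗ⁅F⁆ F[X] ⊗[F] FreeLieAlgebra F Y :=
  lift F fun y => (Polynomial.X : F[X]) ⊗ₜ[F] of F y

/-- Setting the indeterminate to 1 is a homomorphism that undoes `grading` on generators, hence
everywhere. -/
theorem tensorEvalOne_grading (x : FreeLieAlgebra F Y) :
    tensorEvalOne F _ (grading F Y x) = x := by
  let S : LieSubalgebra F (FreeLieAlgebra F Y) :=
    { LinearMap.ker (tensorEvalOne F _ ∘ₗ (grading F Y).toLinearMap - LinearMap.id) with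
      lie_mem' := fun {a b} ha hb => by
        have ha' : tensorEvalOne F _ (grading F Y a) - a = 0 := ha
        have hb' : tensorEvalOne F _ (grading F Y b) - b = 0 := hb
        change tensorEvalOne F _ (grading F Y ⁅a, b⁆) - ⁅a, b⁆ = 0
        rw [LieHom.map_lie, tensorEvalOne_lie, sub_eq_zero.mp ha', sub_eq_zero.mp hb', sub_self] }
  exact sub_eq_zero.mp (mem_of_forall_of_mem S (fun y => by
    change tensorEvalOne F _ (grading F Y (of F y)) - of F y = 0
    rw [grading, lift_of_apply, tensorEvalOne_tmul, Polynomial.eval_X, one_smul, sub_self]) x)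

theorem tensorCoeff_zero_grading (x : FreeLieAlgebra F Y) :
    tensorCoeff F _ 0 (grading F Y x) = 0 := by
  let S : LieSubalgebra F (FreeLieAlgebra F Y) :=
    { LinearMap.ker (tensorCoeff F _ 0 ∘ₗ (grading F Y).toLinearMap) with
      lie_mem' := fun {a b} ha hb => by
        change tensorCoeff F _ 0 (grading F Y ⁅a, b⁆) = 0
        rw [LieHom.map_lie]
        refine tensorCoeff_lie_eq_zero (k := 1) (n := 1) ?_ ?_ 0 (by omega)
        · intro i hi; obtain rfl : i = 0 := by omega
          exact ha
        · intro i hi; obtain rfl : i = 0 := by omega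
          exact hb }
  exact mem_of_forall_of_mem S (fun y => by
    change tensorCoeff F _ 0 (grading F Y (of F y)) = 0
    rw [grading, lift_of_apply, tensorCoeff_tmul, Polynomial.coeff_X_zero, zero_smul]) x

/-- Term n of the series is made of brackets with n + 1 entries (term 0 is the whole algebra), and
each entry contributes at least one factor of the indeterminate. -/
theorem tensorCoeff_grading_of_mem (n : ℕ) (x : FreeLieAlgebra F Y)
    (hx : x ∈ (lowerCentralSeries F (FreeLieAlgebra F Y) (FreeLieAlgebra F Y) n).toSubmodule) :
    ∀ i < n + 1, tensorCoeff F _ i (grading F Y x) = 0 := by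
  induction n generalizing x with
  | zero =>
    intro i hi
    obtain rfl : i = 0 := by omega
    exact tensorCoeff_zero_grading x
  | succ n ih =>
    rw [LieModule.lowerCentralSeries_succ, LieSubmodule.lieIdeal_oper_eq_linear_span'] at hx
    induction hx using Submodule.span_induction with
    | mem x hx =>
      obtain ⟨p, -, q, hq, rfl⟩ := hx
      rw [LieHom.map_lie]
      refine fun i hi => tensorCoeff_lie_eq_zero (k := 1) (n := n + 1) (fun i hi => ?_)
        (ih q hq) i (by omega)
      obtain rfl : i = 0 := by omega
      exact tensorCoeff_zero_grading p
    | zero => intro i _; rw [map_zero, map_zero]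
    | add x y _ _ h h' => intro i hi; rw [map_add, map_add, h i hi, h' i hi, add_zero]
    | smul a x _ h => intro i hi; rw [map_smul, map_smul, h i hi, smul_zero]

/-- The lower central series of a free Lie algebra has trivial intersection. -/
theorem eq_zero_of_forall_mem_lowerCentralSeries (x : FreeLieAlgebra F Y)
    (hx : ∀ n, x ∈ lowerCentralSeries F (FreeLieAlgebra F Y) (FreeLieAlgebra F Y) n) : x = 0 := by
  rw [← tensorEvalOne_grading x]
  -- The element is the sum of its homogeneous coefficients, and coefficient i vanishes by
  -- membership in term i of the series.
  obtain ⟨N, hN⟩ := exists_tensorEvalOne_eq_sum (grading F Y x)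
  rw [hN N le_rfl]
  exact Finset.sum_eq_zero fun i hi => tensorCoeff_grading_of_mem i x (hx i) i (by omega)

/-- The free Lie algebra over a field embeds into the free associative algebra. -/
theorem lift_ι_injective_of_field (F : Type u) [Field F] (Y : Type v) [Finite Y] :
    Function.Injective (lift F (FreeAlgebra.ι F : Y → FreeAlgebra F Y)) := by
  rw [injective_iff_map_eq_zero]
  intro x hx
  refine eq_zero_of_forall_mem_lowerCentralSeries x fun n => ?_
  let I := lowerCentralSeries F (FreeLieAlgebra F Y) (FreeLieAlgebra F Y) n
  have := finite_quotient_lowerCentralSeries F Y n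
  have := isSolvable_quotient_lowerCentralSeries F (FreeLieAlgebra F Y) n
  have hinj := UniversalEnvelopingAlgebra.ι_injective_of_isSolvable (F := F) _
    (FreeLieAlgebra F Y ⧸ I) rfl
  -- The map to the enveloping algebra of the quotient by term n factors through the free
  -- associative algebra, where `x` is already zero. That quotient is finite-dimensional and
  -- nilpotent, so `x` vanishes in it.
  have hcomp : (UniversalEnvelopingAlgebra.ι F).comp (quotientHom I) =
      (FreeAlgebra.lift F fun y => UniversalEnvelopingAlgebra.ι F (quotientHom I (of F y))).toLieHom.comp
        (lift F (FreeAlgebra.ι F : Y → FreeAlgebra F Y)) := by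
    ext y
    simp [-UniversalEnvelopingAlgebra.ι_apply]
  have h0 : UniversalEnvelopingAlgebra.ι F (quotientHom I x) = 0 := by
    have := LieHom.congr_fun hcomp x
    rw [LieHom.comp_apply, LieHom.comp_apply, hx, map_zero] at this
    exact this
  have h1 : quotientHom I x = 0 := hinj (by rw [h0, map_zero])
  exact (Submodule.Quotient.mk_eq_zero _).mp h1

/-- If `R` is an algebra over a field, then the free Lie algebra over `R` embeds into the free
associative algebra. -/
theorem lift_ι_injective (F : Type u) [Field F] (R : Type w) [CommRing R] [Algebra F R]
    (Y : Type v) [Finite Y] :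
    Function.Injective (lift R (FreeAlgebra.ι R : Y → FreeAlgebra R Y)) := by
  let g := lift F (FreeAlgebra.ι F : Y → FreeAlgebra F Y)
  have : IsScalarTower F R (FreeLieAlgebra R Y) := ⟨fun a b x => by
    induction x using Quot.ind with
    | mk x => exact congrArg (Quot.mk _) (smul_assoc a b x)⟩
  let : LieAlgebra F (FreeLieAlgebra R Y) :=
    { lie_smul := fun t x y => by
        rw [← smul_one_smul R t y, lie_smul, smul_one_smul] }
  -- The free Lie algebra over `R` is compared with the scalar extension of the one over `F`. The
  -- map `f` below is injective because `r` inverts it on generators, and `G` is injective because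
  -- `R` is flat over the field.
  let r : R ⊗[F] FreeLieAlgebra F Y →ₗ[R] FreeLieAlgebra R Y :=
    LinearMap.liftBaseChange R (lift F (of R : Y → FreeLieAlgebra R Y) : _ →ₗ[F] _)
  have r_tmul : ∀ a x, r (a ⊗ₜ x) = a • lift F (of R : Y → FreeLieAlgebra R Y) x := fun a x =>
    LinearMap.liftBaseChange_tmul _ _ _ _
  let r' : R ⊗[F] FreeLieAlgebra F Y →ₗ⁅R⁆ FreeLieAlgebra R Y :=
    { r with
      map_lie' := fun {s t} => map_tensor_lie r (fun x y => by
        rw [r_tmul, r_tmul, r_tmul, LieHom.map_lie, one_smul, one_smul, one_smul]) s t }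
  let f : FreeLieAlgebra R Y →ₗ⁅R⁆ R ⊗[F] FreeLieAlgebra F Y := lift R fun y => 1 ⊗ₜ of F y
  have hf : Function.Injective f := by
    have h1 : r'.comp f = LieHom.id := by
      ext y
      have h2 : f (of R y) = 1 ⊗ₜ of F y := lift_of_apply _ _
      rw [LieHom.comp_apply, h2]
      refine (r_tmul _ _).trans ?_
      rw [one_smul, lift_of_apply, LieHom.id_apply]
    exact Function.LeftInverse.injective (g := r') fun x => LieHom.congr_fun h1 x
  let G : R ⊗[F] FreeLieAlgebra F Y →ₗ[R] R ⊗[F] FreeAlgebra F Y :=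
    (g : FreeLieAlgebra F Y →ₗ[F] FreeAlgebra F Y).baseChange R
  have G_tmul : ∀ a x, G (a ⊗ₜ x) = a ⊗ₜ g x := fun a x => LinearMap.baseChange_tmul _ _ _
  have hG : Function.Injective G :=
    Module.Flat.lTensor_preserves_injective_linearMap (M := R)
      (g : FreeLieAlgebra F Y →ₗ[F] FreeAlgebra F Y) (lift_ι_injective_of_field F Y)
  have G_lie : ∀ s t, G ⁅s, t⁆ = G s * G t - G t * G s := fun s t => by
    let : LieRing (R ⊗[F] FreeAlgebra F Y) := LieRing.ofAssociativeRing
    let : LieAlgebra R (R ⊗[F] FreeAlgebra F Y) := LieAlgebra.ofAssociativeAlgebra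
    refine map_tensor_lie G (fun x y => ?_) s t
    refine Eq.trans ?_ (LieRing.of_associative_ring_bracket (G (1 ⊗ₜ x)) (G (1 ⊗ₜ y))).symm
    rw [G_tmul, G_tmul, G_tmul, LieHom.map_lie, LieRing.of_associative_ring_bracket,
      Algebra.TensorProduct.tmul_mul_tmul, Algebra.TensorProduct.tmul_mul_tmul,
      TensorProduct.tmul_sub, mul_one]
  let h : FreeAlgebra R Y →ₐ[R] R ⊗[F] FreeAlgebra F Y :=
    FreeAlgebra.lift R fun y => 1 ⊗ₜ FreeAlgebra.ι F y
  let j := lift R (FreeAlgebra.ι R : Y → FreeAlgebra R Y)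
  have hcomp : ∀ x, G (f x) = h (j x) := by
    let S : LieSubalgebra R (FreeLieAlgebra R Y) :=
      { LinearMap.ker (G ∘ₗ f.toLinearMap - h.toLinearMap ∘ₗ j.toLinearMap) with
        lie_mem' := fun {a b} ha hb => by
          have ha' : G (f a) = h (j a) := sub_eq_zero.mp ha
          have hb' : G (f b) = h (j b) := sub_eq_zero.mp hb
          refine sub_eq_zero.mpr (?_ : G (f ⁅a, b⁆) = h (j ⁅a, b⁆))
          rw [LieHom.map_lie j, LieRing.of_associative_ring_bracket, map_sub, map_mul, map_mul,
            ← ha', ← hb', ← G_lie, LieHom.map_lie f] }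
    intro x
    refine sub_eq_zero.mp (mem_of_forall_of_mem S (fun y =>
      sub_eq_zero.mpr (?_ : G (f (of R y)) = h (j (of R y)))) x)
    rw [show f (of R y) = 1 ⊗ₜ of F y from lift_of_apply _ _, G_tmul]
    simp [g, h, j]
  have hinj : Function.Injective (h ∘ j) := by
    have : (h ∘ j : _ → _) = G ∘ f := funext fun x => (hcomp x).symm
    rw [this]
    exact hG.comp hf
  exact Function.Injective.of_comp hinj

end FreeLieAlgebra

end FreeLie

/-! ### Normal forms of iterated brackets modulo a closed subgroup. -/

theorem exists_perm_pairwise_gt {m : ℕ} {l : List (Fin m)} (hl : l.Nodup) :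
    ∃ l' : List (Fin m), l'.Perm l ∧ l'.Pairwise (· > ·) := by
  refine ⟨l.toFinset.sort (· ≥ ·), ?_, (Finset.sortedGT_sort _).pairwise⟩
  exact (List.perm_ext_iff_of_nodup (Finset.sort_nodup _ _) hl).mpr fun a => by simp

section IteratedBrackets

variable {𝔏 : Type u} [LieRing 𝔏] {m : ℕ}

/-- `ad(ξ_{i₁}) ⋯ ad(ξ_{iᵣ}) (u)` for a list `i₁, …, iᵣ` of indices. -/
def adList (ξ : Fin m → 𝔏) (l : List (Fin m)) (u : 𝔏) : 𝔏 := l.foldr (fun i v => ⁅ξ i, v⁆) u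

theorem adList_append (ξ : Fin m → 𝔏) (l l' : List (Fin m)) (u : 𝔏) :
    adList ξ (l ++ l') u = adList ξ l (adList ξ l' u) := List.foldr_append

theorem adList_add (ξ : Fin m → 𝔏) (l : List (Fin m)) (u v : 𝔏) :
    adList ξ l (u + v) = adList ξ l u + adList ξ l v := by
  induction l with
  | nil => rfl
  | cons i l ih => exact (congrArg _ ih).trans (lie_add _ _ _)

theorem adList_zero (ξ : Fin m → 𝔏) (l : List (Fin m)) : adList ξ l 0 = 0 := by
  induction l with
  | nil => rfl
  | cons i l ih => exact (congrArg _ ih).trans (lie_zero _)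

theorem adList_neg (ξ : Fin m → 𝔏) (l : List (Fin m)) (u : 𝔏) :
    adList ξ l (-u) = -adList ξ l u := by
  rw [eq_neg_iff_add_eq_zero, ← adList_add, neg_add_cancel, adList_zero]

theorem adList_sub (ξ : Fin m → 𝔏) (l : List (Fin m)) (u v : 𝔏) :
    adList ξ l (u - v) = adList ξ l u - adList ξ l v := by
  rw [sub_eq_add_neg, adList_add, adList_neg, sub_eq_add_neg]

/-- By the Leibniz rule the letters of the list distribute over `u` and `v`. The induction passes
the innermost letter to one of the two, which uses up one unit of the bound on that side. -/
theorem adList_lie_mem {ξ : Fin m → 𝔏} {S : AddSubgroup 𝔏}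
    (hS : ∀ x ∈ S, ∀ y ∈ S, ⁅x, y⁆ ∈ S) (n : ℕ) :
    ∀ (u v : 𝔏), (∀ l : List (Fin m), l.length ≤ n → adList ξ l u ∈ S) →
      (∀ l : List (Fin m), l.length ≤ n → adList ξ l v ∈ S) →
      ∀ l : List (Fin m), l.length ≤ n → adList ξ l ⁅u, v⁆ ∈ S := by
  induction n with
  | zero =>
    intro u v hu hv l hl
    obtain rfl := List.eq_nil_of_length_eq_zero (Nat.le_zero.mp hl)
    exact hS _ (hu [] le_rfl) _ (hv [] le_rfl)
  | succ n ih =>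
    intro u v hu hv l hl
    rcases List.eq_nil_or_concat l with rfl | ⟨l, i, rfl⟩
    · exact hS _ (hu [] (by simp)) _ (hv [] (by simp))
    · rw [List.concat_eq_append, List.length_append, List.length_singleton] at hl
      rw [List.concat_eq_append, adList_append]
      change adList ξ l ⁅ξ i, ⁅u, v⁆⁆ ∈ S
      rw [leibniz_lie, adList_add]
      have step : ∀ x, (∀ l : List (Fin m), l.length ≤ n + 1 → adList ξ l x ∈ S) →
          ∀ l : List (Fin m), l.length ≤ n → adList ξ l ⁅ξ i, x⁆ ∈ S := fun x hx l hl => by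
        have := hx (l ++ [i]) (by simpa using hl)
        rwa [adList_append] at this
      exact add_mem
        (ih _ _ (step u hu) (fun l hl => hv l (by omega)) l (by omega))
        (ih _ _ (fun l hl => hu l (by omega)) (step v hv) l (by omega))

/-- A subgroup of a Lie ring of exponent `2` which is closed under brackets and an operator `π`, and
contains partial squares `p i` of the elements `ξ i`. -/
structure IsSquareClosed (ξ p : Fin m → 𝔏) (π : 𝔏 →+ 𝔏) (S : AddSubgroup 𝔏) : Prop where
  lie_p : ∀ i w, ⁅p i, w⁆ = π ⁅ξ i, w⁆ + ⁅ξ i, ⁅ξ i, w⁆⁆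
  lie_π : ∀ x a b : 𝔏, ⁅x, π ⁅a, b⁆⁆ = π ⁅x, ⁅a, b⁆⁆
  lie_mem : ∀ x ∈ S, ∀ y ∈ S, ⁅x, y⁆ ∈ S
  π_mem : ∀ x ∈ S, π x ∈ S
  p_mem : ∀ i, p i ∈ S

/-- The brackets of length `≤ n + 2` of the `ξ i` belong to `S`. -/
def BracketsMem (ξ : Fin m → 𝔏) (S : AddSubgroup 𝔏) (n : ℕ) : Prop :=
  ∀ (a b : Fin m) (l : List (Fin m)), l.length ≤ n → adList ξ l ⁅ξ a, ξ b⁆ ∈ S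

namespace IsSquareClosed

variable {ξ p : Fin m → 𝔏} {π : 𝔏 →+ 𝔏} {S : AddSubgroup 𝔏}


/-- The axiom `lie_π` moves `π` out only when it is applied to a bracket: in the application `π` is
`totalP`, which is zero in degree 1. Each further ad again produces a bracket. -/
theorem adList_π (h : IsSquareClosed ξ p π S) (l : List (Fin m)) (a b : 𝔏) :
    adList ξ l (π ⁅a, b⁆) = π (adList ξ l ⁅a, b⁆) := by
  induction l with
  | nil => rfl
  | cons i l ih =>
    refine (congrArg (fun w => ⁅ξ i, w⁆) ih).trans ?_
    cases l with
    | nil => exact h.lie_π _ _ _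
    | cons j l => exact h.lie_π _ _ _

/-- One bracket with ξⱼ turns `p i` into −(π[ξᵢ, ξⱼ] + [ξᵢ, [ξᵢ, ξⱼ]]), so the innermost letter j is
traded for i in an ordinary iterated bracket. -/
theorem adList_p_mem (h : IsSquareClosed ξ p π S) {n : ℕ} (hn : BracketsMem ξ S n) (i : Fin m)
    (l : List (Fin m)) (hl : l.length ≤ n) : adList ξ l (p i) ∈ S := by
  rcases List.eq_nil_or_concat l with rfl | ⟨l, j, rfl⟩
  · exact h.p_mem i
  · rw [List.concat_eq_append, List.length_append, List.length_singleton] at hl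
    rw [List.concat_eq_append, adList_append]
    change adList ξ l ⁅ξ j, p i⁆ ∈ S
    rw [← lie_skew, h.lie_p, adList_neg, adList_add, h.adList_π]
    refine neg_mem (add_mem (h.π_mem _ (hn _ _ _ (by omega))) ?_)
    have := hn i j (l ++ [i]) (by simpa using hl)
    rwa [adList_append] at this

/-- By Jacobi the difference is the bracket of [ξᵢ, ξⱼ] with a shorter iterate of `w`. The outer
letters distribute over these two, and every piece that arises is short enough to be in `S` already.
-/
theorem swap_mem (h : IsSquareClosed ξ p π S) {n : ℕ} (hn : BracketsMem ξ S n) (w : 𝔏)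
    (hw : ∀ l : List (Fin m), l.length ≤ n → adList ξ l w ∈ S) (i j : Fin m) (l l' : List (Fin m))
    (hl : l.length + l'.length + 2 ≤ n + 1) :
    adList ξ (l ++ i :: j :: l') w - adList ξ (l ++ j :: i :: l') w ∈ S := by
  rw [adList_append, adList_append, ← adList_sub]
  change adList ξ l (⁅ξ i, ⁅ξ j, adList ξ l' w⁆⁆ - ⁅ξ j, ⁅ξ i, adList ξ l' w⁆⁆) ∈ S
  rw [← lie_lie]
  refine adList_lie_mem h.lie_mem l.length _ _ (fun k hk => hn _ _ _ (by omega))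
    (fun k hk => ?_) l le_rfl
  rw [← adList_append]
  exact hw _ (by rw [List.length_append]; omega)

/-- Here ad(ξᵢ)² = ad(pᵢ) − π ad(ξᵢ): the first term is a bracket of elements under control, and the
second has one letter fewer. -/
theorem square_mem (h : IsSquareClosed ξ p π S) {n : ℕ} (hn : BracketsMem ξ S n) (w : 𝔏)
    (hw : ∀ l : List (Fin m), l.length ≤ n → adList ξ l w ∈ S) (i : Fin m) (l l' : List (Fin m))
    (hl : l.length + l'.length + 2 ≤ n + 1) :
    adList ξ (l ++ i :: i :: l') w ∈ S := by
  rw [adList_append]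
  change adList ξ l ⁅ξ i, ⁅ξ i, adList ξ l' w⁆⁆ ∈ S
  rw [show ⁅ξ i, ⁅ξ i, adList ξ l' w⁆⁆ = ⁅p i, adList ξ l' w⁆ - π ⁅ξ i, adList ξ l' w⁆ by
    rw [h.lie_p]; abel, adList_sub, h.adList_π]
  refine sub_mem (adList_lie_mem h.lie_mem l.length _ _
    (fun k hk => h.adList_p_mem hn _ _ (by omega)) (fun k hk => ?_) l le_rfl) (h.π_mem _ ?_)
  · rw [← adList_append]
    exact hw _ (by rw [List.length_append]; omega)
  · have := hw (l ++ i :: l') (by simp; omega)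
    rwa [adList_append] at this

/-- Permutations are generated by adjacent transpositions, covered by `swap_mem`. The prefix `l` is
there so that the case of a common first letter can absorb that letter. -/
theorem adList_mem_of_perm (h : IsSquareClosed ξ p π S) {n : ℕ} (hn : BracketsMem ξ S n) (w : 𝔏)
    (hw : ∀ l : List (Fin m), l.length ≤ n → adList ξ l w ∈ S) {l₁ l₂ : List (Fin m)}
    (hp : l₁.Perm l₂) : ∀ l : List (Fin m), l.length + l₁.length ≤ n + 1 →
      adList ξ (l ++ l₁) w ∈ S → adList ξ (l ++ l₂) w ∈ S := by
  induction hp with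
  | nil => exact fun l _ h => h
  | cons i _ ih =>
    intro l hl hmem
    rw [List.length_cons] at hl
    have := ih (l ++ [i]) (by rw [List.length_append, List.length_singleton]; omega)
    simp only [List.append_assoc, List.singleton_append] at this
    exact this hmem
  | swap i j l' =>
    intro l hl hmem
    rw [List.length_cons, List.length_cons] at hl
    have := sub_mem hmem (h.swap_mem hn w hw j i l l' (by omega))
    rwa [sub_sub_cancel] at this
  | trans h₁ _ ih ih' =>
    exact fun l hl hmem => ih' l (by rwa [← h₁.length_eq]) (ih l hl hmem)

theorem adList_mem_of_not_nodup (h : IsSquareClosed ξ p π S) {n : ℕ} (hn : BracketsMem ξ S n)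
    (w : 𝔏) (hw : ∀ l : List (Fin m), l.length ≤ n → adList ξ l w ∈ S) {l : List (Fin m)}
    (hl : l.length ≤ n + 1) (hd : ¬ l.Nodup) : adList ξ l w ∈ S := by
  rw [← List.exists_duplicate_iff_not_nodup] at hd
  obtain ⟨i, hi⟩ := hd
  obtain ⟨l', hp⟩ := (List.duplicate_iff_sublist.mp hi).exists_perm_append
  have hlen := hp.length_eq
  rw [List.length_append, List.length_cons, List.length_singleton] at hlen
  exact h.adList_mem_of_perm hn w hw hp.symm [] (by simp; omega)
    (h.square_mem hn w hw i [] l' (by simp; omega))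


theorem adList_mem_of_pairwise_gt (h : IsSquareClosed ξ p π S) {n : ℕ} (hn : BracketsMem ξ S n)
    (w : 𝔏) (hw : ∀ l : List (Fin m), l.length ≤ n → adList ξ l w ∈ S)
    (hl : ∀ l : List (Fin m), l.Pairwise (· > ·) → adList ξ l w ∈ S) {l : List (Fin m)}
    (hl' : l.length ≤ n + 1) : adList ξ l w ∈ S := by
  by_cases hd : l.Nodup
  · obtain ⟨l', hp, hl''⟩ := exists_perm_pairwise_gt hd
    exact h.adList_mem_of_perm hn w hw hp [] (by simpa [hp.length_eq] using hl') (hl _ hl'')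
  · exact h.adList_mem_of_not_nodup hn w hw hl' hd

/-- Induction on the length. Modulo `S` the outer letters form a set: order is irrelevant and a
repetition gives an element of `S`. What remains depends on how many of the two innermost letters
recur among the outer ones, and the Jacobi identity is used to make an innermost letter minimal. -/
theorem bracketsMem (h : IsSquareClosed ξ p π S) (hbr : ∀ a b, a < b → ⁅ξ a, ξ b⁆ ∈ S)
    (hsq : ∀ (l : List (Fin m)) (a j : Fin m), (l ++ [a]).Pairwise (· > ·) → j ∉ l ++ [a] →
      adList ξ l ⁅ξ j, ⁅ξ j, ξ a⁆⁆ ∈ S)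
    (had : ∀ (l : List (Fin m)) (a b : Fin m), l ≠ [] → (l ++ [a]).Pairwise (· > ·) → a < b →
      b ∉ l → adList ξ l ⁅ξ a, ξ b⁆ ∈ S) (n : ℕ) : BracketsMem ξ S n := by
  induction n with
  | zero =>
    intro a b l hl
    obtain rfl := List.eq_nil_of_length_eq_zero (Nat.le_zero.mp hl)
    change ⁅ξ a, ξ b⁆ ∈ S
    rcases lt_trichotomy a b with hab | rfl | hab
    · exact hbr a b hab
    · rw [lie_self]; exact zero_mem S
    · rw [← lie_skew]; exact neg_mem (hbr b a hab)
  | succ n hn =>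
    have sym : ∀ (l : List (Fin m)) (a b : Fin m), adList ξ l ⁅ξ a, ξ b⁆ ∈ S →
        adList ξ l ⁅ξ b, ξ a⁆ ∈ S := fun l a b hm => by
      rw [← lie_skew, adList_neg]; exact neg_mem hm
    have perm : ∀ {l l' : List (Fin m)} {a b : Fin m}, l.Perm l' → l.length ≤ n + 1 →
        adList ξ l ⁅ξ a, ξ b⁆ ∈ S → adList ξ l' ⁅ξ a, ξ b⁆ ∈ S := fun {l l' a b} hp hl =>
      h.adList_mem_of_perm hn _ (hn a b) hp [] (by simpa using hl)
    have dup : ∀ {l : List (Fin m)} {a b : Fin m}, l.length ≤ n + 1 → ¬ l.Nodup →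
        adList ξ l ⁅ξ a, ξ b⁆ ∈ S := fun {l a b} hl hd =>
      h.adList_mem_of_not_nodup hn _ (hn a b) hl hd
    -- Cyclic exchange of the three innermost letters: two of the three arrangements in `S` force
    -- the third.
    have jac : ∀ (l : List (Fin m)) (a b c : Fin m), adList ξ (l ++ [a]) ⁅ξ b, ξ c⁆ ∈ S →
        adList ξ (l ++ [b]) ⁅ξ c, ξ a⁆ ∈ S → adList ξ (l ++ [c]) ⁅ξ a, ξ b⁆ ∈ S := by
      intro l a b c h₁ h₂
      rw [adList_append] at h₁ h₂ ⊢
      have e : adList ξ l (⁅ξ a, ⁅ξ b, ξ c⁆⁆ + ⁅ξ b, ⁅ξ c, ξ a⁆⁆ + ⁅ξ c, ⁅ξ a, ξ b⁆⁆) = 0 := by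
        rw [lie_jacobi, adList_zero]
      rw [adList_add, adList_add] at e
      have : adList ξ l ⁅ξ c, ⁅ξ a, ξ b⁆⁆ =
          -(adList ξ l ⁅ξ a, ⁅ξ b, ξ c⁆⁆ + adList ξ l ⁅ξ b, ⁅ξ c, ξ a⁆⁆) := by
        rw [eq_neg_iff_add_eq_zero, add_comm]; exact e
      change adList ξ l ⁅ξ c, ⁅ξ a, ξ b⁆⁆ ∈ S
      rw [this]
      exact neg_mem (add_mem h₁ h₂)
    have toEnd : ∀ {l : List (Fin m)} {a : Fin m}, a ∈ l → (l.erase a ++ [a]).Perm l :=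
      fun {l a} ha => (List.perm_append_singleton _ _).trans (List.perm_cons_erase ha).symm
    have exMin : ∀ (a : Fin m) (l : List (Fin m)), ∃ i ∈ a :: l, ∀ x ∈ a :: l, i ≤ x :=
      fun a l => by
        obtain ⟨i, hi, hm⟩ := (a :: l).toFinset.exists_min_image id ⟨a, by simp⟩
        exact ⟨i, List.mem_toFinset.mp hi, fun x hx => hm x (List.mem_toFinset.mpr hx)⟩
    -- one repeated index, the innermost one minimal
    have sq_min : ∀ (l : List (Fin m)) (a b : Fin m), l.length + 1 ≤ n + 1 → l.Nodup →
        (∀ x ∈ l, a < x) → b ∉ l → b ≠ a → adList ξ (l ++ [b]) ⁅ξ a, ξ b⁆ ∈ S := by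
      intro l a b hl hd ha hb hba
      obtain ⟨l', hp, hl'⟩ := exists_perm_pairwise_gt hd
      refine perm (hp.append_right [b]) (by simpa [hp.length_eq] using hl) (sym _ _ _ ?_)
      rw [adList_append]
      refine hsq l' a b ?_ ?_
      · rw [List.pairwise_append]
        exact ⟨hl', List.pairwise_singleton _ _, fun x hx y hy => by
          rw [List.mem_singleton.mp hy]; exact ha x (hp.mem_iff.mp hx)⟩
      · rw [List.mem_append, List.mem_singleton, hp.mem_iff]; tauto
    -- one repeated index
    have sq : ∀ (l : List (Fin m)) (a b : Fin m), l.length ≤ n + 1 → l.Nodup → a ∉ l → b ∈ l →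
        adList ξ l ⁅ξ a, ξ b⁆ ∈ S := by
      intro l a b hl hd ha hb
      have hba : b ≠ a := fun e => ha (e ▸ hb)
      have hp := toEnd hb
      have hlen : (l.erase b ++ [b]).length = l.length := hp.length_eq
      rw [List.length_append, List.length_singleton] at hlen
      have hd' := hd.erase b
      have hb' : b ∉ l.erase b := hd.not_mem_erase
      have ha' : a ∉ l.erase b := fun hm => ha (List.mem_of_mem_erase hm)
      refine perm hp (by rw [List.length_append, List.length_singleton]; omega) ?_
      generalize l.erase b = l₀ at *
      obtain ⟨i, hi, hmin⟩ := exMin a l₀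
      rcases List.mem_cons.mp hi with rfl | hi
      · exact sq_min l₀ i b (by omega) hd'
          (fun x hx => lt_of_le_of_ne (hmin x (List.mem_cons_of_mem _ hx))
            fun e => ha' (e ▸ hx)) hb' hba
      · have hp' := toEnd hi
        have hlen' : (l₀.erase i ++ [i]).length = l₀.length := hp'.length_eq
        rw [List.length_append, List.length_singleton] at hlen'
        have hia : i ≠ a := fun e => ha' (e ▸ hi)
        have hib : i ≠ b := fun e => hb' (e ▸ hi)
        refine perm (l := l₀.erase i ++ [b] ++ [i]) ?_ (by simp; omega) ?_
        · rw [List.append_assoc]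
          refine ((List.Perm.swap _ _ _).append_left _).trans ?_
          rw [← List.singleton_append, ← List.append_assoc]
          exact hp'.append_right [b]
        -- With the minimal letter i moved next to the innermost bracket, Jacobi leaves two terms.
        -- One has i in the innermost bracket and is covered by `sq_min`; the other has b twice
        -- among the outer letters.
        · refine jac _ a b i ?_ ?_
          · refine perm (l := l₀.erase i ++ [a] ++ [b]) ?_ (by simp; omega) (sym _ _ _ ?_)
            · rw [List.append_assoc, List.append_assoc]
              exact (List.Perm.swap _ _ _).append_left _
            · refine sq_min _ i b (by simp; omega) ?_ ?_ ?_ hib.symm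
              · rw [List.nodup_append]
                refine ⟨hd'.erase i, List.nodup_singleton a, fun x hx y hy => ?_⟩
                rw [List.mem_singleton.mp hy]
                exact fun e => ha' (e ▸ List.mem_of_mem_erase hx)
              · intro x hx
                rcases List.mem_append.mp hx with hx | hx
                · exact lt_of_le_of_ne
                    (hmin x (List.mem_cons_of_mem _ (List.mem_of_mem_erase hx)))
                    fun e => hd'.not_mem_erase (e ▸ hx)
                · rw [List.mem_singleton.mp hx]
                  exact lt_of_le_of_ne (hmin a List.mem_cons_self) hia
              · rw [List.mem_append, List.mem_singleton]
                rintro (hx | hx)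
                · exact hb' (List.mem_of_mem_erase hx)
                · exact hba hx
          · refine dup (by simp; omega) fun hd => ?_
            rw [List.append_assoc, List.nodup_append] at hd
            simp at hd
    -- two repeated indices
    have sq2 : ∀ (l : List (Fin m)) (a b : Fin m), l.length ≤ n + 1 → l.Nodup → a ≠ b → a ∈ l →
        b ∈ l → adList ξ l ⁅ξ a, ξ b⁆ ∈ S := by
      intro l a b hl hd hab ha hb
      have hp := toEnd ha
      have hb' : b ∈ l.erase a := (List.mem_erase_of_ne hab.symm).mpr hb
      have hp' := toEnd hb'
      have hlen : (l.erase a ++ [a]).length = l.length := hp.length_eq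
      have hlen' : ((l.erase a).erase b ++ [b]).length = (l.erase a).length := hp'.length_eq
      rw [List.length_append, List.length_singleton] at hlen hlen'
      refine perm ((hp'.append_right [a]).trans hp) (by simp; omega) ?_
      generalize (l.erase a).erase b = l₀ at *
      rw [List.append_assoc, adList_append]
      change adList ξ l₀ ⁅ξ b, ⁅ξ a, ⁅ξ a, ξ b⁆⁆⁆ ∈ S
      -- Replace ad(ξ_a)² by ad(p_a) − π ad(ξ_a). Then [ξ_b, [p_a, ξ_b]] is −ad(ξ_b)²(p_a), where
      -- ad(ξ_b)² is replaced in the same way. Only p's and shorter brackets survive.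
      have e : ⁅ξ b, ⁅ξ a, ⁅ξ a, ξ b⁆⁆⁆ =
          -⁅p b, p a⁆ + π ⁅ξ b, p a⁆ - π ⁅ξ b, ⁅ξ a, ξ b⁆⁆ := by
        have e1 : ⁅ξ a, ⁅ξ a, ξ b⁆⁆ = ⁅p a, ξ b⁆ - π ⁅ξ a, ξ b⁆ := by rw [h.lie_p]; abel
        have e2 : ⁅ξ b, ⁅p a, ξ b⁆⁆ = -⁅p b, p a⁆ + π ⁅ξ b, p a⁆ := by
          rw [h.lie_p b, ← lie_skew (p a), lie_neg]; abel
        rw [e1, lie_sub, e2, h.lie_π]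
      rw [e, adList_sub, adList_add, adList_neg, h.adList_π, h.adList_π]
      refine sub_mem (add_mem (neg_mem (adList_lie_mem h.lie_mem n _ _ (h.adList_p_mem hn b)
        (h.adList_p_mem hn a) _ (by omega))) (h.π_mem _ ?_)) (h.π_mem _ ?_)
      · have := h.adList_p_mem hn a (l₀ ++ [b]) (by simp; omega)
        rwa [adList_append] at this
      · have := hn a b (l₀ ++ [b]) (by simp; omega)
        rwa [adList_append] at this
    -- no repeated index, the innermost one minimal
    have ad_min : ∀ (l : List (Fin m)) (a b : Fin m), l.length = n + 1 → l.Nodup →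
        (∀ x ∈ l, a < x) → b ∉ l → a < b → adList ξ l ⁅ξ a, ξ b⁆ ∈ S := by
      intro l a b hl hd ha hb hab
      obtain ⟨l', hp, hl'⟩ := exists_perm_pairwise_gt hd
      refine perm hp (by rw [hp.length_eq, hl]) (had l' a b ?_ ?_ hab ?_)
      · rintro rfl
        rw [← hp.length_eq] at hl
        simp at hl
      · rw [List.pairwise_append]
        exact ⟨hl', List.pairwise_singleton _ _, fun x hx y hy => by
          rw [List.mem_singleton.mp hy]; exact ha x (hp.mem_iff.mp hx)⟩
      · rwa [hp.mem_iff]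
    intro a b l hl
    rcases Nat.lt_or_ge n l.length with hlt | hle
    swap
    · exact hn a b l hle
    replace hl : l.length = n + 1 := le_antisymm hl hlt
    by_cases hab : a = b
    · subst hab; rw [lie_self, adList_zero]; exact zero_mem S
    by_cases hd : l.Nodup
    swap
    · exact dup hl.le hd
    by_cases ha : a ∈ l
    · by_cases hb : b ∈ l
      · exact sq2 l a b hl.le hd hab ha hb
      · exact sym _ _ _ (sq l b a hl.le hd hb ha)
    by_cases hb : b ∈ l
    · exact sq l a b hl.le hd ha hb
    -- All letters are now distinct. If the least one is a or b, `ad_min` applies up to sign;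
    -- otherwise it is moved next to the innermost bracket, and Jacobi expresses the element by two
    -- brackets having it innermost.
    obtain ⟨i, hi, hmin⟩ := exMin a (b :: l)
    rcases List.mem_cons.mp hi with rfl | hi
    · exact ad_min l i b hl hd (fun x hx => lt_of_le_of_ne (hmin x (by simp [hx]))
        fun e => ha (e ▸ hx)) hb (lt_of_le_of_ne (hmin b (by simp)) hab)
    rcases List.mem_cons.mp hi with rfl | hi
    · exact sym _ _ _ (ad_min l i a hl hd (fun x hx => lt_of_le_of_ne (hmin x (by simp [hx]))
        fun e => hb (e ▸ hx)) ha (lt_of_le_of_ne (hmin a (by simp)) (Ne.symm hab)))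
    have hp := toEnd hi
    have hlen : (l.erase i ++ [i]).length = l.length := hp.length_eq
    rw [List.length_append, List.length_singleton] at hlen
    have hia : i < a := lt_of_le_of_ne (hmin a (by simp)) fun e => ha (e ▸ hi)
    have hib : i < b := lt_of_le_of_ne (hmin b (by simp)) fun e => hb (e ▸ hi)
    have key : ∀ c d : Fin m, c ∉ l → d ∉ l → i < c → i < d → c ≠ d →
        adList ξ (l.erase i ++ [c]) ⁅ξ i, ξ d⁆ ∈ S := by
      intro c d hc hd' hic hid hcd
      refine ad_min _ i d (by rw [List.length_append, List.length_singleton]; omega) ?_ ?_ ?_ hid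
      · rw [List.nodup_append]
        refine ⟨hd.erase i, List.nodup_singleton c, fun x hx y hy => ?_⟩
        rw [List.mem_singleton.mp hy]
        exact fun e => hc (e ▸ List.mem_of_mem_erase hx)
      · intro x hx
        rcases List.mem_append.mp hx with hx | hx
        · exact lt_of_le_of_ne (hmin x (by simp [List.mem_of_mem_erase hx]))
            fun e => hd.not_mem_erase (e ▸ hx)
        · rw [List.mem_singleton.mp hx]; exact hic
      · rw [List.mem_append, List.mem_singleton]
        rintro (hx | hx)
        · exact hd' (List.mem_of_mem_erase hx)
        · exact hcd hx.symm
    refine perm hp (by rw [List.length_append, List.length_singleton]; omega) (jac _ a b i ?_ ?_)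
    · exact sym _ _ _ (key a b ha hb hia hib hab)
    · exact key b a hb ha hib hia (Ne.symm hab)

/-- For an arbitrary innermost `w` no exchange with it is needed: sorting the outer letters and
removing repetitions suffices. -/
theorem adList_mem (h : IsSquareClosed ξ p π S) (hn : ∀ n, BracketsMem ξ S n) (w : 𝔏)
    (hl : ∀ l : List (Fin m), l.Pairwise (· > ·) → adList ξ l w ∈ S) (l : List (Fin m)) :
    adList ξ l w ∈ S := by
  have : ∀ n, ∀ l : List (Fin m), l.length ≤ n → adList ξ l w ∈ S := by
    intro n
    induction n with
    | zero =>
      intro l hl'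
      obtain rfl := List.eq_nil_of_length_eq_zero (Nat.le_zero.mp hl')
      exact hl [] List.Pairwise.nil
    | succ n ih => exact fun l hl' => h.adList_mem_of_pairwise_gt (hn n) w ih hl hl'
  exact this _ l le_rfl

end IsSquareClosed


end IteratedBrackets

/-! ### Generation of the part of degree greater than 1 by `Y`. -/

namespace MixedLieAlgebra

variable {𝔤 : MixedLieAlgebra.{u}}

theorem P_one_zero {k : ℕ+} (h : 1 + 1 = k) : 𝔤.P h (0 : 𝔤.comp 1) = 0 := by
  have e := 𝔤.P_add_one h 0 0
  rw [𝔤.lie_eq_zero, add_zero, add_zero] at e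
  exact left_eq_add.mp e

theorem P_zero {n k : ℕ+} (h : n + 1 = k) : 𝔤.P h (0 : 𝔤.comp n) = 0 := by
  by_cases hn : 1 < n
  · have e := 𝔤.P_add hn h 0 0
    rw [add_zero] at e
    exact left_eq_add.mp e
  · obtain rfl : n = 1 := le_antisymm (not_lt.mp hn) one_le
    exact P_one_zero h

/-- `[Pξ, w] = π[ξ, w] + [ξ, [ξ, w]]` for `ξ` of degree `1`. -/
theorem bracket_P_of {n k : ℕ+} (hn : n = 1) (h : n + 1 = k) (a : 𝔤.comp n) (w : 𝔤.Total) :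
    ⁅𝔤.of k (𝔤.P h a), w⁆ = 𝔤.totalP ⁅𝔤.of n a, w⁆ + ⁅𝔤.of n a, ⁅𝔤.of n a, w⁆⁆ := by
  subst hn
  induction w using induction_total with
  | zero => simp
  | add x y hx hy => simp only [lie_add, map_add, hx, hy]; abel
  | of m b =>
    have hm : (1 : ℕ+) < 1 + m := PNat.lt_add_right 1 m
    rw [bracket_of (k := k + m) rfl, bracket_of (k := 1 + m) rfl,
      bracket_of (k := k + m) (by rw [← h, add_assoc]),
      totalP_of hm (k := k + m) (by rw [← h, add_right_comm]), ← map_add]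
    exact congrArg _ (𝔤.P_lie_one h _ _ _ _ a b)

end MixedLieAlgebra

section Generation

variable {d m : ℕ} (hmd : m ≤ d) (τ : Fin d → ℕ+)

open MixedLieAlgebra

/-- Subgroups of `L_mix(X)` which contain `Y` and are closed under brackets and the action of
`π`. -/
structure IsYClosed (S : AddSubgroup (freeMixedLie τ).Total) : Prop where
  lie_mem : ∀ x ∈ S, ∀ y ∈ S, ⁅x, y⁆ ∈ S
  π_mem : ∀ x ∈ S, (freeMixedLie τ).totalP x ∈ S
  y_mem : ∀ y : YIndex d m, yTotal hmd τ y ∈ S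

variable {hmd τ}

theorem IsYClosed.isSquareClosed (hτ : ∀ i : Fin d, τ i = 1 ↔ (i : ℕ) < m)
    {S : AddSubgroup (freeMixedLie τ).Total} (hS : IsYClosed hmd τ S) :
    IsSquareClosed (fun i : Fin m => ξ τ (i.castLE hmd)) (fun i => Pξ τ (i.castLE hmd))
      (freeMixedLie τ).totalP.toAddMonoidHom S where
  lie_p i w := bracket_P_of ((hτ _).mpr i.2) rfl _ w
  lie_π x a b := bracket_totalP x _ (bracket_mem_plus a b)
  lie_mem := hS.lie_mem
  π_mem := hS.π_mem
  p_mem i := hS.y_mem (.sq i)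

theorem IsYClosed.bracketsMem (hτ : ∀ i : Fin d, τ i = 1 ↔ (i : ℕ) < m)
    {S : AddSubgroup (freeMixedLie τ).Total} (hS : IsYClosed hmd τ S) (n : ℕ) :
    BracketsMem (fun i : Fin m => ξ τ (i.castLE hmd)) S n := by
  refine (hS.isSquareClosed hτ).bracketsMem (fun a b hab => hS.y_mem (.br a b hab)) ?_ ?_ n
  · intro l a j hl hj
    exact hS.y_mem (.adSq _ ⟨l, a, j, rfl, hl, hj⟩)
  · intro l a b hl hd hab hb
    refine hS.y_mem (.ad _ ⟨l, a, b, ?_, rfl, hd, hab, hb⟩)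
    have := List.length_pos_iff.mpr hl
    omega

theorem IsYClosed.adList_mem (hτ : ∀ i : Fin d, τ i = 1 ↔ (i : ℕ) < m)
    {S : AddSubgroup (freeMixedLie τ).Total} (hS : IsYClosed hmd τ S) (j : Fin d)
    (hj : m ≤ (j : ℕ)) (l : List (Fin m)) :
    adList (fun i : Fin m => ξ τ (i.castLE hmd)) l (ξ τ j) ∈ S := by
  refine (hS.isSquareClosed hτ).adList_mem (hS.bracketsMem hτ) _ (fun l hl => ?_) l
  -- The three families involving a generator of weight > 1 are one family, split by the length 0, 1
  -- or at least 2 of the list.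
  match l, hl with
  | [], _ => exact hS.y_mem (.gen j hj)
  | [i], _ => exact hS.y_mem (.brMixed i j hj)
  | i :: i' :: l, hl => exact hS.y_mem (.adMixed _ ⟨i :: i' :: l, j, by simp, rfl, hl, hj⟩)

/-- The subgroup need not contain ξᵢ. Bracketing with ξᵢ only lengthens the iterated bracket that
defines an element of `Y`, and all such brackets were shown to lie in `S`. -/
theorem IsYClosed.lie_y_mem (hτ : ∀ i : Fin d, τ i = 1 ↔ (i : ℕ) < m)
    {S : AddSubgroup (freeMixedLie τ).Total} (hS : IsYClosed hmd τ S) (i : Fin m)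
    (y : YIndex d m) : ⁅ξ τ (i.castLE hmd), yTotal hmd τ y⁆ ∈ S := by
  have hb := hS.bracketsMem hτ
  cases y with
  | sq j => exact (hS.isSquareClosed hτ).adList_p_mem (hb 1) j [i] le_rfl
  | br a b hab => exact hb 1 a b [i] le_rfl
  | gen j hj => exact hS.adList_mem hτ j hj [i]
  | brMixed a j hj => exact hS.adList_mem hτ j hj [i, a]
  | adSq k s =>
    have := hb (s.init.length + 2) s.j s.last (i :: s.init ++ [s.j]) (by simp)
    rwa [adList_append] at this
  | ad k s => exact hb (s.init.length + 1) s.a s.b (i :: s.init) (by simp)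
  | adMixed k s => exact hS.adList_mem hτ s.last s.le (i :: s.init)

variable (hmd τ) in
/-- The smallest subgroup containing `Y` and closed under brackets and the action of `π`. -/
def yClosure : AddSubgroup (freeMixedLie τ).Total := sInf {S | IsYClosed hmd τ S}

theorem isYClosed_yClosure : IsYClosed hmd τ (yClosure hmd τ) where
  lie_mem x hx y hy := by
    rw [yClosure, AddSubgroup.mem_sInf] at *
    exact fun S hS => hS.lie_mem _ (hx S hS) _ (hy S hS)
  π_mem x hx := by
    rw [yClosure, AddSubgroup.mem_sInf] at *
    exact fun S hS => hS.π_mem _ (hx S hS)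
  y_mem y := by
    rw [yClosure, AddSubgroup.mem_sInf]
    exact fun S hS => hS.y_mem y

theorem yClosure_le {S : AddSubgroup (freeMixedLie τ).Total} (hS : IsYClosed hmd τ S) :
    yClosure hmd τ ≤ S := sInf_le hS

theorem mem_plus_of_mem_yClosure (hτ : ∀ i : Fin d, τ i = 1 ↔ (i : ℕ) < m)
    {x : (freeMixedLie τ).Total} (hx : x ∈ yClosure hmd τ) : x ∈ (freeMixedLie τ).plus :=
  yClosure_le (S := (freeMixedLie τ).plus.toSubmodule.toAddSubgroup)
    ⟨fun x _ y _ => bracket_mem_plus x y, fun x _ => totalP_mem_plus x, yTotal_mem_plus hmd τ hτ⟩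
    hx

/-- The elements of the closure whose bracket with ξᵢ stays in the closure contain `Y` and are
closed under brackets (Leibniz) and under `π`; minimality does the rest. Moving `π` through the
bracket needs the element to have no component of degree 1. -/
theorem lie_mem_yClosure (hτ : ∀ i : Fin d, τ i = 1 ↔ (i : ℕ) < m) (i : Fin m)
    {x : (freeMixedLie τ).Total} (hx : x ∈ yClosure hmd τ) :
    ⁅ξ τ (i.castLE hmd), x⁆ ∈ yClosure hmd τ := by
  let S : AddSubgroup (freeMixedLie τ).Total :=
    { carrier := {x | x ∈ yClosure hmd τ ∧ ⁅ξ τ (i.castLE hmd), x⁆ ∈ yClosure hmd τ}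
      add_mem' := fun {x y} hx hy => ⟨add_mem hx.1 hy.1, by
        rw [lie_add]; exact add_mem hx.2 hy.2⟩
      zero_mem' := ⟨zero_mem _, by rw [lie_zero]; exact zero_mem _⟩
      neg_mem' := fun {x} hx => ⟨neg_mem hx.1, by rw [lie_neg]; exact neg_mem hx.2⟩ }
  have h := isYClosed_yClosure (hmd := hmd) (τ := τ)
  refine (yClosure_le (S := S) ⟨?_, ?_, ?_⟩ hx).2
  · intro x hx y hy
    refine ⟨h.lie_mem _ hx.1 _ hy.1, ?_⟩
    rw [leibniz_lie]
    exact add_mem (h.lie_mem _ hx.2 _ hy.1) (h.lie_mem _ hx.1 _ hy.2)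
  · intro x hx
    refine ⟨h.π_mem _ hx.1, ?_⟩
    rw [bracket_totalP _ _ (mem_plus_of_mem_yClosure hτ hx.1)]
    exact h.π_mem _ hx.2
  · exact fun y => ⟨h.y_mem y, h.lie_y_mem hτ i y⟩

-- Induction on formal expressions. Degree 1 must carry two assertions, because `P` is not additive
-- there: P(a + b) involves [a, b], which is controlled only by knowing that a and b are sums of the
-- ξᵢ.
open FreeMixedLie in
theorem mk_mem_yClosure (hτ : ∀ i : Fin d, τ i = 1 ↔ (i : ℕ) < m) {n : ℕ+} (w : Word τ n) :
    (n = 1 → (freeMixedLie τ).of n (mk w) ∈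
        AddSubgroup.closure (Set.range fun i : Fin m => ξ τ (i.castLE hmd)) ∧
      ∀ (k : ℕ+) (h : n + 1 = k), (freeMixedLie τ).of k ((freeMixedLie τ).P h (mk w)) ∈
        yClosure hmd τ) ∧
    (n ≠ 1 → (freeMixedLie τ).of n (mk w) ∈ yClosure hmd τ) := by
  have hc := isYClosed_yClosure (hmd := hmd) (τ := τ)
  have lie₁ : ∀ x ∈ AddSubgroup.closure (Set.range fun i : Fin m => ξ τ (i.castLE hmd)),
      ∀ y ∈ yClosure hmd τ, ⁅x, y⁆ ∈ yClosure hmd τ := by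
    intro x hx y hy
    induction hx using AddSubgroup.closure_induction with
    | mem x hx => obtain ⟨i, rfl⟩ := hx; exact lie_mem_yClosure hτ i hy
    | zero => rw [zero_lie]; exact zero_mem _
    | add x x' _ _ h h' => rw [add_lie]; exact add_mem h h'
    | neg x _ h => rw [neg_lie]; exact neg_mem h
  have lie₁₁ : ∀ x ∈ AddSubgroup.closure (Set.range fun i : Fin m => ξ τ (i.castLE hmd)),
      ∀ y ∈ AddSubgroup.closure (Set.range fun i : Fin m => ξ τ (i.castLE hmd)),
        ⁅x, y⁆ ∈ yClosure hmd τ := by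
    intro x hx y hy
    induction hx using AddSubgroup.closure_induction with
    | mem x hx =>
      obtain ⟨i, rfl⟩ := hx
      induction hy using AddSubgroup.closure_induction with
      | mem y hy => obtain ⟨j, rfl⟩ := hy; exact hc.bracketsMem hτ 0 i j [] le_rfl
      | zero => rw [lie_zero]; exact zero_mem _
      | add x x' _ _ h h' => rw [lie_add]; exact add_mem h h'
      | neg x _ h => rw [lie_neg]; exact neg_mem h
    | zero => rw [zero_lie]; exact zero_mem _
    | add x x' _ _ h h' => rw [add_lie]; exact add_mem h h'
    | neg x _ h => rw [neg_lie]; exact neg_mem h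
  induction w with
  | gen i =>
    refine ⟨fun hi => ⟨AddSubgroup.subset_closure ⟨⟨i, (hτ i).mp hi⟩, rfl⟩, ?_⟩, fun hi => ?_⟩
    · rintro k rfl
      exact hc.y_mem (.sq ⟨i, (hτ i).mp hi⟩)
    · exact hc.y_mem (.gen i (not_lt.mp fun h => hi ((hτ i).mpr h)))
  | zero n =>
    have h0 : (mk (Word.zero n) : Comp τ n) = 0 := rfl
    refine ⟨fun hn => ⟨?_, fun k h => ?_⟩, fun _ => ?_⟩
    · rw [h0]; exact (map_zero ((freeMixedLie τ).of n)) ▸ zero_mem _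
    · have : (freeMixedLie τ).P h (mk (Word.zero n)) = 0 := P_zero h
      rw [this, map_zero]; exact zero_mem _
    · rw [h0]; exact (map_zero ((freeMixedLie τ).of n)) ▸ zero_mem _
  | @add n a b ha hb =>
    have hab : (freeMixedLie τ).of n (mk (a.add b)) =
      (freeMixedLie τ).of n (mk a) + (freeMixedLie τ).of n (mk b) :=
        map_add ((freeMixedLie τ).of n) (mk a : Comp τ n) (mk b : Comp τ n)
    rw [hab]
    refine ⟨fun hn => ⟨add_mem (ha.1 hn).1 (hb.1 hn).1, fun k h => ?_⟩,
      fun hn => add_mem (ha.2 hn) (hb.2 hn)⟩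
    subst hn
    have e : ∀ x y : (freeMixedLie τ).comp 1, (freeMixedLie τ).of k ((freeMixedLie τ).P h (x + y)) =
        (freeMixedLie τ).of k ((freeMixedLie τ).P h x) +
          (freeMixedLie τ).of k ((freeMixedLie τ).P h y) +
          ⁅(freeMixedLie τ).of 1 x, (freeMixedLie τ).of 1 y⁆ := fun x y => by
      rw [(freeMixedLie τ).P_add_one, map_add, map_add, bracket_of]
    refine (congrArg (· ∈ yClosure hmd τ) (e (mk a : Comp τ 1) (mk b : Comp τ 1))).mpr ?_
    exact add_mem (add_mem ((ha.1 rfl).2 _ _) ((hb.1 rfl).2 _ _))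
      (lie₁₁ _ (ha.1 rfl).1 _ (hb.1 rfl).1)
  | @lie p q k h a b ha hb =>
    have hk : k ≠ 1 := by
      rw [← h]
      intro e
      have := congrArg PNat.val e
      have h1 := p.pos
      have h2 := q.pos
      simp only [PNat.add_coe, PNat.one_coe] at this
      omega
    refine ⟨fun e => absurd e hk, fun _ => ?_⟩
    have e : (freeMixedLie τ).of k (mk (Word.lie h a b)) =
        ⁅(freeMixedLie τ).of p (mk a), (freeMixedLie τ).of q (mk b)⁆ := 
      (bracket_of (𝔤 := freeMixedLie τ) h (mk a : Comp τ p) (mk b : Comp τ q)).symm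
    rw [e]
    by_cases hp : p = 1
    · by_cases hq : q = 1
      · exact lie₁₁ _ (ha.1 hp).1 _ (hb.1 hq).1
      · exact lie₁ _ (ha.1 hp).1 _ (hb.2 hq)
    · by_cases hq : q = 1
      · rw [← lie_skew]; exact neg_mem (lie₁ _ (hb.1 hq).1 _ (ha.2 hp))
      · exact hc.lie_mem _ (ha.2 hp) _ (hb.2 hq)
  | @P n k h a ha =>
    have hk : k ≠ 1 := h ▸ add_one_ne_one n
    refine ⟨fun e => absurd e hk, fun _ => ?_⟩
    by_cases hn : n = 1
    · exact (ha.1 hn).2 k h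
    · have e : (freeMixedLie τ).of k (mk (Word.P h a)) =
          (freeMixedLie τ).totalP ((freeMixedLie τ).of n (mk a)) :=
        (totalP_of (𝔤 := freeMixedLie τ) (lt_of_le_of_ne one_le (Ne.symm hn)) h
          (mk a : Comp τ n)).symm
      rw [e]
      exact hc.π_mem _ (ha.2 hn)

/-- `L⁺(X)` is the smallest subgroup of `L_mix(X)` containing `Y` and closed under brackets and the
action of `π`. -/
theorem IsYClosed.plus_le (hτ : ∀ i : Fin d, τ i = 1 ↔ (i : ℕ) < m)
    {S : AddSubgroup (freeMixedLie τ).Total} (hS : IsYClosed hmd τ S)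
    {x : (freeMixedLie τ).Total} (hx : x ∈ (freeMixedLie τ).plus) : x ∈ S := by
  have key : ∀ x : (freeMixedLie τ).Total,
      x - (freeMixedLie τ).of 1 ((freeMixedLie τ).proj 1 x) ∈ yClosure hmd τ := by
    intro x
    induction x using induction_total with
    | zero => simp [zero_mem]
    | add x y hx hy =>
      rw [map_add, map_add, add_sub_add_comm]
      exact add_mem hx hy
    | of n a =>
      by_cases hn : n = 1
      · subst hn
        rw [proj_of_same, sub_self]
        exact zero_mem _
      · rw [proj_of_ne hn, map_zero, sub_zero]
        obtain ⟨w, rfl⟩ := FreeMixedLie.mk_surjective a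
        exact (mk_mem_yClosure hτ w).2 hn
  have := key x
  rw [mem_plus.mp hx, map_zero, sub_zero] at this
  exact yClosure_le hS this

end Generation

/-! ### Ordered monomials as generators of a module over a subalgebra. -/

section OrderedMonomials

variable {k : Type u} {A : Type v} [CommRing k] [Ring A] [Algebra k A]

theorem Submodule.prod_span_pair_le {n : ℕ} (f : Fin n → A) :
    (List.ofFn fun i => Submodule.span k {1, f i}).prod ≤
      Submodule.span k (Set.range fun e : Fin n → Fin 2 => (List.ofFn fun i => f i ^ (e i : ℕ)).prod) := by
  induction n with
  | zero =>
    rw [List.ofFn_zero, List.prod_nil, Submodule.one_le]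
    exact Submodule.subset_span ⟨Fin.elim0, by simp⟩
  | succ n ih =>
    rw [List.ofFn_succ, List.prod_cons]
    refine (mul_le_mul_right (ih fun i => f i.succ) _).trans ?_
    rw [Submodule.span_mul_span]
    refine Submodule.span_mono ?_
    rintro _ ⟨x, hx, _, ⟨e, rfl⟩, rfl⟩
    rcases hx with rfl | rfl
    · exact ⟨Fin.cons 0 e, by simp [List.ofFn_succ]⟩
    · exact ⟨Fin.cons 1 e, by simp [List.ofFn_succ]⟩

/-- Elements of an algebra which commute with a subalgebra and with each other, and are idempotent
up to scalars, modulo the subalgebra. -/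
structure IsAlmostCentral (B : Subalgebra k A) {m : ℕ} (x : Fin m → A) : Prop where
  comm_mem : ∀ i, ∀ b ∈ B, x i * b - b * x i ∈ B
  comm_mem' : ∀ i j, x i * x j - x j * x i ∈ B
  sq_mem : ∀ i, ∃ c : k, c • x i + x i * x i ∈ B

namespace IsAlmostCentral

variable {B : Subalgebra k A} {m : ℕ} {x : Fin m → A}

/-- Moving b past xᵢ costs the commutator, which lies in `B` and is absorbed by the vector 1 of the
span. -/
theorem mul_comm_span (h : IsAlmostCentral B x) (i : Fin m) :
    Subalgebra.toSubmodule B * Submodule.span k {1, x i} =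
      Submodule.span k {1, x i} * Subalgebra.toSubmodule B := by
  have h1 : (1 : A) ∈ Submodule.span k {1, x i} := Submodule.subset_span (by simp)
  have hx : x i ∈ Submodule.span k {1, x i} := Submodule.subset_span (by simp)
  apply le_antisymm
  · rw [Submodule.mul_le]
    intro b hb y hy
    obtain ⟨c, c', rfl⟩ := Submodule.mem_span_pair.mp hy
    have e : b * (c • 1 + c' • x i) = (c • 1 + c' • x i) * b + 1 * (c' • -(x i * b - b * x i)) := by
      simp only [mul_add, add_mul, mul_smul_comm, smul_mul_assoc, mul_one, one_mul, smul_neg,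
        smul_sub]
      abel
    rw [e]
    exact add_mem (Submodule.mul_mem_mul hy hb) (Submodule.mul_mem_mul h1
      (B.smul_mem (neg_mem (h.comm_mem i b hb)) c'))
  · rw [Submodule.mul_le]
    intro y hy b hb
    obtain ⟨c, c', rfl⟩ := Submodule.mem_span_pair.mp hy
    have e : (c • 1 + c' • x i) * b = b * (c • 1 + c' • x i) + (c' • (x i * b - b * x i)) * 1 := by
      simp only [mul_add, add_mul, mul_smul_comm, smul_mul_assoc, mul_one, one_mul, smul_sub]
      abel
    rw [e]
    exact add_mem (Submodule.mul_mem_mul hb hy) (Submodule.mul_mem_mul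
      (B.smul_mem (h.comm_mem i b hb) c') h1)

theorem span_mul_span_le (h : IsAlmostCentral B x) (i j : Fin m) :
    Submodule.span k {1, x i} * Submodule.span k {1, x j} ≤
      Submodule.span k {1, x j} * Submodule.span k {1, x i} * Subalgebra.toSubmodule B := by
  have h1 : ∀ i, (1 : A) ∈ Submodule.span k {1, x i} := fun i => Submodule.subset_span (by simp)
  rw [Submodule.mul_le]
  intro y hy z hz
  obtain ⟨c, c', rfl⟩ := Submodule.mem_span_pair.mp hy
  obtain ⟨e, e', rfl⟩ := Submodule.mem_span_pair.mp hz
  have : (c • 1 + c' • x i) * (e • 1 + e' • x j) = (e • 1 + e' • x j) * (c • 1 + c' • x i) * 1 +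
      1 * 1 * ((c' * e') • (x i * x j - x j * x i)) := by
    simp only [mul_add, add_mul, mul_smul_comm, smul_mul_assoc, mul_one, one_mul, smul_sub,
      smul_add, smul_smul, mul_comm e, mul_comm e']
    abel
  rw [this]
  exact add_mem (Submodule.mul_mem_mul (Submodule.mul_mem_mul hz hy) B.one_mem)
    (Submodule.mul_mem_mul (Submodule.mul_mem_mul (h1 j) (h1 i))
      (B.smul_mem (h.comm_mem' i j) _))

theorem span_mul_self_le (h : IsAlmostCentral B x) (i : Fin m) :
    Submodule.span k {1, x i} * Submodule.span k {1, x i} ≤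
      Submodule.span k {1, x i} * Subalgebra.toSubmodule B := by
  have h1 : (1 : A) ∈ Submodule.span k {1, x i} := Submodule.subset_span (by simp)
  rw [Submodule.mul_le]
  intro y hy z hz
  obtain ⟨c, c', rfl⟩ := Submodule.mem_span_pair.mp hy
  obtain ⟨e, e', rfl⟩ := Submodule.mem_span_pair.mp hz
  obtain ⟨q, hq⟩ := h.sq_mem i
  have : (c • 1 + c' • x i) * (e • 1 + e' • x i) =
      ((c * e) • 1 + (c * e' + c' * e - c' * e' * q) • x i) * 1 +
      1 * ((c' * e') • (q • x i + x i * x i)) := by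
    simp only [mul_add, add_mul, mul_smul_comm, smul_mul_assoc, mul_one, one_mul]
    module
  rw [this]
  exact add_mem (Submodule.mul_mem_mul (Submodule.mem_span_pair.mpr ⟨_, _, rfl⟩) B.one_mem)
    (Submodule.mul_mem_mul h1 (B.smul_mem hq _))

theorem commute_prod (h : IsAlmostCentral B x) (l : List (Fin m)) :
    Commute (Subalgebra.toSubmodule B) (l.map fun i => Submodule.span k {1, x i}).prod := by
  refine Commute.list_prod_right _ _ fun y hy => ?_
  obtain ⟨i, -, rfl⟩ := List.mem_map.mp hy
  exact h.mul_comm_span i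

/-- The new factor moves to the right until it meets its own copy, where the relation for the square
merges the two. The errors in `B` produced on the way commute, as submodules, with the remaining
factors and are absorbed on the right. -/
theorem span_mul_prod_le (h : IsAlmostCentral B x) (l : List (Fin m)) (i : Fin m) (hi : i ∈ l) :
    Submodule.span k {1, x i} *
        ((l.map fun i => Submodule.span k {1, x i}).prod * Subalgebra.toSubmodule B) ≤
      (l.map fun i => Submodule.span k {1, x i}).prod * Subalgebra.toSubmodule B := by
  have hB : Subalgebra.toSubmodule B * Subalgebra.toSubmodule B = Subalgebra.toSubmodule B :=
    B.isIdempotentElem_toSubmodule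
  have hBl : ∀ l : List (Fin m), Subalgebra.toSubmodule B *
      ((l.map fun i => Submodule.span k {1, x i}).prod * Subalgebra.toSubmodule B) =
      (l.map fun i => Submodule.span k {1, x i}).prod * Subalgebra.toSubmodule B := fun l => by
    rw [← mul_assoc, (h.commute_prod l).eq, mul_assoc, hB]
  induction l with
  | nil => simp at hi
  | cons j l ih =>
    rw [List.map_cons, List.prod_cons, mul_assoc, ← mul_assoc]
    by_cases hij : i = j
    · subst hij
      refine (mul_le_mul_left (h.span_mul_self_le i) _).trans ?_
      rw [mul_assoc, hBl]
    · refine (mul_le_mul_left (h.span_mul_span_le i j) _).trans ?_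
      rw [mul_assoc, hBl, mul_assoc]
      exact mul_le_mul_right (ih ((List.mem_cons.mp hi).resolve_left hij)) _

/-- If `B` and the `x i` generate `A`, then the products of the `x i` in increasing order generate
`A` as a right module over `B`. -/
theorem prod_mul_eq_top (h : IsAlmostCentral B x) (hB : Algebra.adjoin k (B ∪ Set.range x) = ⊤) :
    (List.ofFn fun i => Submodule.span k {1, x i}).prod * Subalgebra.toSubmodule B = ⊤ := by
  rw [List.ofFn_eq_map]
  set V := ((List.finRange m).map fun i => Submodule.span k {1, x i}).prod *
    Subalgebra.toSubmodule B with hV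
  have hBV : Subalgebra.toSubmodule B * V = V := by
    rw [hV, ← mul_assoc, (h.commute_prod _).eq, mul_assoc, B.isIdempotentElem_toSubmodule.eq]
  have hone : (1 : A) ∈ V := by
    have : ∀ l : List (Fin m), (1 : A) ∈ (l.map fun i => Submodule.span k {1, x i}).prod := by
      intro l
      induction l with
      | nil => exact Submodule.one_le.mp le_rfl
      | cons i l ih =>
        have hi : (1 : A) ∈ Submodule.span k {1, x i} := Submodule.subset_span (by simp)
        simpa using Submodule.mul_mem_mul hi ih
    simpa using Submodule.mul_mem_mul (this (List.finRange m)) B.one_mem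
  -- The left stabiliser of `V` is a subalgebra containing `B` and every `x i`, hence it is all of
  -- `A`; since 1 lies in `V`, so does every element.
  let S : Subalgebra k A :=
    { carrier := {a | ∀ v ∈ V, a * v ∈ V}
      mul_mem' := fun {a b} ha hb v hv => by rw [mul_assoc]; exact ha _ (hb _ hv)
      add_mem' := fun {a b} ha hb v hv => by rw [add_mul]; exact add_mem (ha _ hv) (hb _ hv)
      algebraMap_mem' := fun c v hv => by
        rw [← Algebra.smul_def]; exact V.smul_mem c hv }
  have hS : S = ⊤ := by
    rw [eq_top_iff, ← hB, Algebra.adjoin_le_iff]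
    rintro a (ha | ⟨i, rfl⟩) v hv
    · rw [← hBV]; exact Submodule.mul_mem_mul ha hv
    · exact h.span_mul_prod_le _ i (List.mem_finRange i)
        (Submodule.mul_mem_mul (Submodule.subset_span (by simp)) hv)
  rw [Submodule.eq_top_iff']
  intro a
  have ha : a ∈ S := hS ▸ Algebra.mem_top
  simpa using ha 1 hone

theorem mul_prod_eq_top (h : IsAlmostCentral B x) (hB : Algebra.adjoin k (B ∪ Set.range x) = ⊤) :
    Subalgebra.toSubmodule B * (List.ofFn fun i => Submodule.span k {1, x i}).prod = ⊤ := by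
  rw [← h.prod_mul_eq_top hB, List.ofFn_eq_map, (h.commute_prod _).eq]

end IsAlmostCentral

end OrderedMonomials

/-! ### The image of the mixed Lie algebra in the associative algebra. -/

section Associative

variable {d m : ℕ} (hmd : m ≤ d) (τ : Fin d → ℕ+)

open MixedLieAlgebra

theorem toAssoc_of (n : ℕ+) (a : (freeMixedLie τ).comp n) :
    toAssoc τ ((freeMixedLie τ).of n a) =
      (weightedComp τ n).subtype ((canonicalHom τ).map n a) := by
  unfold toAssoc
  exact DirectSum.toAddMonoid_of _ n a

theorem toAssoc_lie (x y : (freeMixedLie τ).Total) :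
    toAssoc τ ⁅x, y⁆ = toAssoc τ x * toAssoc τ y - toAssoc τ y * toAssoc τ x := by
  induction x using induction_total with
  | zero => simp
  | add x x' h h' => rw [add_lie, map_add, map_add, h, h']; noncomm_ring
  | of p a =>
    induction y using induction_total with
    | zero => simp
    | add y y' h h' => rw [lie_add, map_add, map_add, h, h']; noncomm_ring
    | of q b =>
      rw [bracket_of rfl, toAssoc_of, toAssoc_of, toAssoc_of, (canonicalHom τ).map_lie]
      rfl

theorem toAssoc_totalP (x : (freeMixedLie τ).Total) (hx : x ∈ (freeMixedLie τ).plus) :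
    toAssoc τ ((freeMixedLie τ).totalP x) = (Polynomial.X : (ZMod 2)[X]) • toAssoc τ x := by
  have key : ∀ x : (freeMixedLie τ).Total, toAssoc τ ((freeMixedLie τ).totalP x) =
      (Polynomial.X : (ZMod 2)[X]) •
        toAssoc τ (x - (freeMixedLie τ).of 1 ((freeMixedLie τ).proj 1 x)) := by
    intro x
    induction x using induction_total with
    | zero => simp
    | add x y hx hy =>
      rw [map_add, map_add, map_add, map_add, add_sub_add_comm, map_add, smul_add, hx, hy]
    | of n a =>
      by_cases hn : 1 < n
      · rw [proj_of_ne hn.ne', map_zero, sub_zero, totalP_of hn rfl, toAssoc_of, toAssoc_of,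
          (canonicalHom τ).map_P]
        change (Polynomial.X : (ZMod 2)[X]) •
          (((canonicalHom τ).map n a).1 : FreeAlgebra (ZMod 2)[X] (Fin d)) +
            (if n = 1 then (((canonicalHom τ).map n a).1 : FreeAlgebra (ZMod 2)[X] (Fin d)) *
              ((canonicalHom τ).map n a).1 else 0) = _
        rw [if_neg hn.ne', add_zero]
        rfl
      · obtain rfl : n = 1 := le_antisymm (not_lt.mp hn) one_le
        rw [proj_of_same, sub_self, totalP_of_one, map_zero, smul_zero]
  rw [key x, mem_plus.mp hx, map_zero, sub_zero]

theorem toAssoc_ξ (i : Fin d) : toAssoc τ (ξ τ i) = FreeAlgebra.ι (ZMod 2)[X] i :=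
  toAssoc_of τ _ _

theorem toAssoc_Pξ (i : Fin d) (hi : τ i = 1) : toAssoc τ (Pξ τ i) =
    (Polynomial.X : (ZMod 2)[X]) • FreeAlgebra.ι (ZMod 2)[X] i +
      FreeAlgebra.ι (ZMod 2)[X] i * FreeAlgebra.ι (ZMod 2)[X] i := by
  refine (toAssoc_of τ _ _).trans ?_
  rw [(canonicalHom τ).map_P]
  refine Eq.trans (b := (Polynomial.X : (ZMod 2)[X]) • FreeAlgebra.ι (ZMod 2)[X] i +
    (if τ i = 1 then FreeAlgebra.ι (ZMod 2)[X] i * FreeAlgebra.ι (ZMod 2)[X] i else 0)) ?_ ?_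
  · rfl
  rw [if_pos hi]

variable {τ}

/-- The elements without component of degree 1 whose image lies in `B` form a Y-closed subgroup,
because `B` is closed under commutators and under `π`. -/
theorem toAssoc_mem_subalgebraB (hτ : ∀ i : Fin d, τ i = 1 ↔ (i : ℕ) < m)
    {x : (freeMixedLie τ).Total} (hx : x ∈ (freeMixedLie τ).plus) :
    toAssoc τ x ∈ subalgebraB hmd τ := by
  let S : AddSubgroup (freeMixedLie τ).Total :=
    (freeMixedLie τ).plus.toSubmodule.toAddSubgroup ⊓
      (Subalgebra.toSubmodule (subalgebraB hmd τ)).toAddSubgroup.comap (toAssoc τ)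
  have hS : IsYClosed hmd τ S := by
    refine ⟨fun x hx y hy => ⟨bracket_mem_plus x y, ?_⟩, fun x hx => ⟨totalP_mem_plus x, ?_⟩,
      fun y => ⟨yTotal_mem_plus hmd τ hτ y, Algebra.subset_adjoin ⟨y, rfl⟩⟩⟩
    · change toAssoc τ ⁅x, y⁆ ∈ subalgebraB hmd τ
      rw [toAssoc_lie]
      exact sub_mem (mul_mem hx.2 hy.2) (mul_mem hy.2 hx.2)
    · change toAssoc τ ((freeMixedLie τ).totalP x) ∈ subalgebraB hmd τ
      rw [toAssoc_totalP τ x hx.1]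
      exact (subalgebraB hmd τ).smul_mem hx.2 _
  exact (hS.plus_le hτ hx).2

/-- Any bracket in `L` has no component of degree 1, so commutators of the ξᵢ with each other and
with `Y` lie in `B`; commutation with ξᵢ is a derivation, so this extends to all of `B`. The
relation for squares is Pξᵢ = πξᵢ + ξᵢ², with scalar π. -/
theorem isAlmostCentral_subalgebraB (hτ : ∀ i : Fin d, τ i = 1 ↔ (i : ℕ) < m) :
    IsAlmostCentral (subalgebraB hmd τ)
      fun i : Fin m => FreeAlgebra.ι (ZMod 2)[X] (i.castLE hmd) where
  comm_mem i b hb := by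
    induction hb using Algebra.adjoin_induction with
    | mem x hx =>
      obtain ⟨y, rfl⟩ := hx
      rw [yAssoc, ← toAssoc_ξ τ, ← toAssoc_lie]
      exact toAssoc_mem_subalgebraB hmd hτ (bracket_mem_plus _ _)
    | algebraMap c => rw [Algebra.commutes, sub_self]; exact zero_mem _
    | add x y _ _ h h' =>
      have := add_mem h h'
      rwa [sub_add_sub_comm, ← mul_add, ← add_mul] at this
    | mul x y hx hy h h' =>
      have := add_mem (mul_mem h hy) (mul_mem hx h')
      rwa [sub_mul, mul_sub, mul_assoc, mul_assoc x, sub_add_sub_cancel, ← mul_assoc x] at this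
  comm_mem' i j := by
    rw [← toAssoc_ξ τ, ← toAssoc_ξ τ, ← toAssoc_lie]
    exact toAssoc_mem_subalgebraB hmd hτ (bracket_mem_plus _ _)
  sq_mem i := by
    refine ⟨Polynomial.X, ?_⟩
    rw [← toAssoc_Pξ τ _ ((hτ _).mpr i.2)]
    exact Algebra.subset_adjoin ⟨.sq i, rfl⟩

theorem adjoin_subalgebraB_union :
    Algebra.adjoin (ZMod 2)[X] ((subalgebraB hmd τ : Set (FreeAlgebra (ZMod 2)[X] (Fin d))) ∪
      Set.range fun i : Fin m => FreeAlgebra.ι (ZMod 2)[X] (i.castLE hmd)) = ⊤ := by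
  rw [eq_top_iff, ← FreeAlgebra.adjoin_range_ι, Algebra.adjoin_le_iff]
  rintro _ ⟨i, rfl⟩
  apply Algebra.subset_adjoin
  by_cases hi : (i : ℕ) < m
  · exact Or.inr ⟨⟨i, hi⟩, rfl⟩
  · left
    rw [← toAssoc_ξ τ]
    exact Algebra.subset_adjoin ⟨.gen i (not_lt.mp hi), rfl⟩


/-- The map `(c e)ₑ ↦ ∑ ξ ^ e * c e`, where the `c e` are polynomials in the elements of `Y`. -/
noncomputable def monomialMulLift :
    ((Fin m → Fin 2) → FreeAlgebra (ZMod 2)[X] (YIndex d m)) →ₗ[(ZMod 2)[X]]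
      FreeAlgebra (ZMod 2)[X] (Fin d) :=
  ∑ e, LinearMap.mulLeft (ZMod 2)[X] (monomialXi hmd e) ∘ₗ
    (FreeAlgebra.lift (ZMod 2)[X] (yAssoc hmd τ)).toLinearMap ∘ₗ LinearMap.proj e

/-- The map `(c e)ₑ ↦ ∑ c e * ξ ^ e`, where the `c e` are polynomials in the elements of `Y`. -/
noncomputable def liftMulMonomial :
    ((Fin m → Fin 2) → FreeAlgebra (ZMod 2)[X] (YIndex d m)) →ₗ[(ZMod 2)[X]]
      FreeAlgebra (ZMod 2)[X] (Fin d) :=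
  ∑ e, LinearMap.mulRight (ZMod 2)[X] (monomialXi hmd e) ∘ₗ
    (FreeAlgebra.lift (ZMod 2)[X] (yAssoc hmd τ)).toLinearMap ∘ₗ LinearMap.proj e

theorem monomialMulLift_apply (c) : monomialMulLift hmd (τ := τ) c =
    ∑ e, monomialXi hmd e * FreeAlgebra.lift (ZMod 2)[X] (yAssoc hmd τ) (c e) := by
  simp [monomialMulLift]

theorem liftMulMonomial_apply (c) : liftMulMonomial hmd (τ := τ) c =
    ∑ e, FreeAlgebra.lift (ZMod 2)[X] (yAssoc hmd τ) (c e) * monomialXi hmd e := by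
  simp [liftMulMonomial]

theorem monomialMulLift_single (e : Fin m → Fin 2) (t : FreeAlgebra (ZMod 2)[X] (YIndex d m)) :
    monomialMulLift hmd (τ := τ) (Pi.single e t) =
      monomialXi hmd e * FreeAlgebra.lift (ZMod 2)[X] (yAssoc hmd τ) t := by
  rw [monomialMulLift_apply, Finset.sum_eq_single e]
  · rw [Pi.single_eq_same]
  · intro e' _ h
    rw [Pi.single_eq_of_ne h, map_zero, mul_zero]
  · simp

theorem liftMulMonomial_single (e : Fin m → Fin 2) (t : FreeAlgebra (ZMod 2)[X] (YIndex d m)) :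
    liftMulMonomial hmd (τ := τ) (Pi.single e t) =
      FreeAlgebra.lift (ZMod 2)[X] (yAssoc hmd τ) t * monomialXi hmd e := by
  rw [liftMulMonomial_apply, Finset.sum_eq_single e]
  · rw [Pi.single_eq_same]
  · intro e' _ h
    rw [Pi.single_eq_of_ne h, map_zero, zero_mul]
  · simp

theorem range_lift_yAssoc :
    (FreeAlgebra.lift (ZMod 2)[X] (yAssoc hmd τ)).range = subalgebraB hmd τ :=
  (Algebra.adjoin_range_eq_range_freeAlgebra_lift _ _ _).symm

theorem monomialMulLift_surjective (hτ : ∀ i : Fin d, τ i = 1 ↔ (i : ℕ) < m) :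
    Function.Surjective (monomialMulLift hmd (τ := τ)) := by
  rw [← LinearMap.range_eq_top, eq_top_iff,
    ← (isAlmostCentral_subalgebraB hmd hτ).prod_mul_eq_top (adjoin_subalgebraB_union hmd),
    Submodule.mul_le]
  intro a ha b hb
  obtain ⟨t, rfl⟩ := (range_lift_yAssoc hmd (τ := τ)).ge hb
  replace ha := Submodule.prod_span_pair_le _ ha
  induction ha using Submodule.span_induction with
  | mem x hx =>
    obtain ⟨e, rfl⟩ := hx
    exact ⟨Pi.single e t, monomialMulLift_single hmd e t⟩
  | zero => rw [zero_mul]; exact zero_mem _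
  | add x y _ _ hx hy => rw [add_mul]; exact add_mem hx hy
  | smul c x _ hx => rw [smul_mul_assoc]; exact Submodule.smul_mem _ c hx

theorem liftMulMonomial_surjective (hτ : ∀ i : Fin d, τ i = 1 ↔ (i : ℕ) < m) :
    Function.Surjective (liftMulMonomial hmd (τ := τ)) := by
  rw [← LinearMap.range_eq_top, eq_top_iff,
    ← (isAlmostCentral_subalgebraB hmd hτ).mul_prod_eq_top (adjoin_subalgebraB_union hmd),
    Submodule.mul_le]
  intro b hb a ha
  obtain ⟨t, rfl⟩ := (range_lift_yAssoc hmd (τ := τ)).ge hb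
  replace ha := Submodule.prod_span_pair_le _ ha
  induction ha using Submodule.span_induction with
  | mem x hx =>
    obtain ⟨e, rfl⟩ := hx
    exact ⟨Pi.single e t, liftMulMonomial_single hmd e t⟩
  | zero => rw [mul_zero]; exact zero_mem _
  | add x y _ _ hx hy => rw [mul_add]; exact add_mem hx hy
  | smul c x _ hx => rw [mul_smul_comm]; exact Submodule.smul_mem _ c hx

end Associative

/-! ### Surjective maps between weighted spaces of equal dimensions. -/

section GradedInjectivity

open Module

variable {F I J M N : Type*} [Field F] [AddCommGroup M] [Module F M] [AddCommGroup N] [Module F N]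

/-- The projection to the span of the basis vectors of weight `n`. -/
noncomputable def Module.Basis.weightProj (b : Basis I F M) (w : I → ℕ) (n : ℕ) : M →ₗ[F] M :=
  b.constr F fun i => if w i = n then b i else 0

theorem Module.Basis.weightProj_basis (b : Basis I F M) (w : I → ℕ) (n : ℕ) (i : I) :
    b.weightProj w n (b i) = if w i = n then b i else 0 :=
  b.constr_basis F _ i

theorem Module.Basis.weightProj_mem (b : Basis I F M) (w : I → ℕ) (n : ℕ) (x : M) :
    b.weightProj w n x ∈ Submodule.span F (Set.range fun i : {i // w i = n} => b i) := by
  rw [weightProj, Basis.constr_apply]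
  refine Submodule.sum_mem _ fun i _ => Submodule.smul_mem _ _ ?_
  split_ifs with h
  · exact Submodule.subset_span ⟨⟨i, h⟩, rfl⟩
  · exact zero_mem _

theorem Module.Basis.weightProj_of_mem (b : Basis I F M) (w : I → ℕ) (n n' : ℕ) {x : M}
    (hx : x ∈ Submodule.span F (Set.range fun i : {i // w i = n} => b i)) :
    b.weightProj w n' x = if n = n' then x else 0 := by
  induction hx using Submodule.span_induction with
  | mem x hx =>
    obtain ⟨⟨i, rfl⟩, rfl⟩ := hx
    exact b.weightProj_basis w n' i
  | zero => rw [map_zero, ite_self]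
  | add x y _ _ hx hy => rw [map_add, hx, hy]; split_ifs <;> simp
  | smul c x _ hx => rw [map_smul, hx]; split_ifs <;> simp

theorem Module.Basis.eq_zero_of_weightProj (b : Basis I F M) (w : I → ℕ) {x : M}
    (hx : ∀ n, b.weightProj w n x = 0) : x = 0 := by
  rw [b.ext_elem_iff]
  intro i
  have key : ∀ y : M, b.repr (b.weightProj w (w i) y) i = b.repr y i := by
    intro y
    have : (Finsupp.lapply i ∘ₗ b.repr.toLinearMap) ∘ₗ b.weightProj w (w i) =
        Finsupp.lapply i ∘ₗ b.repr.toLinearMap := by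
      refine b.ext fun j => ?_
      simp only [LinearMap.comp_apply, weightProj_basis]
      split_ifs with h
      · rfl
      · have hji : j ≠ i := fun e => h (e ▸ rfl)
        simp [Finsupp.single_eq_of_ne hji.symm]
    exact LinearMap.congr_fun this y
  rw [← key, hx]

/-- A surjective linear map preserving weights between spaces with equally many basis vectors of
each weight is injective. -/
theorem LinearMap.injective_of_surjective_of_weight (b : Basis I F M) (c : Basis J F N)
    (w : I → ℕ) (v : J → ℕ) (hw : ∀ n, Finite {i // w i = n}) (hv : ∀ n, Finite {j // v j = n})
    (hcard : ∀ n, Nat.card {i // w i = n} = Nat.card {j // v j = n}) (Φ : M →ₗ[F] N)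
    (hsurj : Function.Surjective Φ)
    (hΦ : ∀ i, Φ (b i) ∈ Submodule.span F (Set.range fun j : {j // v j = w i} => c j)) :
    Function.Injective Φ := by
  -- Commuting with the weight projections lets both surjectivity and injectivity be tested one
  -- weight at a time, where all dimensions are finite.
  have hcomm : ∀ n x, c.weightProj v n (Φ x) = Φ (b.weightProj w n x) := by
    intro n x
    have : c.weightProj v n ∘ₗ Φ = Φ ∘ₗ b.weightProj w n := by
      refine b.ext fun i => ?_
      rw [LinearMap.comp_apply, LinearMap.comp_apply, c.weightProj_of_mem v _ n (hΦ i),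
        b.weightProj_basis]
      split_ifs <;> simp
    exact LinearMap.congr_fun this x
  have hmaps : ∀ n, ∀ x ∈ Submodule.span F (Set.range fun i : {i // w i = n} => b i),
      Φ x ∈ Submodule.span F (Set.range fun j : {j // v j = n} => c j) := by
    intro n x hx
    have h := b.weightProj_of_mem w n n hx
    rw [if_pos rfl] at h
    rw [← h, ← hcomm]
    exact c.weightProj_mem v n _
  have hinj : ∀ n, Function.Injective (Φ.restrict (hmaps n)) := by
    intro n
    have := Fintype.ofFinite {i // w i = n}
    have := Fintype.ofFinite {j // v j = n}
    have : FiniteDimensional F (Submodule.span F (Set.range fun i : {i // w i = n} => b i)) :=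
      FiniteDimensional.span_of_finite F (Set.finite_range _)
    have : FiniteDimensional F (Submodule.span F (Set.range fun j : {j // v j = n} => c j)) :=
      FiniteDimensional.span_of_finite F (Set.finite_range _)
    rw [LinearMap.injective_iff_surjective_of_finrank_eq_finrank]
    · rintro ⟨y, hy⟩
      obtain ⟨x, rfl⟩ := hsurj y
      refine ⟨⟨b.weightProj w n x, b.weightProj_mem w n x⟩, Subtype.ext ?_⟩
      have h := c.weightProj_of_mem v n n hy
      rw [if_pos rfl, hcomm] at h
      exact h
    · refine (finrank_span_eq_card (b.linearIndependent.comp _ Subtype.val_injective)).trans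
        (Eq.trans ?_ (finrank_span_eq_card
          (c.linearIndependent.comp _ Subtype.val_injective)).symm)
      rw [← Nat.card_eq_fintype_card, ← Nat.card_eq_fintype_card, hcard]
  rw [injective_iff_map_eq_zero]
  intro x hx
  refine b.eq_zero_of_weightProj w fun n => ?_
  have h0 : Φ (b.weightProj w n x) = 0 := by rw [← hcomm, hx, map_zero]
  have := @hinj n ⟨_, b.weightProj_mem w n x⟩ 0 (Subtype.ext (by simpa using h0))
  exact congrArg Subtype.val this

end GradedInjectivity

/-! ### Homogeneity and weights of the elements of `Y`. -/

section Homogeneity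

theorem FreeAlgebra.basisFreeMonoid_apply (R : Type u) (X : Type v) [CommSemiring R]
    (l : FreeMonoid X) :
    FreeAlgebra.basisFreeMonoid R X l = (l.toList.map (FreeAlgebra.ι R)).prod := by
  rw [← FreeMonoid.lift_apply]
  unfold FreeAlgebra.basisFreeMonoid
  rw [Module.Basis.map_apply, Finsupp.coe_basisSingleOne]
  exact (MonoidAlgebra.lift_single (R := R) _ l 1).trans (one_smul _ _)

variable {d m : ℕ} (hmd : m ≤ d) (τ : Fin d → ℕ+)

open MixedLieAlgebra

theorem lie_mem_range_of {𝔤 : MixedLieAlgebra.{u}} {n n' k : ℕ} {x y : 𝔤.Total} (h : n + n' = k)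
    (hx : ∃ p : ℕ+, (p : ℕ) = n ∧ ∃ u, x = 𝔤.of p u)
    (hy : ∃ p : ℕ+, (p : ℕ) = n' ∧ ∃ u, y = 𝔤.of p u) :
    ∃ p : ℕ+, (p : ℕ) = k ∧ ∃ u, ⁅x, y⁆ = 𝔤.of p u := by
  obtain ⟨p, rfl, u, rfl⟩ := hx
  obtain ⟨q, rfl, v, rfl⟩ := hy
  exact ⟨p + q, h, _, bracket_of rfl u v⟩

theorem ξ_mem_range_of (i : Fin d) {n : ℕ} (h : τ i = n) :
    ∃ p : ℕ+, (p : ℕ) = n ∧ ∃ u, ξ τ i = (freeMixedLie τ).of p u :=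
  ⟨τ i, h, _, rfl⟩

variable {τ} in
theorem iterAd_mem_range_of (hτ : ∀ i : Fin d, τ i = 1 ↔ (i : ℕ) < m) (l : List (Fin m)) {n k : ℕ}
    {x : (freeMixedLie τ).Total} (h : l.length + n = k)
    (hx : ∃ p : ℕ+, (p : ℕ) = n ∧ ∃ u, x = (freeMixedLie τ).of p u) :
    ∃ p : ℕ+, (p : ℕ) = k ∧ ∃ u, iterAd hmd τ l x = (freeMixedLie τ).of p u := by
  induction l generalizing k with
  | nil =>
    obtain rfl : n = k := by simpa using h
    exact hx
  | cons i l ih =>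
    rw [List.length_cons] at h
    exact lie_mem_range_of (n := 1) (n' := l.length + n) (by omega)
      (ξ_mem_range_of τ _ (by rw [(hτ _).mpr i.2]; rfl)) (ih rfl)

variable {τ} in
theorem yTotal_mem_range_of (hτ : ∀ i : Fin d, τ i = 1 ↔ (i : ℕ) < m) (y : YIndex d m) :
    ∃ n : ℕ+, (n : ℕ) = yWeight τ y ∧
      ∃ u : (freeMixedLie τ).comp n, yTotal hmd τ y = (freeMixedLie τ).of n u := by
  have h1 : ∀ i : Fin m, ((τ (i.castLE hmd) : ℕ+) : ℕ) = 1 := fun i => by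
    rw [(hτ _).mpr i.2]; rfl
  cases y with
  | sq i => exact ⟨τ (i.castLE hmd) + 1, by rw [PNat.add_coe, h1]; rfl, _, rfl⟩
  | br i j h =>
    exact lie_mem_range_of rfl (ξ_mem_range_of τ _ (h1 i)) (ξ_mem_range_of τ _ (h1 j))
  | gen j h => exact ξ_mem_range_of τ _ rfl
  | brMixed i j h => exact lie_mem_range_of rfl (ξ_mem_range_of τ _ (h1 i)) (ξ_mem_range_of τ _ rfl)
  | adSq k s =>
    exact iterAd_mem_range_of hmd hτ _ s.length_eq (lie_mem_range_of rfl (ξ_mem_range_of τ _ (h1 _))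
      (lie_mem_range_of rfl (ξ_mem_range_of τ _ (h1 _)) (ξ_mem_range_of τ _ (h1 _))))
  | ad k s =>
    exact iterAd_mem_range_of hmd hτ _ s.length_eq (lie_mem_range_of rfl (ξ_mem_range_of τ _ (h1 _))
      (ξ_mem_range_of τ _ (h1 _)))
  | adMixed k s =>
    refine iterAd_mem_range_of hmd hτ _ ?_ (ξ_mem_range_of τ _ rfl)
    change _ = k - 1 + _
    have := s.length_eq
    omega

variable {τ} in
theorem yAssoc_mem_weightedComp (hτ : ∀ i : Fin d, τ i = 1 ↔ (i : ℕ) < m) (y : YIndex d m) :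
    yAssoc hmd τ y ∈ weightedComp τ (yWeight τ y) := by
  obtain ⟨n, hn, u, hu⟩ := yTotal_mem_range_of hmd hτ y
  rw [yAssoc, hu, ← hn, toAssoc_of]
  exact ((canonicalHom τ).map n u).2

theorem list_prod_mem_weightedComp {α : Type*} (l : List α) (w : α → ℕ)
    (f : α → FreeAlgebra (ZMod 2)[X] (Fin d)) (h : ∀ a ∈ l, f a ∈ weightedComp τ (w a)) :
    (l.map f).prod ∈ weightedComp τ (l.map w).sum :=
  SetLike.list_prod_map_mem_graded l w f h

variable {τ} in
theorem monomialXi_mem_weightedComp (hτ : ∀ i : Fin d, τ i = 1 ↔ (i : ℕ) < m) (e : Fin m → Fin 2) :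
    monomialXi hmd e ∈ weightedComp τ (∑ i, (e i : ℕ)) := by
  rw [monomialXi, List.ofFn_eq_map, ← List.sum_ofFn, List.ofFn_eq_map]
  refine list_prod_mem_weightedComp τ _ _ _ fun i _ => ?_
  have := SetLike.pow_mem_graded (A := weightedComp τ) (e i : ℕ)
    (ι_mem_weightedComp τ (i.castLE hmd))
  rwa [(hτ _).mpr i.2, PNat.one_coe, smul_eq_mul, mul_one] at this

theorem X_pow_smul_mem_weightedComp (a : ℕ) {n : ℕ} {x : FreeAlgebra (ZMod 2)[X] (Fin d)}
    (hx : x ∈ weightedComp τ n) : (Polynomial.X : (ZMod 2)[X]) ^ a • x ∈ weightedComp τ (a + n) := by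
  induction a with
  | zero => simpa using hx
  | succ a ih =>
    rw [pow_succ', mul_smul, add_right_comm]
    exact X_smul_mem_weightedComp τ _ _ ih

end Homogeneity

/-! ### Bases of words over 𝔽₂ and their weights. -/

section Comparison

open Module

variable {d m : ℕ} (hmd : m ≤ d) (τ : Fin d → ℕ+)

/-- The weight of `π ^ a • ξ_{i₁} ⋯ ξ_{iₖ}`. -/
def wordWeight {ι : Type*} (w : ι → ℕ) (x : ℕ × FreeMonoid ι) : ℕ := x.1 + (x.2.toList.map w).sum

/-- The basis of `A(X)` over `𝔽₂` consisting of the `π ^ a • ξ_{i₁} ⋯ ξ_{iₖ}`. -/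
noncomputable def wordBasis (ι : Type*) :
    Basis (ℕ × FreeMonoid ι) (ZMod 2) (FreeAlgebra (ZMod 2)[X] ι) :=
  (Polynomial.basisMonomials (ZMod 2)).smulTower (FreeAlgebra.basisFreeMonoid (ZMod 2)[X] ι)

theorem wordBasis_apply (ι : Type*) (x : ℕ × FreeMonoid ι) : wordBasis ι x =
    (Polynomial.X : (ZMod 2)[X]) ^ x.1 • (x.2.toList.map (FreeAlgebra.ι (ZMod 2)[X])).prod := by
  rw [wordBasis, Basis.smulTower_apply, FreeAlgebra.basisFreeMonoid_apply,
    Polynomial.coe_basisMonomials, Polynomial.X_pow_eq_monomial]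

theorem weightedComp_le_span (n : ℕ) : weightedComp τ n ≤ Submodule.span (ZMod 2)
    (Set.range fun j : {j // wordWeight (fun i => (τ i : ℕ)) j = n} => wordBasis (Fin d) j) := by
  refine Submodule.span_mono ?_
  rintro _ ⟨a, l, h, rfl⟩
  exact ⟨⟨(a, FreeMonoid.ofList l), h⟩, wordBasis_apply _ _⟩

/-- The weight of the family concentrated in `e` with value `π ^ a • y₁ ⋯ yₖ`, `yᵢ ∈ Y`. -/
def familyWeight (x : ℕ × (Σ _ : Fin m → Fin 2, FreeMonoid (YIndex d m))) : ℕ :=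
  x.1 + (∑ i, (x.2.1 i : ℕ) + (x.2.2.toList.map (yWeight τ)).sum)

/-- The basis of `T ^ {0,1}ᵐ` over `𝔽₂`, `T` the free associative algebra on `Y`. -/
noncomputable def familyBasis (d m : ℕ) :
    Basis (ℕ × (Σ _ : Fin m → Fin 2, FreeMonoid (YIndex d m))) (ZMod 2)
      ((Fin m → Fin 2) → FreeAlgebra (ZMod 2)[X] (YIndex d m)) :=
  (Polynomial.basisMonomials (ZMod 2)).smulTower
    (Pi.basis fun _ => FreeAlgebra.basisFreeMonoid (ZMod 2)[X] (YIndex d m))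

theorem familyBasis_apply (x : ℕ × (Σ _ : Fin m → Fin 2, FreeMonoid (YIndex d m))) :
    familyBasis d m x = (Polynomial.X : (ZMod 2)[X]) ^ x.1 •
      Pi.single x.2.1 (x.2.2.toList.map (FreeAlgebra.ι (ZMod 2)[X])).prod := by
  obtain ⟨a, e, l⟩ := x
  rw [familyBasis, Basis.smulTower_apply, Pi.basis_apply, FreeAlgebra.basisFreeMonoid_apply,
    Polynomial.coe_basisMonomials, Polynomial.X_pow_eq_monomial]

variable {τ}

/-- Both multiplication maps send a basis vector of `familyBasis` to a homogeneous element of the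
same weight and are already surjective, so equality of the counts in each weight is all that is
needed. -/
theorem injective_of_familyWeight (hτ : ∀ i : Fin d, τ i = 1 ↔ (i : ℕ) < m)
    (hfin : ∀ n, Finite {x // wordWeight (fun i => (τ i : ℕ)) x = n})
    (hfin' : ∀ n, Finite {x // familyWeight (m := m) τ x = n})
    (hcard : ∀ n, Nat.card {x // familyWeight (m := m) τ x = n} =
      Nat.card {x // wordWeight (fun i => (τ i : ℕ)) x = n}) :
    Function.Injective (monomialMulLift hmd (τ := τ)) ∧
      Function.Injective (liftMulMonomial hmd (τ := τ)) := by
  have hlift : ∀ l : List (YIndex d m), FreeAlgebra.lift (ZMod 2)[X] (yAssoc hmd τ)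
      (l.map (FreeAlgebra.ι (ZMod 2)[X])).prod ∈ weightedComp τ (l.map (yWeight τ)).sum := by
    intro l
    rw [map_list_prod, List.map_map]
    refine list_prod_mem_weightedComp τ _ _ _ fun y _ => ?_
    rw [Function.comp_apply, FreeAlgebra.lift_ι_apply]
    exact yAssoc_mem_weightedComp hmd hτ y
  constructor
  · refine LinearMap.injective_of_surjective_of_weight (familyBasis d m) (wordBasis (Fin d))
      (familyWeight τ) _ hfin' hfin hcard ((monomialMulLift hmd (τ := τ)).restrictScalars (ZMod 2))
      (monomialMulLift_surjective hmd hτ) fun x => weightedComp_le_span τ _ ?_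
    rw [familyBasis_apply, LinearMap.restrictScalars_apply, map_smul, monomialMulLift_single]
    exact X_pow_smul_mem_weightedComp τ _
      (SetLike.mul_mem_graded (monomialXi_mem_weightedComp hmd hτ _) (hlift _))
  · refine LinearMap.injective_of_surjective_of_weight (familyBasis d m) (wordBasis (Fin d))
      (familyWeight τ) _ hfin' hfin hcard ((liftMulMonomial hmd (τ := τ)).restrictScalars (ZMod 2))
      (liftMulMonomial_surjective hmd hτ) fun x => weightedComp_le_span τ _ ?_
    rw [familyBasis_apply, LinearMap.restrictScalars_apply, map_smul, liftMulMonomial_single,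
      familyWeight, add_comm (∑ i, _)]
    exact X_pow_smul_mem_weightedComp τ _
      (SetLike.mul_mem_graded (hlift _) (monomialXi_mem_weightedComp hmd hτ _))

end Comparison

/-! ### Generating series of weighted sets. -/

section WeightSeries

variable {α : Type u} {β : Type v}

/-- There are finitely many elements of each weight. -/
def FiniteFibers (w : α → ℕ) : Prop := ∀ n, Finite {a // w a = n}

/-- The generating series of the number of elements of weight `n`. -/
noncomputable def weightSeries (w : α → ℕ) : PowerSeries ℤ :=
  PowerSeries.mk fun n => (Nat.card {a // w a = n} : ℤ)

theorem coeff_weightSeries (w : α → ℕ) (n : ℕ) :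
    PowerSeries.coeff n (weightSeries w) = (Nat.card {a // w a = n} : ℤ) :=
  PowerSeries.coeff_mk _ _

theorem FiniteFibers.of_finite [Finite α] (w : α → ℕ) : FiniteFibers w := fun _ => inferInstance

theorem finiteFibers_congr {w : α → ℕ} {v : β → ℕ} (e : α ≃ β) (h : ∀ a, v (e a) = w a)
    (hw : FiniteFibers w) : FiniteFibers v := fun n =>
  have := hw n
  Finite.of_equiv _ (e.subtypeEquiv (p := fun a => w a = n) (q := fun b => v b = n)
    fun a => by rw [h])

theorem weightSeries_congr {w : α → ℕ} {v : β → ℕ} (e : α ≃ β) (h : ∀ a, v (e a) = w a) :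
    weightSeries w = weightSeries v := by
  ext n
  rw [coeff_weightSeries, coeff_weightSeries,
    Nat.card_congr (e.subtypeEquiv (p := fun a => w a = n) (q := fun b => v b = n)
      fun a => by rw [h])]

theorem weightSeries_sum {w : α → ℕ} {v : β → ℕ} (hw : FiniteFibers w) (hv : FiniteFibers v) :
    weightSeries (Sum.elim w v) = weightSeries w + weightSeries v := by
  ext n
  have := hw n
  have := hv n
  let e : {a // Sum.elim w v a = n} ≃ {a // w a = n} ⊕ {b // v b = n} := Equiv.subtypeSum
  rw [map_add, coeff_weightSeries, coeff_weightSeries, coeff_weightSeries, Nat.card_congr e,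
    Nat.card_sum, Nat.cast_add]

/-- Pairs of weights adding up to `n`. -/
def addFiberEquiv (w : α → ℕ) (v : β → ℕ) (n : ℕ) : {x : α × β // w x.1 + v x.2 = n} ≃
    Σ p : Finset.HasAntidiagonal.antidiagonal n, {a // w a = p.1.1} × {b // v b = p.1.2} where
  toFun x := ⟨⟨(w x.1.1, v x.1.2), Finset.HasAntidiagonal.mem_antidiagonal.mpr x.2⟩,
    ⟨x.1.1, rfl⟩, ⟨x.1.2, rfl⟩⟩
  invFun y := ⟨(y.2.1.1, y.2.2.1), by
    rw [y.2.1.2, y.2.2.2]; exact Finset.HasAntidiagonal.mem_antidiagonal.mp y.1.2⟩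
  left_inv _ := rfl
  right_inv := by
    rintro ⟨⟨⟨p, q⟩, h⟩, ⟨a, ha⟩, ⟨b, hb⟩⟩
    change w a = p at ha
    change v b = q at hb
    subst ha hb
    rfl

theorem FiniteFibers.prod {w : α → ℕ} {v : β → ℕ} (hw : FiniteFibers w) (hv : FiniteFibers v) :
    FiniteFibers fun x : α × β => w x.1 + v x.2 := fun n => by
  have := hw
  have := hv
  unfold FiniteFibers at *
  exact Finite.of_equiv _ (addFiberEquiv w v n).symm

theorem weightSeries_prod {w : α → ℕ} {v : β → ℕ} (hw : FiniteFibers w) (hv : FiniteFibers v) :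
    weightSeries (fun x : α × β => w x.1 + v x.2) = weightSeries w * weightSeries v := by
  ext n
  have := hw
  have := hv
  unfold FiniteFibers at *
  rw [coeff_weightSeries, PowerSeries.coeff_mul, Nat.card_congr (addFiberEquiv w v n),
    Nat.card_sigma, Nat.cast_sum,
    ← Finset.sum_coe_sort (Finset.HasAntidiagonal.antidiagonal n) fun p =>
      PowerSeries.coeff p.1 (weightSeries w) * PowerSeries.coeff p.2 (weightSeries v)]
  refine Finset.sum_congr rfl fun p _ => ?_
  rw [coeff_weightSeries, coeff_weightSeries, Nat.card_prod, Nat.cast_mul]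

/-- The weight of a word. -/
def listWeight (w : α → ℕ) (l : List α) : ℕ := (l.map w).sum

/-- Positivity of the weights makes the tail of a nonempty word strictly lighter, so strong
induction applies. -/
theorem FiniteFibers.list {w : α → ℕ} (hw : FiniteFibers w) (hpos : ∀ a, 0 < w a) :
    FiniteFibers (listWeight w) := by
  intro n
  induction n using Nat.strong_induction_on with
  | _ n ih =>
    have hfin : ({[]} ∪ ⋃ p ∈ {p : ℕ × ℕ | p.1 ≤ n ∧ p.2 < n},
        Set.image2 List.cons {a | w a = p.1} {l | listWeight w l = p.2}).Finite := by
      refine (Set.finite_singleton _).union (Set.Finite.biUnion ?_ ?_)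
      · exact ((Set.finite_le_nat n).prod (Set.finite_lt_nat n)).subset fun p hp => hp
      · intro p hp
        exact Set.Finite.image2 _ (hw p.1) (ih p.2 hp.2)
    refine Set.Finite.subset hfin ?_
    rintro (_ | ⟨a, l⟩) hl
    · exact Or.inl rfl
    · have e : w a + listWeight w l = n := by
        change listWeight w (a :: l) = n at hl
        simpa [listWeight] using hl
      have := hpos a
      refine Or.inr (Set.mem_biUnion (x := (w a, listWeight w l)) ⟨?_, ?_⟩ ⟨a, rfl, l, rfl, rfl⟩)
      · dsimp only; omega
      · dsimp only; omega

/-- A list is empty or has a head and a tail. -/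
def listEquivSum (α : Type u) : List α ≃ Unit ⊕ α × List α where
  toFun
    | [] => Sum.inl ()
    | a :: l => Sum.inr (a, l)
  invFun
    | Sum.inl _ => []
    | Sum.inr x => x.1 :: x.2
  left_inv := by rintro (_ | ⟨a, l⟩) <;> rfl
  right_inv := by rintro (_ | ⟨a, l⟩) <;> rfl

theorem weightSeries_const [Finite α] (c : ℕ) : weightSeries (fun _ : α => c) =
    (Nat.card α : PowerSeries ℤ) * PowerSeries.X ^ c := by
  ext n
  rw [coeff_weightSeries, ← map_natCast (PowerSeries.C (R := ℤ)), PowerSeries.coeff_C_mul_X_pow]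
  split_ifs with h
  · subst h
    rw [Nat.card_congr (Equiv.subtypeUnivEquiv fun _ => rfl)]
  · have : IsEmpty {_a : α // c = n} := ⟨fun a => h a.2.symm⟩
    rw [Nat.card_of_isEmpty, Nat.cast_zero]

/-- The geometric series: a word is empty or a letter followed by a word, so W = 1 + wW. -/
theorem weightSeries_list {w : α → ℕ} (hw : FiniteFibers w) (hpos : ∀ a, 0 < w a) :
    (1 - weightSeries w) * weightSeries (listWeight w) = 1 := by
  have hl := hw.list hpos
  have : weightSeries (listWeight w) = 1 + weightSeries w * weightSeries (listWeight w) := by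
    conv_lhs => rw [weightSeries_congr (listEquivSum α)
      (v := Sum.elim (fun _ : Unit => 0) fun x => w x.1 + listWeight w x.2)
      (by rintro (_ | ⟨a, l⟩) <;> simp [listEquivSum, listWeight]),
      weightSeries_sum (FiniteFibers.of_finite _) (hw.prod hl), weightSeries_prod hw hl,
      weightSeries_const]
    simp
  linear_combination this

theorem weightSeries_sigma (β : ℕ → Type v) : weightSeries (fun x : Σ n, β n => x.1) =
    PowerSeries.mk fun n => (Nat.card (β n) : ℤ) := by
  ext n
  rw [coeff_weightSeries, PowerSeries.coeff_mk, Nat.card_congr (Equiv.sigmaSubtype n)]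

end WeightSeries

/-! ### Cardinalities of the index families. -/

section Cardinalities

variable {m : ℕ}

theorem card_decreasing (m r : ℕ) :
    Nat.card {l : List (Fin m) // l.Pairwise (· > ·) ∧ l.length = r} = m.choose r := by
  have hnd : ∀ {l : List (Fin m)}, l.Pairwise (· > ·) → l.Nodup := fun h => h.imp fun h => h.ne'
  have hb : Function.Bijective (fun l : {l : List (Fin m) // l.Pairwise (· > ·) ∧ l.length = r} =>
      (⟨l.1.toFinset, by rw [List.toFinset_card_of_nodup (hnd l.2.1), l.2.2]⟩ :
        {s : Finset (Fin m) // s.card = r})) := by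
    constructor
    · rintro ⟨l, hl, hr⟩ ⟨l', hl', hr'⟩ h
      have h := congrArg Subtype.val h
      have hp : l.Perm l' := (List.perm_ext_iff_of_nodup (hnd hl) (hnd hl')).mpr fun a => by
        rw [← List.mem_toFinset, ← List.mem_toFinset (l := l')]
        exact iff_of_eq (congrArg (a ∈ ·) h)
      exact Subtype.ext (hp.eq_of_pairwise (fun a b _ _ h h' => absurd h' h.asymm) hl hl')
    · rintro ⟨s, hs⟩
      refine ⟨⟨s.sort (· ≥ ·), ?_, by rw [Finset.length_sort, hs]⟩, Subtype.ext (by simp)⟩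
      exact ((s.pairwise_sort (· ≥ ·)).and (s.sort_nodup (· ≥ ·))).imp
        fun h => lt_of_le_of_ne h.1 h.2.symm
  rw [Nat.card_eq_of_bijective _ hb, Nat.card_eq_fintype_card, Fintype.card_finset_len,
    Fintype.card_fin]

theorem card_notMem {l : List (Fin m)} (hl : l.Nodup) :
    Nat.card {j // j ∉ l} = m - l.length := by
  rw [Nat.card_eq_fintype_card, Fintype.card_subtype_compl fun j => j ∈ l, Fintype.card_fin,
    ← List.toFinset_card_of_nodup hl]
  congr 1
  rw [Fintype.card_subtype]
  congr 1
  ext j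
  simp

theorem card_decreasing_notMem (m r : ℕ) :
    Nat.card {x : List (Fin m) × Fin m // x.1.Pairwise (· > ·) ∧ x.1.length = r ∧ x.2 ∉ x.1} =
      m.choose r * (m - r) := by
  let e : {x : List (Fin m) × Fin m // x.1.Pairwise (· > ·) ∧ x.1.length = r ∧ x.2 ∉ x.1} ≃
      Σ l : {l : List (Fin m) // l.Pairwise (· > ·) ∧ l.length = r}, {j // j ∉ l.1} :=
    { toFun := fun x => ⟨⟨x.1.1, x.2.1, x.2.2.1⟩, ⟨x.1.2, x.2.2.2⟩⟩
      invFun := fun y => ⟨(y.1.1, y.2.1), y.1.2.1, y.1.2.2, y.2.2⟩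
      left_inv := fun _ => rfl
      right_inv := fun _ => rfl }
  have : Finite {l : List (Fin m) // l.Pairwise (· > ·) ∧ l.length = r} :=
    Set.Finite.subset (List.finite_length_eq (Fin m) r) fun l hl => hl.2
  have := Fintype.ofFinite {l : List (Fin m) // l.Pairwise (· > ·) ∧ l.length = r}
  rw [Nat.card_congr e, Nat.card_sigma, Finset.sum_congr rfl fun l _ => show _ = m - r by
    rw [card_notMem (l.2.1.imp fun h => h.ne'), l.2.2], Finset.sum_const, smul_eq_mul,
    Finset.card_univ, ← Nat.card_eq_fintype_card, card_decreasing]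

instance (m k : ℕ) : Finite {l : List (Fin m) // l.Pairwise (· > ·) ∧ l.length = k} :=
  Set.Finite.subset (List.finite_length_eq (Fin m) k) fun _ hl => hl.2

instance (m k : ℕ) : Finite
    {x : List (Fin m) × Fin m // x.1.Pairwise (· > ·) ∧ x.1.length = k ∧ x.2 ∉ x.1} :=
  Set.Finite.subset ((List.finite_length_eq (Fin m) k).prod Set.finite_univ)
    fun _ hl => ⟨hl.2.1, trivial⟩

theorem adSqIndex_bijective (m r : ℕ) : Function.Bijective (fun s : AdSqIndex m (r + 3) =>
    (⟨(s.init ++ [s.last], s.j), s.decreasing, by have := s.length_eq; simp; omega, s.notMem⟩ :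
      {x : List (Fin m) × Fin m // x.1.Pairwise (· > ·) ∧ x.1.length = r + 1 ∧ x.2 ∉ x.1})) := by
  constructor
  · rintro s s' h
    have h := congrArg Subtype.val h
    obtain ⟨h1, h2⟩ := Prod.mk.inj h
    obtain ⟨h3, h4⟩ := List.append_inj' h1 rfl
    exact AdSqIndex.ext h3 (by simpa using h4) h2
  · rintro ⟨⟨l, j⟩, hl, hr, hj⟩
    rcases List.eq_nil_or_concat' l with rfl | ⟨l, a, rfl⟩
    · simp at hr
    · exact ⟨⟨l, a, j, by simp at hr; omega, by simpa using hl, by simpa using hj⟩, by simp⟩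

/-- A decreasing list of length k − 2 and a letter outside it give C(m, k−2)(m−k+2) = (k−1) C(m,
k−1) choices. -/
theorem card_adSqIndex (m k : ℕ) (hk : 3 ≤ k) :
    Nat.card (AdSqIndex m k) = (k - 1) * m.choose (k - 1) := by
  obtain ⟨r, rfl⟩ := Nat.exists_eq_add_of_le' hk
  rw [Nat.card_eq_of_bijective _ (adSqIndex_bijective m r), card_decreasing_notMem,
    show r + 3 - 1 = r + 1 + 1 from rfl, ← Nat.choose_succ_right_eq, mul_comm]

/-- A decreasing list followed by another element is decreasing, or the last two elements are
increasing. -/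
def adIndexSumMap (m r : ℕ) :
    AdIndex m (r + 3) ⊕ {l : List (Fin m) // l.Pairwise (· > ·) ∧ l.length = r + 3} →
      {x : List (Fin m) × Fin m // x.1.Pairwise (· > ·) ∧ x.1.length = r + 2 ∧ x.2 ∉ x.1}
  | .inl s => ⟨(s.init ++ [s.a], s.b), s.decreasing, by have := s.length_eq; simp; omega, by
      have := s.notMem
      have := s.lt.ne'
      simp_all⟩
  | .inr l => ⟨(l.1.dropLast, l.1.getLast (List.ne_nil_of_length_eq_add_one l.2.2)), by
      have h := l.2.1
      rw [← List.dropLast_append_getLast (List.ne_nil_of_length_eq_add_one l.2.2),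
        List.pairwise_append] at h
      exact ⟨h.1, by have := l.2.2; simp; omega, fun hm => (h.2.2 _ hm _ (by simp)).ne rfl⟩⟩

theorem adIndexSumMap_bijective (m r : ℕ) : Function.Bijective (adIndexSumMap m r) := by
  constructor
  · have key : ∀ (s : AdIndex m (r + 3))
        (l : {l : List (Fin m) // l.Pairwise (· > ·) ∧ l.length = r + 3}),
        adIndexSumMap m r (.inl s) ≠ adIndexSumMap m r (.inr l) := by
      intro s l h
      have h1 : s.init ++ [s.a] = l.1.dropLast := congrArg (fun x => x.1.1) h
      have h2 : s.b = l.1.getLast _ := congrArg (fun x => x.1.2) h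
      have h := l.2.1
      rw [← List.dropLast_append_getLast (List.ne_nil_of_length_eq_add_one l.2.2), ← h1, ← h2,
        List.pairwise_append] at h
      exact lt_asymm s.lt (h.2.2 s.a (by simp) s.b (by simp))
    rintro (s | l) (s' | l') h
    · obtain ⟨h1, h2⟩ := Prod.mk.inj (congrArg Subtype.val h)
      obtain ⟨h3, h4⟩ := List.append_inj' h1 rfl
      exact congrArg _ (AdIndex.ext h3 (by simpa using h4) h2)
    · exact absurd h (key s l')
    · exact absurd h.symm (key s' l)
    · have h1 : l.1.dropLast = l'.1.dropLast := congrArg (fun x => x.1.1) h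
      have h2 : l.1.getLast _ = l'.1.getLast _ := congrArg (fun x => x.1.2) h
      refine congrArg _ (Subtype.ext ?_)
      rw [← List.dropLast_append_getLast (List.ne_nil_of_length_eq_add_one l.2.2), h1, h2,
        List.dropLast_append_getLast]
  · rintro ⟨⟨l, b⟩, hl, hr, hb⟩
    rcases List.eq_nil_or_concat' l with rfl | ⟨l, a, rfl⟩
    · simp at hr
    · by_cases hab : a < b
      · exact ⟨.inl ⟨l, a, b, by omega, by simp at hr; omega, hl, hab, by simp_all⟩, rfl⟩
      · have hba : b < a := lt_of_le_of_ne (not_lt.mp hab) (by rintro rfl; simp at hb)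
        refine ⟨.inr ⟨l ++ [a] ++ [b], ?_, by simp at hr ⊢; omega⟩, Subtype.ext ?_⟩
        · rw [List.pairwise_append]
          refine ⟨hl, by simp, fun x hx y hy => ?_⟩
          obtain rfl := List.mem_singleton.mp hy
          rcases List.mem_append.mp hx with hx | hx
          · exact hba.trans ((List.pairwise_append.mp hl).2.2 x hx a (by simp))
          · exact (List.mem_singleton.mp hx) ▸ hba
        · exact Prod.ext (by simp [adIndexSumMap]) (by simp [adIndexSumMap])

instance (m k : ℕ) : Finite (AdIndex m k) := by
  by_cases hk : 3 ≤ k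
  · obtain ⟨r, rfl⟩ := Nat.exists_eq_add_of_le' hk
    exact Finite.of_injective _ ((adIndexSumMap_bijective m r).1.comp Sum.inl_injective)
  · have : IsEmpty (AdIndex m k) := ⟨fun s => hk s.three_le⟩
    infer_instance

/-- Pairs of a decreasing list of length k − 1 and a letter outside it number C(m, k−1)(m−k+1) = k
C(m, k). Those whose last letter is smaller than the end of the list form the C(m, k) decreasing
lists of length k, which leaves (k−1) C(m, k). -/
theorem card_adIndex (m k : ℕ) (hk : 3 ≤ k) : Nat.card (AdIndex m k) = (k - 1) * m.choose k := by
  obtain ⟨r, rfl⟩ := Nat.exists_eq_add_of_le' hk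
  have h := Nat.card_eq_of_bijective _ (adIndexSumMap_bijective m r)
  rw [Nat.card_sum, card_decreasing, card_decreasing_notMem, ← Nat.choose_succ_right_eq] at h
  rw [show r + 3 - 1 = r + 2 from rfl]
  simp only [Nat.add_assoc, Nat.reduceAdd] at h ⊢
  linarith

theorem card_le_val (d m : ℕ) : Nat.card {j : Fin d // m ≤ (j : ℕ)} = d - m := by
  have h : Nat.card {j : Fin d // ¬ (j : ℕ) < m} = d - m := by
    rw [Nat.card_eq_fintype_card, Fintype.card_subtype_compl, Fintype.card_fin,
      Fintype.card_subtype, Fin.card_filter_val_lt]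
    omega
  simpa only [not_lt] using h

theorem card_lt (m : ℕ) : Nat.card {p : Fin m × Fin m // p.1 < p.2} = m.choose 2 := by
  rw [← card_decreasing]
  refine Nat.card_eq_of_bijective (fun p => ⟨[p.1.2, p.1.1], by simpa using p.2, rfl⟩) ⟨?_, ?_⟩
  · rintro ⟨⟨a, b⟩, _⟩ ⟨⟨a', b'⟩, _⟩ h
    simp at h
    simp [h]
  · rintro ⟨l, hl, hr⟩
    obtain ⟨a, b, rfl⟩ := List.length_eq_two.mp hr
    exact ⟨⟨(b, a), by simpa using hl⟩, rfl⟩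

theorem card_adMixedIndex (d m k : ℕ) (hk : 3 ≤ k) :
    Nat.card (AdMixedIndex d m k) = m.choose (k - 1) * (d - m) := by
  let e : AdMixedIndex d m k ≃ {l : List (Fin m) // l.Pairwise (· > ·) ∧ l.length = k - 1} ×
      {j : Fin d // m ≤ (j : ℕ)} :=
    { toFun := fun s => (⟨s.init, s.decreasing, by have := s.length_eq; omega⟩, ⟨s.last, s.le⟩)
      invFun := fun x => ⟨x.1.1, x.2.1, hk, by have := x.1.2.2; omega, x.1.2.1, x.2.2⟩
      left_inv := fun _ => rfl
      right_inv := fun _ => rfl }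
  rw [Nat.card_congr e, Nat.card_prod, card_decreasing, card_le_val]

theorem card_sum_eq (m n : ℕ) :
    Nat.card {e : Fin m → Fin 2 // ∑ i, (e i : ℕ) = n} = m.choose n := by
  have hsum : ∀ e : Fin m → Fin 2, (Finset.univ.filter fun i => e i = 1).card =
      ∑ i, (e i : ℕ) := by
    intro e
    rw [Finset.card_filter]
    refine Finset.sum_congr rfl fun i _ => ?_
    generalize e i = x
    fin_cases x <;> rfl
  have hb : Function.Bijective (fun e : {e : Fin m → Fin 2 // ∑ i, (e i : ℕ) = n} =>
      (⟨Finset.univ.filter fun i => e.1 i = 1, by rw [hsum, e.2]⟩ :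
        {s : Finset (Fin m) // s.card = n})) := by
    constructor
    · rintro ⟨e, he⟩ ⟨e', he'⟩ h
      refine Subtype.ext (funext fun i => ?_)
      have h := congrArg (i ∈ ·) (congrArg Subtype.val h)
      simp only [Finset.mem_filter, Finset.mem_univ, true_and, eq_iff_iff] at h
      change e i = e' i
      generalize e i = x at *
      generalize e' i = y at *
      fin_cases x <;> fin_cases y <;> simp_all
    · rintro ⟨s, hs⟩
      have : (Finset.univ.filter fun i => (if i ∈ s then (1 : Fin 2) else 0) = 1) = s := by
        ext i; simp
      exact ⟨⟨fun i => if i ∈ s then 1 else 0, by rw [← hsum, this, hs]⟩, Subtype.ext this⟩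
  rw [Nat.card_eq_of_bijective _ hb, Nat.card_eq_fintype_card, Fintype.card_finset_len,
    Fintype.card_fin]

end Cardinalities

/-! ### The generating series of `Y` and the dimension count. -/

section YSeries

variable {d m : ℕ} (τ : Fin d → ℕ+)

/-- Strictly decreasing lists of indices of generators of weight `1`. -/
abbrev DecreasingList (m : ℕ) : Type := {l : List (Fin m) // l.Pairwise (· > ·)}

instance (m : ℕ) : Finite (DecreasingList m) :=
  Set.Finite.subset (List.finite_length_le (Fin m) m) fun l (hl : l.Pairwise _) => by
    have : l.Nodup := hl.imp fun h => h.ne'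
    simpa using this.length_le_card

/-- The generators of weight `> 1`. -/
abbrev HeavyGen (d m : ℕ) : Type := {j : Fin d // m ≤ (j : ℕ)}

/-- The index set `Y`, where the elements involving a generator of weight `> 1` are put together. -/
def yIndexEquiv (d m : ℕ) : YIndex d m ≃
    ((Fin m ⊕ {p : Fin m × Fin m // p.1 < p.2}) ⊕
      ((Σ k, AdSqIndex m k) ⊕ (Σ k, AdIndex m k))) ⊕ DecreasingList m × HeavyGen d m where
  toFun
    | .sq i => .inl (.inl (.inl i))
    | .br i j h => .inl (.inl (.inr ⟨(i, j), h⟩))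
    | .adSq k s => .inl (.inr (.inl ⟨k, s⟩))
    | .ad k s => .inl (.inr (.inr ⟨k, s⟩))
    | .gen j h => .inr (⟨[], List.Pairwise.nil⟩, ⟨j, h⟩)
    | .brMixed i j h => .inr (⟨[i], List.pairwise_singleton _ _⟩, ⟨j, h⟩)
    | .adMixed _ s => .inr (⟨s.init, s.decreasing⟩, ⟨s.last, s.le⟩)
  invFun
    | .inl (.inl (.inl i)) => .sq i
    | .inl (.inl (.inr p)) => .br p.1.1 p.1.2 p.2
    | .inl (.inr (.inl s)) => .adSq s.1 s.2
    | .inl (.inr (.inr s)) => .ad s.1 s.2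
    | .inr (⟨[], _⟩, j) => .gen j.1 j.2
    | .inr (⟨[i], _⟩, j) => .brMixed i j.1 j.2
    -- The list has length `l.length + 2`, and k counts in addition the innermost letter j.
    | .inr (⟨i :: i' :: l, h⟩, j) =>
      .adMixed (l.length + 3) ⟨i :: i' :: l, j.1, by omega, rfl, h, j.2⟩
  left_inv := by
    rintro (_ | _ | _ | _ | _ | _ | ⟨k, ⟨_ | ⟨_, _ | ⟨_, l⟩⟩, _, hk, h, _, _⟩⟩)
    · rfl
    · rfl
    · rfl
    · rfl
    · rfl
    · rfl
    · simp at h; omega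
    · simp at h; omega
    · subst h; rfl
  right_inv := by
    rintro ((((_ | _) | (_ | _))) | ⟨⟨_ | ⟨_, _ | ⟨_, l⟩⟩, _⟩, _⟩) <;> rfl

theorem yWeight_yIndexEquiv (y : YIndex d m) :
    Sum.elim (Sum.elim (Sum.elim (fun _ => 2) fun _ => 2) (Sum.elim (fun s => s.1) fun s => s.1))
      (fun x => x.1.1.length + (τ x.2.1 : ℕ)) (yIndexEquiv d m y) = yWeight τ y := by
  cases y with
  | gen j h => exact zero_add _
  | adMixed k s =>
    have := s.length_eq
    change s.init.length + (τ s.last : ℕ) = k - 1 + (τ s.last : ℕ)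
    omega
  | _ => rfl

theorem yWeight_pos (y : YIndex d m) : 0 < yWeight τ y := by
  cases y with
  | gen j h => exact (τ j).pos
  | adSq k s => have := s.length_eq; change 0 < k; omega
  | ad k s => have := s.three_le; change 0 < k; omega
  | brMixed i j h => change 0 < 1 + _; omega
  | adMixed k s => exact Nat.add_pos_right _ (τ s.last).pos
  | _ => exact Nat.two_pos

instance (m : ℕ) : Finite (Σ k, AdSqIndex m k) := by
  refine Finite.of_injective (β := DecreasingList m × Fin m)
    (fun x => (⟨x.2.init ++ [x.2.last], x.2.decreasing⟩, x.2.j)) ?_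
  rintro ⟨k, s⟩ ⟨k', s'⟩ h
  obtain ⟨h1, h2⟩ := Prod.mk.inj h
  obtain ⟨h3, h4⟩ := List.append_inj' (congrArg Subtype.val h1) rfl
  obtain rfl : k = k' := by rw [← s.length_eq, ← s'.length_eq, h3]
  exact congrArg _ (AdSqIndex.ext h3 (by simpa using h4) h2)

instance (m : ℕ) : Finite (Σ k, AdIndex m k) := by
  refine Finite.of_injective (β := DecreasingList m × Fin m)
    (fun x => (⟨x.2.init ++ [x.2.a], x.2.decreasing⟩, x.2.b)) ?_
  rintro ⟨k, s⟩ ⟨k', s'⟩ h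
  obtain ⟨h1, h2⟩ := Prod.mk.inj h
  obtain ⟨h3, h4⟩ := List.append_inj' (congrArg Subtype.val h1) rfl
  obtain rfl : k = k' := by rw [← s.length_eq, ← s'.length_eq, h3]
  exact congrArg _ (AdIndex.ext h3 (by simpa using h4) h2)

instance : Finite (YIndex d m) := Finite.of_equiv _ (yIndexEquiv d m).symm

theorem card_adSqIndex_of_lt (m : ℕ) {k : ℕ} (hk : k < 3) : Nat.card (AdSqIndex m k) = 0 :=
  have : IsEmpty (AdSqIndex m k) := ⟨fun s => by have := s.length_eq; omega⟩
  Nat.card_of_isEmpty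

theorem card_adIndex_of_lt (m : ℕ) {k : ℕ} (hk : k < 3) : Nat.card (AdIndex m k) = 0 :=
  have : IsEmpty (AdIndex m k) := ⟨fun s => by have := s.three_le; omega⟩
  Nat.card_of_isEmpty

/-- The identity is taken in ℤ so that it holds beyond k = m, where the binomial coefficients vanish
but m − k is negative. -/
theorem cast_choose_succ_mul (m k : ℕ) :
    (m.choose (k + 1) : ℤ) * (k + 1) = m.choose k * (m - k) := by
  rcases le_or_gt k m with h | h
  · rw [← Nat.cast_sub h]
    exact_mod_cast Nat.choose_succ_right_eq m k
  · rw [Nat.choose_eq_zero_of_lt h, Nat.choose_eq_zero_of_lt (by omega)]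
    simp

theorem weightSeries_decreasing (m : ℕ) : weightSeries (fun l : DecreasingList m => l.1.length) =
    PowerSeries.mk fun n => (m.choose n : ℤ) := by
  ext n
  rw [coeff_weightSeries, PowerSeries.coeff_mk, ← card_decreasing]
  exact congrArg _ (Nat.card_congr (Equiv.subtypeSubtypeEquivSubtypeInter _
    fun l : List (Fin m) => l.length = n))

theorem weightSeries_exponents (m : ℕ) :
    weightSeries (fun e : Fin m → Fin 2 => ∑ i, (e i : ℕ)) =
      weightSeries (fun l : DecreasingList m => l.1.length) := by
  rw [weightSeries_decreasing]
  ext n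
  rw [coeff_weightSeries, PowerSeries.coeff_mk, card_sum_eq]

variable {τ}

theorem weightSeries_generators (hmd : m ≤ d) (hτ : ∀ i : Fin d, τ i = 1 ↔ (i : ℕ) < m) :
    weightSeries (fun i => (τ i : ℕ)) =
      (m : PowerSeries ℤ) * PowerSeries.X + weightSeries fun j : HeavyGen d m => (τ j.1 : ℕ) := by
  let e : Fin d ≃ Fin m ⊕ HeavyGen d m :=
    (Equiv.sumCompl fun i : Fin d => (i : ℕ) < m).symm.trans (Equiv.sumCongr
      { toFun := fun i => ⟨i.1, i.2⟩
        invFun := fun i => ⟨i.castLE hmd, i.2⟩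
        left_inv := fun _ => rfl
        right_inv := fun _ => rfl } (Equiv.subtypeEquivRight fun i => not_lt))
  rw [weightSeries_congr e.symm.symm
      (v := Sum.elim (fun _ => 1) fun j : HeavyGen d m => (τ j.1 : ℕ)),
    weightSeries_sum (FiniteFibers.of_finite _) (FiniteFibers.of_finite _), weightSeries_const,
    Nat.card_eq_fintype_card, Fintype.card_fin, pow_one]
  intro i
  obtain ⟨x, rfl⟩ := e.symm.surjective i
  rw [Equiv.symm_symm, Equiv.apply_symm_apply]
  rcases x with i | j
  · change 1 = (τ (i.castLE hmd) : ℕ)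
    rw [(hτ _).mpr i.2]; rfl
  · rfl

/-- The first factor is (1+t)^m. The generators of weight > 1 contribute (1+t)^m times their own
series to `Y`, which cancels, so only the generators of weight 1 remain to be compared. -/
theorem weightSeries_yWeight (hmd : m ≤ d) (hτ : ∀ i : Fin d, τ i = 1 ↔ (i : ℕ) < m) :
    weightSeries (fun l : DecreasingList m => l.1.length) * (1 - weightSeries fun i => (τ i : ℕ)) =
      1 - weightSeries (yWeight (m := m) τ) := by
  have hfin : ∀ {α : Type} [Finite α] (w : α → ℕ), FiniteFibers w := FiniteFibers.of_finite
  have hY : weightSeries (yWeight (m := m) τ) =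
      ((m : PowerSeries ℤ) * PowerSeries.X ^ 2 + (m.choose 2 : PowerSeries ℤ) * PowerSeries.X ^ 2 +
        ((PowerSeries.mk fun n => (Nat.card (AdSqIndex m n) : ℤ)) +
          PowerSeries.mk fun n => (Nat.card (AdIndex m n) : ℤ))) +
      weightSeries (fun l : DecreasingList m => l.1.length) *
        weightSeries fun j : HeavyGen d m => (τ j.1 : ℕ) := by
    rw [weightSeries_congr (yIndexEquiv d m) (yWeight_yIndexEquiv τ),
      weightSeries_sum (hfin _) (hfin _), weightSeries_sum (hfin _) (hfin _),
      weightSeries_sum (hfin _) (hfin _), weightSeries_sum (hfin _) (hfin _),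
      weightSeries_const, weightSeries_const, weightSeries_sigma, weightSeries_sigma, card_lt,
      Nat.card_eq_fintype_card, Fintype.card_fin,
      weightSeries_prod (w := fun l : DecreasingList m => l.1.length)
        (v := fun j : HeavyGen d m => (τ j.1 : ℕ)) (hfin _) (hfin _)]
  -- In degree n ≥ 3 the claim is C(m,n) − m C(m,n−1) = −(n−1)(C(m,n−1) + C(m,n)), a rearrangement
  -- of n C(m,n) = (m−n+1) C(m,n−1). Degrees below 3 are separate because the families of long
  -- brackets start at 3.
  have key : (PowerSeries.mk fun n => (m.choose n : ℤ)) * (1 - (m : PowerSeries ℤ) * PowerSeries.X) =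
      1 - ((m : PowerSeries ℤ) * PowerSeries.X ^ 2 + (m.choose 2 : PowerSeries ℤ) * PowerSeries.X ^ 2 +
        ((PowerSeries.mk fun n => (Nat.card (AdSqIndex m n) : ℤ)) +
          PowerSeries.mk fun n => (Nat.card (AdIndex m n) : ℤ))) := by
    rw [mul_sub, mul_one, mul_left_comm, ← map_natCast (PowerSeries.C (R := ℤ)),
      ← map_natCast (PowerSeries.C (R := ℤ))]
    ext n
    have hc := cast_choose_succ_mul m
    simp only [map_sub, map_add, PowerSeries.coeff_mk,
      PowerSeries.coeff_C_mul]
    rcases n with _ | _ | _ | n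
    · simp [card_adSqIndex_of_lt, card_adIndex_of_lt]
    · simp [card_adSqIndex_of_lt, card_adIndex_of_lt, PowerSeries.coeff_succ_mul_X,
        PowerSeries.coeff_one]
    · have := hc 1
      simp [card_adSqIndex_of_lt, card_adIndex_of_lt, PowerSeries.coeff_succ_mul_X,
        PowerSeries.coeff_one] at this ⊢
      linarith
    · have := hc (n + 2)
      rw [card_adSqIndex _ _ (by omega), card_adIndex _ _ (by omega), PowerSeries.coeff_succ_mul_X]
      simp [PowerSeries.coeff_one] at this ⊢
      linarith
  rw [hY, weightSeries_generators hmd hτ]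
  rw [← weightSeries_decreasing] at key
  linear_combination key

/-- With X and Y the series of the two generating sets, `weightSeries_yWeight` says that
(1+t)^m/(1−Y) = 1/(1−X). Both sides carry the further factor 1/(1−t) for the powers of `π`. -/
theorem weightSeries_family (hmd : m ≤ d) (hτ : ∀ i : Fin d, τ i = 1 ↔ (i : ℕ) < m) :
    weightSeries (familyWeight (m := m) τ) = weightSeries (wordWeight fun i => (τ i : ℕ)) := by
  have hN : FiniteFibers (id : ℕ → ℕ) := fun n => Set.finite_singleton n
  have hX := FiniteFibers.of_finite fun i => (τ i : ℕ)
  have hY := FiniteFibers.of_finite (yWeight (m := m) τ)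
  have h1 := weightSeries_list hX fun i => (τ i).pos
  have h2 := weightSeries_list hY (yWeight_pos τ)
  have h3 := weightSeries_yWeight hmd hτ
  have hXl := hX.list fun i => (τ i).pos
  have hYl := hY.list (yWeight_pos τ)
  have hE := FiniteFibers.of_finite fun e : Fin m → Fin 2 => ∑ i, (e i : ℕ)
  have e1 : weightSeries (wordWeight fun i => (τ i : ℕ)) =
      weightSeries (id : ℕ → ℕ) * weightSeries (listWeight fun i => (τ i : ℕ)) :=
    weightSeries_prod hN hXl
  have e2 : weightSeries (familyWeight (m := m) τ) = weightSeries (id : ℕ → ℕ) *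
      (weightSeries (fun e : Fin m → Fin 2 => ∑ i, (e i : ℕ)) *
        weightSeries (listWeight (yWeight (m := m) τ))) := by
    rw [← weightSeries_prod hE hYl, ← weightSeries_prod hN (hE.prod hYl)]
    exact weightSeries_congr (Equiv.prodCongr (Equiv.refl _) (Equiv.sigmaEquivProd _ _))
      fun _ => rfl
  rw [e1, e2, weightSeries_exponents]
  set D := weightSeries (fun l : DecreasingList m => l.1.length)
  set WX := weightSeries (listWeight fun i => (τ i : ℕ))
  set WY := weightSeries (listWeight (yWeight (m := m) τ))
  linear_combination weightSeries (id : ℕ → ℕ) * (-D * WY * h1 + WX * h2 + WX * WY * h3)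

theorem finiteFibers_wordWeight : FiniteFibers (wordWeight fun i => (τ i : ℕ)) :=
  FiniteFibers.prod (w := (id : ℕ → ℕ)) (fun n => Set.finite_singleton n)
    ((FiniteFibers.of_finite fun i => (τ i : ℕ)).list fun i => (τ i).pos)

theorem finiteFibers_familyWeight : FiniteFibers (familyWeight (m := m) τ) :=
  finiteFibers_congr (Equiv.prodCongr (Equiv.refl _) (Equiv.sigmaEquivProd _ _).symm)
    (fun _ => rfl)
    (FiniteFibers.prod (w := (id : ℕ → ℕ)) (fun n => Set.finite_singleton n)
      ((FiniteFibers.of_finite fun e : Fin m → Fin 2 => ∑ i, (e i : ℕ)).prod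
        ((FiniteFibers.of_finite (yWeight (m := m) τ)).list (yWeight_pos τ))))

theorem injective_monomialMul (hmd : m ≤ d) (hτ : ∀ i : Fin d, τ i = 1 ↔ (i : ℕ) < m) :
    Function.Injective (monomialMulLift hmd (τ := τ)) ∧
      Function.Injective (liftMulMonomial hmd (τ := τ)) := by
  refine injective_of_familyWeight hmd hτ finiteFibers_wordWeight finiteFibers_familyWeight
    fun n => ?_
  have := congrArg (PowerSeries.coeff n) (weightSeries_family hmd hτ)
  rw [coeff_weightSeries, coeff_weightSeries] at this
  exact_mod_cast this

end YSeries

/-! ### Freeness of the Lie algebra on `Y`. -/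

section FreeLie

variable {d m : ℕ} (hmd : m ≤ d) {τ : Fin d → ℕ+} (hτ : ∀ i : Fin d, τ i = 1 ↔ (i : ℕ) < m)

open MixedLieAlgebra

theorem lift_yAssoc_injective (hτ : ∀ i : Fin d, τ i = 1 ↔ (i : ℕ) < m) :
    Function.Injective (FreeAlgebra.lift (ZMod 2)[X] (yAssoc hmd τ)) := by
  -- The monomial with all exponents zero is 1, so the lift is the restriction of the injective map
  -- `monomialMulLift` to one summand.
  have h1 : monomialXi hmd (0 : Fin m → Fin 2) = 1 := by simp [monomialXi]
  intro s t h
  refine Pi.single_injective (M := fun _ => FreeAlgebra (ZMod 2)[X] (YIndex d m)) 0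
    ((injective_monomialMul hmd hτ).1 ?_)
  rw [monomialMulLift_single, monomialMulLift_single, h1, one_mul, one_mul, h]

theorem toAssoc_incl_smul (f : (ZMod 2)[X]) (x : (freeMixedLie τ).Plus) :
    toAssoc τ ((freeMixedLie τ).incl (f • x)) = f • toAssoc τ ((freeMixedLie τ).incl x) := by
  have hX : ∀ y : (freeMixedLie τ).Plus, toAssoc τ ((freeMixedLie τ).totalP
      ((freeMixedLie τ).incl y)) =
        (Polynomial.X : (ZMod 2)[X]) • toAssoc τ ((freeMixedLie τ).incl y) :=
    fun y => toAssoc_totalP τ y.1 y.2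
  induction f using Polynomial.induction_on with
  | C a =>
    fin_cases a
    · change toAssoc τ (incl _ (Polynomial.C (0 : ZMod 2) • x)) = Polynomial.C (0 : ZMod 2) • _
      rw [map_zero, zero_smul, zero_smul, map_zero, map_zero]
    · change toAssoc τ (incl _ (Polynomial.C (1 : ZMod 2) • x)) = Polynomial.C (1 : ZMod 2) • _
      rw [map_one, one_smul, one_smul]
  | add f g hf hg => rw [add_smul, map_add, map_add, hf, hg, add_smul]
  | monomial n a h =>
    rw [pow_succ', mul_left_comm, mul_smul, X_smul_val, hX, h, smul_smul]

attribute [local instance] LieRing.ofAssociativeRing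

/-- The canonical map `L⁺(X) → A(X)`. -/
noncomputable def plusToAssoc (τ : Fin d → ℕ+) :
    (freeMixedLie τ).Plus →ₗ⁅(ZMod 2)[X]⁆ FreeAlgebra (ZMod 2)[X] (Fin d) where
  toFun x := toAssoc τ ((freeMixedLie τ).incl x)
  map_add' x y := by rw [map_add, map_add]
  map_smul' := toAssoc_incl_smul
  map_lie' {x y} := by
    rw [LieHom.map_lie, toAssoc_lie, LieRing.of_associative_ring_bracket]

theorem plusToAssoc_lift (x : FreeLieAlgebra (ZMod 2)[X] (YIndex d m)) :
    plusToAssoc τ (FreeLieAlgebra.lift (ZMod 2)[X] (yPlus hmd τ hτ) x) =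
      FreeAlgebra.lift (ZMod 2)[X] (yAssoc hmd τ)
        (FreeLieAlgebra.lift (ZMod 2)[X] (FreeAlgebra.ι (ZMod 2)[X]) x) := by
  have : (plusToAssoc τ).comp (FreeLieAlgebra.lift (ZMod 2)[X] (yPlus hmd τ hτ)) =
      (FreeAlgebra.lift (ZMod 2)[X] (yAssoc hmd τ)).toLieHom.comp
        (FreeLieAlgebra.lift (ZMod 2)[X] (FreeAlgebra.ι (ZMod 2)[X])) := by
    refine FreeLieAlgebra.hom_ext fun y => ?_
    rw [LieHom.comp_apply, LieHom.comp_apply, FreeLieAlgebra.lift_of_apply,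
      FreeLieAlgebra.lift_of_apply]
    exact (FreeAlgebra.lift_ι_apply (R := (ZMod 2)[X]) (yAssoc hmd τ) y).symm
  exact LieHom.congr_fun this x

/-- By `plusToAssoc_lift`, composing with the map to `A` gives the embedding of the free Lie algebra
into the free associative algebra on `Y` followed by another injection. No injectivity of `L⁺` → `A`
is needed beforehand. -/
theorem lift_yPlus_injective :
    Function.Injective (FreeLieAlgebra.lift (ZMod 2)[X] (yPlus hmd τ hτ)) := by
  intro x y h
  apply FreeLieAlgebra.lift_ι_injective (ZMod 2) (ZMod 2)[X] (YIndex d m)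
  apply lift_yAssoc_injective hmd hτ
  rw [← plusToAssoc_lift hmd hτ, ← plusToAssoc_lift hmd hτ, h]

/-- Needed to count the families as sets of elements rather than of indices. -/
theorem yPlus_injective : Function.Injective (yPlus hmd τ hτ) := by
  intro y y' h
  rw [← FreeLieAlgebra.lift_of_apply (R := (ZMod 2)[X]) (yPlus hmd τ hτ) y,
    ← FreeLieAlgebra.lift_of_apply (R := (ZMod 2)[X]) (yPlus hmd τ hτ) y'] at h
  have h := congrArg (FreeLieAlgebra.lift (ZMod 2)[X] (FreeAlgebra.ι (ZMod 2)[X]))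
    (lift_yPlus_injective hmd hτ h)
  rw [FreeLieAlgebra.lift_of_apply, FreeLieAlgebra.lift_of_apply] at h
  exact FreeAlgebra.ι_injective h

/-- The image, viewed inside `L`, is a Y-closed subgroup, so it contains `L⁺` by generation. -/
theorem lift_yPlus_surjective :
    Function.Surjective (FreeLieAlgebra.lift (ZMod 2)[X] (yPlus hmd τ hτ)) := by
  set Λ := FreeLieAlgebra.lift (ZMod 2)[X] (yPlus hmd τ hτ)
  let S : AddSubgroup (freeMixedLie τ).Total :=
    Λ.range.toSubmodule.toAddSubgroup.map
      (AddMonoidHomClass.toAddMonoidHom ((freeMixedLie τ).incl : _ →ₗ[ZMod 2] _))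
  have hS : IsYClosed hmd τ S := by
    have hmem : ∀ z, (freeMixedLie τ).incl (Λ z) ∈ S := fun z => ⟨_, ⟨z, rfl⟩, rfl⟩
    refine ⟨?_, ?_, fun y => ?_⟩
    · rintro _ ⟨_, ⟨x, rfl⟩, rfl⟩ _ ⟨_, ⟨y, rfl⟩, rfl⟩
      have := hmem ⁅x, y⁆
      rwa [LieHom.map_lie, LieHom.map_lie] at this
    · rintro _ ⟨_, ⟨x, rfl⟩, rfl⟩
      have := hmem ((Polynomial.X : (ZMod 2)[X]) • x)
      rwa [map_smul, X_smul_val] at this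
    · have := hmem (FreeLieAlgebra.of _ y)
      rwa [FreeLieAlgebra.lift_of_apply] at this
  intro x
  obtain ⟨_, ⟨z, rfl⟩, hz⟩ := hS.plus_le hτ x.2
  exact ⟨z, Subtype.ext hz⟩

end FreeLie

/-! ### Freeness of `B`, of `A` over `B`, and the final assembly. -/

section FreeModule

variable {d m : ℕ} (hmd : m ≤ d) {τ : Fin d → ℕ+} (hτ : ∀ i : Fin d, τ i = 1 ↔ (i : ℕ) < m)

theorem val_lift_yB (t : FreeAlgebra (ZMod 2)[X] (YIndex d m)) :
    (FreeAlgebra.lift (ZMod 2)[X] (yB hmd τ) t : FreeAlgebra (ZMod 2)[X] (Fin d)) =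
      FreeAlgebra.lift (ZMod 2)[X] (yAssoc hmd τ) t := by
  have : (subalgebraB hmd τ).val.comp (FreeAlgebra.lift (ZMod 2)[X] (yB hmd τ)) =
      FreeAlgebra.lift (ZMod 2)[X] (yAssoc hmd τ) := by
    ext y
    simp [yB]
  exact DFunLike.congr_fun this t

theorem lift_yB_bijective (hτ : ∀ i : Fin d, τ i = 1 ↔ (i : ℕ) < m) :
    Function.Bijective (FreeAlgebra.lift (ZMod 2)[X] (yB hmd τ)) := by
  constructor
  · intro s t h
    apply lift_yAssoc_injective hmd hτ
    rw [← val_lift_yB, ← val_lift_yB, h]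
  · rintro ⟨b, hb⟩
    obtain ⟨t, rfl⟩ := (range_lift_yAssoc hmd (τ := τ)).ge hb
    exact ⟨t, Subtype.ext (val_lift_yB hmd t)⟩

end FreeModule

theorem theorem2p3 (d m : ℕ) (hmd : m ≤ d) (τ : Fin d → ℕ+)
    (hτ : ∀ i : Fin d, τ i = 1 ↔ (i : ℕ) < m) :
    -- `L⁺(X)` is a free Lie algebra over `𝔽₂[π]` with basis `Y`
    Function.Bijective (FreeLieAlgebra.lift (ZMod 2)[X] (yPlus hmd τ hτ)) ∧
    -- the elements of `Y` are homogeneous, of the indicated weights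
    (∀ y : YIndex d m, ∃ n : ℕ+, (n : ℕ) = yWeight τ y ∧
      ∃ u : (freeMixedLie τ).comp n, yTotal hmd τ y = (freeMixedLie τ).of n u) ∧
    -- the numbers of elements in the families
    ({x | ∃ i, x = yPlus hmd τ hτ (.sq i)} ∪
      {x | ∃ i j h, x = yPlus hmd τ hτ (.br i j h)}).ncard = (m + 1).choose 2 ∧
    (∀ k : ℕ, 3 ≤ k →
      (Set.range fun s => yPlus hmd τ hτ (.adSq k s)).ncard = (k - 1) * m.choose (k - 1) ∧
      (Set.range fun s => yPlus hmd τ hτ (.ad k s)).ncard = (k - 1) * m.choose k ∧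
      (Set.range fun s => yPlus hmd τ hτ (.adMixed k s)).ncard = m.choose (k - 1) * (d - m)) ∧
    -- `B` is the free associative algebra over `𝔽₂[π]` on `Y`
    Function.Bijective (FreeAlgebra.lift (ZMod 2)[X] (yB hmd τ)) ∧
    -- `A` is a free `B`-module, as a left and as a right module, with basis the monomials
    (∃ b : Module.Basis (Fin m → Fin 2) (subalgebraB hmd τ) (FreeAlgebra (ZMod 2)[X] (Fin d)),
      ∀ e, b e = monomialXi hmd e) ∧
    Function.Bijective (fun c : (Fin m → Fin 2) → subalgebraB hmd τ =>
      ∑ e, monomialXi hmd e * (c e : FreeAlgebra (ZMod 2)[X] (Fin d))) := by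
  have hinj := yPlus_injective hmd hτ
  have hB := lift_yB_bijective hmd hτ
  have ncard_range : ∀ {α : Type} (f : α → YIndex d m), Function.Injective f →
      (Set.range fun s => yPlus hmd τ hτ (f s)).ncard = Nat.card α := by
    intro α f hf
    exact (Nat.card_coe_set_eq _).symm.trans (Nat.card_range_of_injective (hinj.comp hf))
  -- Every element of `B` is written as a polynomial in `Y`, so that relations with coefficients in
  -- `B` pull back to the free algebra, where injectivity is known.
  choose t ht using hB.2
  refine ⟨⟨lift_yPlus_injective hmd hτ, lift_yPlus_surjective hmd hτ⟩,
    yTotal_mem_range_of hmd hτ, ?_, fun k hk => ⟨?_, ?_, ?_⟩, hB, ?_, ?_, ?_⟩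
  · let f : Fin m ⊕ {p : Fin m × Fin m // p.1 < p.2} → YIndex d m :=
      Sum.elim YIndex.sq fun p => .br p.1.1 p.1.2 p.2
    have hf : Function.Injective f := by
      rintro (i | ⟨⟨i, j⟩, h⟩) (i' | ⟨⟨i', j'⟩, h'⟩) e <;> simp_all [f]
    have : ({x | ∃ i, x = yPlus hmd τ hτ (.sq i)} ∪
        {x | ∃ i j h, x = yPlus hmd τ hτ (.br i j h)}) = Set.range fun s => yPlus hmd τ hτ (f s) := by
      ext x
      constructor
      · rintro (⟨i, rfl⟩ | ⟨i, j, h, rfl⟩)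
        · exact ⟨.inl i, rfl⟩
        · exact ⟨.inr ⟨(i, j), h⟩, rfl⟩
      · rintro ⟨i | p, rfl⟩
        · exact Or.inl ⟨i, rfl⟩
        · exact Or.inr ⟨_, _, p.2, rfl⟩
    rw [this, ncard_range f hf, Nat.card_sum, card_lt, Nat.card_eq_fintype_card, Fintype.card_fin,
      Nat.choose_succ_succ, Nat.choose_one_right]
  · rw [ncard_range _ fun s s' h => by simpa using h, card_adSqIndex m k hk]
  · rw [ncard_range _ fun s s' h => by simpa using h, card_adIndex m k hk]
  · rw [ncard_range _ fun s s' h => by simpa using h, card_adMixedIndex d m k hk]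
  -- The left-module structure puts the coefficients before the monomials, so independence and
  -- spanning come from `liftMulMonomial`; the right-module statement below uses `monomialMulLift`.
  · have hli : LinearIndependent (subalgebraB hmd τ) (monomialXi (m := m) hmd) := by
      rw [Fintype.linearIndependent_iffₛ]
      intro f g hfg
      have hsum : ∀ g : (Fin m → Fin 2) → subalgebraB hmd τ,
          liftMulMonomial hmd (τ := τ) (fun e => t (g e)) = ∑ e, g e • monomialXi hmd e := by
        intro g
        rw [liftMulMonomial_apply]
        refine Finset.sum_congr rfl fun e _ => ?_
        rw [← val_lift_yB, ht]
        rfl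
      have h := (injective_monomialMul hmd hτ).2 ((hsum f).trans (hfg.trans (hsum g).symm))
      intro e
      rw [← ht (f e), ← ht (g e)]
      exact congrArg _ (congrFun h e)
    refine ⟨.mk hli fun a _ => ?_, fun e => Module.Basis.mk_apply _ _ e⟩
    obtain ⟨c, rfl⟩ := liftMulMonomial_surjective hmd hτ a
    rw [liftMulMonomial_apply]
    refine Submodule.sum_mem _ fun e _ => ?_
    rw [← val_lift_yB]
    exact Submodule.smul_mem _ (FreeAlgebra.lift (ZMod 2)[X] (yB hmd τ) (c e))
      (Submodule.subset_span ⟨e, rfl⟩)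
  · intro c c' h
    have h' : monomialMulLift hmd (τ := τ) (fun e => t (c e)) =
        monomialMulLift hmd (τ := τ) (fun e => t (c' e)) := by
      simpa only [monomialMulLift_apply, ← val_lift_yB, ht] using h
    funext e
    rw [← ht (c e), ← ht (c' e)]
    exact congrArg _ (congrFun ((injective_monomialMul hmd hτ).1 h') e)
  · intro a
    obtain ⟨c, rfl⟩ := monomialMulLift_surjective hmd hτ a
    refine ⟨fun e => FreeAlgebra.lift (ZMod 2)[X] (yB hmd τ) (c e), ?_⟩
    simp only [monomialMulLift_apply, val_lift_yB]
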